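/- Let $F$ be a perfect field and let $A$ be a central simple $F$-algebra of degree $n\in\{2,3\}$, that is, $\dim_F A=n^2$. For a commutative $F$-algebra $R$ let $\mathrm{Nrd}\colon A\otimes_F R\to R$ be the reduced norm, that is, the determinant in a splitting $A\otimes_F\overline F\cong M_n(\overline F)$, descended to $R$. Let $SB_n(M_2(A))$ be the generalized Severi–Brauer variety: the $F$-scheme whose $R$-points, for every commutative $F$-algebra $R$, are the right ideals of $M_2(A)\otimes_F R$ that are $R$-module direct summands, projective of rank $2n^2$ over $R$. Locally on the base such an ideal is of the form $[\alpha_1,\alpha_2]$, the set of matrices both of whose columns lie in the right module $\binom{\alpha_1}{\alpha_2}(A\otimes R)$, where the column $\binom{\alpha_1}{\alpha_2}$ is unique up to right multiplication by a unit of $A\otimes R$. Let $X_A\subset SB_n(M_2(A))$ be the closed subscheme defined by the equation $\mathrm{Nrd}(\alpha_1)=\mathrm{Nrd}(\alpha_2)$, that is, its $R$-points are the ideals $J$ such that this equation holds for every commutative $R$-algebra $S$ and every presentation $J_S=[\alpha_1,\alpha_2]$ over $S$. Let $SL_1(A)$ be the $F$-scheme with $R$-points $\{g\in(A\otimes_F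 R)^\times:\mathrm{Nrd}(g)=1\}$. Then these three functors are represented by $F$-schemes, with $X_A$ closed in $SB_n(M_2(A))$, and 1. $X_A$ is smooth over $F$; 2. the morphism $SL_1(A)\to X_A$, $g\mapsto[1,g]$, is an open immersion with dense image. -/

import Mathlib

open CategoryTheory AlgebraicGeometry TensorProduct

universe u

namespace SeveriBrauer

noncomputable section

section ReducedNorm

variable (F : Type u) [Field F] (A : Type u) [Ring A] [Algebra F A] (n : ℕ)

/-- A splitting of `A` over the algebraic closure of `F`: an isomorphism of the scalar extension
of `A` with the algebra of `n × n` matrices. -/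
abbrev Splitting : Type u :=
  (AlgebraicClosure F ⊗[F] A) ≃ₐ[AlgebraicClosure F]
    Matrix (Fin n) (Fin n) (AlgebraicClosure F)

variable {F A n}

/-- The algebra homomorphism `A ⊗ R → Mₙ(R ⊗ F̄)` obtained from a splitting of `A` by extending
scalars from `F` to a commutative `F`-algebra `R`. -/
def splittingHom (φ : Splitting F A n) (R : Type u) [CommRing R] [Algebra F R] :
    (R ⊗[F] A) →ₐ[R] Matrix (Fin n) (Fin n) (R ⊗[F] AlgebraicClosure F) :=
  Algebra.TensorProduct.lift
    (Algebra.ofId R (Matrix (Fin n) (Fin n) (R ⊗[F] AlgebraicClosure F)))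
    (((Algebra.TensorProduct.includeRight :
        AlgebraicClosure F →ₐ[F] R ⊗[F] AlgebraicClosure F).mapMatrix).comp
      ((φ.toAlgHom.restrictScalars F).comp
        (Algebra.TensorProduct.includeRight : A →ₐ[F] AlgebraicClosure F ⊗[F] A)))
    (by
      intro r a
      rw [Algebra.ofId_apply]
      exact Algebra.commute_algebraMap_left _ _)

theorem splittingHom_tmul (φ : Splitting F A n) (R : Type u) [CommRing R] [Algebra F R]
    (r : R) (a : A) (i j : Fin n) :
    splittingHom φ R (r ⊗ₜ[F] a) i j = r ⊗ₜ[F] φ (1 ⊗ₜ[F] a) i j := by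
  rw [splittingHom, Algebra.TensorProduct.lift_tmul, Algebra.ofId_apply, ← Algebra.smul_def]
  simp [TensorProduct.smul_tmul']

/-- The determinant of an element of `A ⊗ R` with respect to a splitting of `A`;
it lies in `R ⊗ F̄`. -/
def splittingDet (φ : Splitting F A n) {R : Type u} [CommRing R] [Algebra F R] (a : R ⊗[F] A) :
    R ⊗[F] AlgebraicClosure F :=
  (splittingHom φ R a).det

variable (n)

open Classical in
/-- The reduced norm `Nrd : A ⊗ R → R` of a central simple `F`-algebra `A` of degree `n`, for every
commutative `F`-algebra `R`: the determinant taken in a splitting of `A`, descended to `R`. It is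
the only element of `R` (viewed inside `R ⊗ F̄`) that equals the determinant in every splitting.
(For central simple `A` of degree `n` splittings exist, the determinant does not depend on the
splitting and lies in `R`, so the value `0` in the other case is never used.) -/
def reducedNorm {R : Type u} [CommRing R] [Algebra F R] (a : R ⊗[F] A) : R :=
  if h : Nonempty (Splitting F A n) ∧
      ∃ r : R, ∀ φ : Splitting F A n, splittingDet φ a = r ⊗ₜ[F] (1 : AlgebraicClosure F)
  then h.2.choose else 0

/-- The determinant in a splitting commutes with base change. -/
theorem splittingDet_map (φ : Splitting F A n) {R S : Type u} [CommRing R] [Algebra F R]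
    [CommRing S] [Algebra F S] (f : R →ₐ[F] S) (a : R ⊗[F] A) :
    splittingDet φ (Algebra.TensorProduct.map f (AlgHom.id F A) a) =
      Algebra.TensorProduct.map f (AlgHom.id F (AlgebraicClosure F)) (splittingDet φ a) := by
  have key : ((splittingHom φ S).restrictScalars F).comp
        (Algebra.TensorProduct.map f (AlgHom.id F A)) =
      ((Algebra.TensorProduct.map f (AlgHom.id F (AlgebraicClosure F))).mapMatrix).comp
        ((splittingHom φ R).restrictScalars F) := by
    apply Algebra.TensorProduct.ext
    · ext r i j
      simp [splittingHom_tmul]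
    · ext b i j
      simp [splittingHom_tmul]
  have h := DFunLike.congr_fun key a
  simp only [AlgHom.comp_apply, AlgHom.restrictScalars_apply] at h
  rw [splittingDet, h, splittingDet, AlgHom.map_det]

/-- If `Nrd(a) = 1` then `Nrd` of the image of `a` under a change of the base algebra is `1`. -/
theorem reducedNorm_map_eq_one {R S : Type u} [CommRing R] [Algebra F R] [CommRing S] [Algebra F S]
    (f : R →ₐ[F] S) {a : R ⊗[F] A} (ha : reducedNorm n a = 1) :
    reducedNorm n (Algebra.TensorProduct.map f (AlgHom.id F A) a) = 1 := by
  rcases subsingleton_or_nontrivial S with hS | hS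
  · exact Subsingleton.elim _ _
  have hR : Nontrivial R := f.toRingHom.domain_nontrivial
  have h : Nonempty (Splitting F A n) ∧
      ∃ r : R, ∀ φ : Splitting F A n, splittingDet φ a = r ⊗ₜ[F] (1 : AlgebraicClosure F) := by
    by_contra h
    rw [reducedNorm, dif_neg h] at ha
    exact zero_ne_one ha
  have h1 : ∀ φ : Splitting F A n, splittingDet φ a = 1 := fun φ => by
    rw [reducedNorm, dif_pos h] at ha
    rw [h.2.choose_spec φ, ha, Algebra.TensorProduct.one_def]
  have h2 : ∀ φ : Splitting F A n,
      splittingDet φ (Algebra.TensorProduct.map f (AlgHom.id F A) a) = 1 := fun φ => by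
    rw [splittingDet_map, h1, map_one]
  have h' : Nonempty (Splitting F A n) ∧ ∃ r : S, ∀ φ : Splitting F A n,
      splittingDet φ (Algebra.TensorProduct.map f (AlgHom.id F A) a) =
        r ⊗ₜ[F] (1 : AlgebraicClosure F) :=
    ⟨h.1, 1, fun φ => by rw [h2, Algebra.TensorProduct.one_def]⟩
  obtain ⟨φ⟩ := h.1
  rw [reducedNorm, dif_pos h']
  refine Algebra.TensorProduct.includeLeft_injective (R := F) (S := F)
    (B := AlgebraicClosure F) (algebraMap F (AlgebraicClosure F)).injective ?_
  rw [map_one, ← h2 φ, h'.2.choose_spec φ, Algebra.TensorProduct.includeLeft_apply]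

end ReducedNorm

section Functors

variable (F : Type u) [Field F]

/-- The functor of points, restricted to commutative `F`-algebras `R`, of a scheme `X` over `F`:
`R ↦ X(R)`, the set of `F`-morphisms `Spec R ⟶ X`. -/
abbrev functorOfPoints (X : Over (Spec (.of F))) : CommAlgCat.{u} F ⥤ Type u :=
  (algSpec (.of F)).rightOp ⋙ yoneda.obj X

/-- The functor `R ↦ A ⊗ R`. -/
@[simps]
def scalarExtension (A : Type u) [Ring A] [Algebra F A] : CommAlgCat.{u} F ⥤ Type u where
  obj R := R ⊗[F] A
  map f := ↾(Algebra.TensorProduct.map f.hom (AlgHom.id F A))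
  map_id R := by
    ext x; simp
  map_comp f g := by
    ext x
    change Algebra.TensorProduct.map (g.hom.comp f.hom) (AlgHom.id F A) x = _
    rw [← AlgHom.id_comp (AlgHom.id F A), Algebra.TensorProduct.map_comp]
    rfl

/-- The group functor `SL₁(A)`: its `R`-points are the units of `A ⊗ R` of reduced norm `1`. Here
`A` is a central simple algebra of degree `n`. -/
def specialLinear (A : Type u) [Ring A] [Algebra F A] (n : ℕ) :
    Subfunctor (scalarExtension F A) where
  obj R := {g | IsUnit (show R ⊗[F] A from g) ∧ reducedNorm n (show R ⊗[F] A from g) = 1}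
  map f := by
    rintro g ⟨hg, hg'⟩
    exact ⟨hg.map (Algebra.TensorProduct.map f.hom (AlgHom.id F A)),
      reducedNorm_map_eq_one n f.hom hg'⟩

/-- A submodule of a ring that is stable under right multiplication. -/
def IsRightIdeal {R B : Type u} [CommRing R] [Ring B] [Algebra R B] (J : Submodule R B) : Prop :=
  ∀ x ∈ J, ∀ b : B, x * b ∈ J

variable {F} in
theorem IsRightIdeal.grassmannian_map {B : Type u} [Ring B] [Algebra F B] {m : ℕ}
    {R S : Type u} [CommRing R] [Algebra F R] [CommRing S] [Algebra F S] (f : R →ₐ[F] S)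
    {J : Module.Grassmannian R (R ⊗[F] B) m} (hJ : IsRightIdeal J.toSubmodule) :
    IsRightIdeal (Module.Grassmannian.map f J).toSubmodule := by
  let : Algebra R S := f.toAlgebra
  have : IsScalarTower F R S :=
    IsScalarTower.of_algebraMap_eq' <| IsScalarTower.algebraMap_eq F R S
  intro x hx b
  rw [Module.Grassmannian.map_toSubmodule] at hx ⊢
  set q := Module.Grassmannian.baseChangeMkQ S J.toSubmodule with hq
  rw [LinearMap.mem_ker] at hx ⊢
  induction b with
  | zero => simp
  | add b c hb hc => rw [mul_add, map_add, hb, hc, add_zero]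
  | tmul s b =>
    let r : R ⊗[F] B →ₗ[R] R ⊗[F] B := LinearMap.mulRight R ((1 : R) ⊗ₜ[F] b)
    have hr : J.toSubmodule ≤ J.toSubmodule.comap r := by
      intro y hy
      rw [Submodule.mem_comap]
      exact hJ y hy _
    let rQ := Submodule.mapQ J.toSubmodule J.toSubmodule r hr
    have key : q ∘ₗ LinearMap.mulRight S ((1 : S) ⊗ₜ[F] b) = rQ.baseChange S ∘ₗ q := by
      ext c
      simp [hq, Module.Grassmannian.baseChangeMkQ, rQ, r]
    have h := LinearMap.congr_fun key x
    simp only [LinearMap.comp_apply, LinearMap.mulRight_apply, hx, map_zero] at h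
    have hs : (s ⊗ₜ[F] b : S ⊗[F] B) = s • ((1 : S) ⊗ₜ[F] b) := by
      rw [TensorProduct.smul_tmul', smul_eq_mul, mul_one]
    rw [hs, mul_smul_comm, map_smul, h, smul_zero]

/-- The functor of the generalized Severi–Brauer variety `SB_k(B)` of a central simple algebra `B`
of degree `d`: its `R`-points are the right ideals of `B ⊗ R` that are projective direct summands
of rank `k d` over `R`, that is, whose quotient is a projective `R`-module of rank `d² - k d`. It is
a subfunctor of the Grassmannian functor of the vector space `B`. -/
def severiBrauer (B : Type u) [Ring B] [Algebra F B] (d k : ℕ) :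
    Subfunctor (Module.Grassmannian.functor (R := F) (M := B) (d ^ 2 - k * d) :
      CommAlgCat.{u} F ⥤ Type u) where
  obj _ := {J | IsRightIdeal (Module.Grassmannian.toSubmodule J)}
  map f := fun _ hJ => IsRightIdeal.grassmannian_map f.hom hJ

variable {F} {A : Type u} [Ring A] [Algebra F A]

/-- The matrix with first column `(α₁, α₂)` and second column `0`, as an element of
`M₂(A) ⊗ R = M₂(A ⊗ R)`. -/
def column {R : Type u} [CommRing R] [Algebra F R] (α₁ α₂ : R ⊗[F] A) :
    R ⊗[F] Matrix (Fin 2) (Fin 2) A :=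
  (Matrix.singleLinearMap F 0 0).baseChange R α₁ + (Matrix.singleLinearMap F 1 0).baseChange R α₂

/-- The right ideal `[α₁, α₂]` of `M₂(A) ⊗ R` attached to a column `(α₁, α₂)`: the matrices both
of whose columns lie in the right `A ⊗ R`-module generated by `(α₁, α₂)`. It is the right ideal
generated by the matrix with columns `(α₁, α₂)` and `0`. -/
def columnIdeal {R : Type u} [CommRing R] [Algebra F R] (α₁ α₂ : R ⊗[F] A) :
    Submodule R (R ⊗[F] Matrix (Fin 2) (Fin 2) A) :=
  LinearMap.range (LinearMap.mulLeft R (column α₁ α₂))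

variable (F A)

/-- The functor of the closed subvariety `X_A` of `SB_n(M₂(A))` given by the equation
`Nrd(α₁) = Nrd(α₂)`, where `A` is central simple of degree `n`. A point of `SB_n(M₂(A))` is, locally
on the base, of the form `[α₁, α₂]` with `(α₁, α₂)` unique up to right multiplication by a unit of
`A ⊗ R`, and the equation has to hold in every such presentation. -/
def normSection (n : ℕ) :
    Subfunctor (severiBrauer F (Matrix (Fin 2) (Fin 2) A) (2 * n) n).toFunctor where
  obj R := {J | ∀ (S : CommAlgCat.{u} F) (f : R ⟶ S) (α₁ α₂ : S ⊗[F] A),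
    (Module.Grassmannian.map f.hom J.1).toSubmodule = columnIdeal α₁ α₂ →
      reducedNorm n α₁ = reducedNorm n α₂}
  map f := by
    intro J hJ T g α₁ α₂ h
    refine hJ T (f ≫ g) α₁ α₂ ?_
    rw [← h]
    exact congrArg Module.Grassmannian.toSubmodule (Module.Grassmannian.map_comp _ f.hom g.hom J.1)

end Functors

end

end SeveriBrauer

/-! Everything is computed in charts indexed by g ∈ GL₂(A): the chart of g is the affine space of A,
with x corresponding to the ideal [g(1, x)]. A surjection of finite projective modules of equal rank
is injective, so two points of the Grassmannian, one contained in the other, coincide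
(`grassmannian_eq_of_le`). Hence an ideal containing the column g(1, x) is that point, and the chart
of h meets the chart of g where the first entry of g⁻¹h(1, y) is a unit, a basic open set
(`isUnit_transitionEntry_iff`). The charts cover (`severiBrauer_locallyCovered`): over an
algebraically closed field a permutation matrix of size 2n gives a suitable complement. If F is
infinite it can be replaced by some g ∈ GL₂(A) by density of rational points; if F is finite, A is
split and the permutation matrix is already rational. A Zariski sheaf with such an atlas is a scheme
(`IsAtlas.exists_scheme`).

F̄/F is Galois because F is perfect, so the determinant in a splitting descends and the reduced norm
is multiplicative and compatible with base change. The equation of X_A is therefore independent of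
the presentation, and in the chart of g it is the single equation Nrd(α) = Nrd(β) with (α, β) = g(1,
x). This makes X_A closed, and its chart at g = 1 is exactly SL₁(A), whence the open immersion.

Smoothness is the Jacobian criterion. At a geometric point where the differential vanishes, (adj α,
−adj β) annihilates the invertible block matrix g, so adj α = adj β = 0 and both ranks are at most n
− 2. But some combination H₀₀α + H₀₁β equals 1, which forces n ≤ 2(n − 2); this is false for n ∈ {2,
3} (`false_of_adjugate_mul_eq`).

For density, a point with α and β singular is deformed over K⟦X⟧: α and β lift independently to
matrices with the same nonzero determinant (`exists_powerSeries_point`). Hence every point of X_A is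
a specialization of a point whose first entry is invertible, that is, of a point of SL₁(A). -/

namespace SeveriBrauer

noncomputable section

/-! ### Zariski sheaves on commutative algebras and locally covered functors -/

section ZariskiSheaf

variable {F : Type u} [Field F]

/-- The localization of an `F`-algebra at an element. -/
abbrev away (R : CommAlgCat.{u} F) (f : R) : CommAlgCat.{u} F := .of F (Localization.Away f)

/-- The localization map. -/
def toAway (R : CommAlgCat.{u} F) (f : R) : R ⟶ away R f :=
  CommAlgCat.ofHom (IsScalarTower.toAlgHom F R (Localization.Away f))

theorem isUnit_toAway (R : CommAlgCat.{u} F) (f : R) : IsUnit (toAway R f f) :=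
  IsLocalization.Away.algebraMap_isUnit f

/-- The morphism out of a localization defined by a morphism inverting the element. -/
def awayLift {R S : CommAlgCat.{u} F} (f : R) (a : R ⟶ S) (h : IsUnit (a f)) : away R f ⟶ S :=
  CommAlgCat.ofHom
    { IsLocalization.Away.lift (S := Localization.Away f) f (g := a.hom.toRingHom) h with
      commutes' := fun r => by
        have := IsLocalization.Away.lift_eq (S := Localization.Away f) f (g := a.hom.toRingHom) h
          (algebraMap F R r)
        rw [← IsScalarTower.algebraMap_apply] at this
        exact this.trans (a.hom.commutes r) }

@[simp]
theorem toAway_awayLift {R S : CommAlgCat.{u} F} (f : R) (a : R ⟶ S) (h : IsUnit (a f)) :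
    toAway R f ≫ awayLift f a h = a := by
  ext x
  exact IsLocalization.Away.lift_eq (S := Localization.Away f) f (g := a.hom.toRingHom) h x

theorem away_hom_ext {R S : CommAlgCat.{u} F} (f : R) {a b : away R f ⟶ S}
    (h : toAway R f ≫ a = toAway R f ≫ b) : a = b := by
  have h2 : a.hom.toRingHom = b.hom.toRingHom :=
    IsLocalization.ringHom_ext (Submonoid.powers f)
      (RingHom.ext fun x => ConcreteCategory.congr_hom h x)
  exact CommAlgCat.hom_ext (AlgHom.ext fun x => DFunLike.congr_fun h2 x)

/-- A functor on commutative `F`-algebras is a Zariski sheaf if its elements can be glued uniquely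
along finite covers of affine schemes by basic open subschemes. -/
structure IsZariskiSheaf (P : CommAlgCat.{u} F ⥤ Type u) : Prop where
  ext : ∀ (R : CommAlgCat.{u} F) {ι : Type u} [Finite ι] (f : ι → R),
    Ideal.span (Set.range f) = ⊤ → ∀ x y : P.obj R,
      (∀ i, P.map (toAway R (f i)) x = P.map (toAway R (f i)) y) → x = y
  glue : ∀ (R : CommAlgCat.{u} F) {ι : Type u} [Finite ι] (f : ι → R),
    Ideal.span (Set.range f) = ⊤ → ∀ x : ∀ i, P.obj (away R (f i)),
      (∀ i j (S : CommAlgCat.{u} F) (a : away R (f i) ⟶ S) (b : away R (f j) ⟶ S),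
        toAway R (f i) ≫ a = toAway R (f j) ≫ b → P.map a (x i) = P.map b (x j)) →
      ∃ y, ∀ i, P.map (toAway R (f i)) y = x i

/-- Locally every element of `P` comes from one of the elements `u i`. -/
def LocallyCovered (P : CommAlgCat.{u} F ⥤ Type u) {I : Type*} (B : I → CommAlgCat.{u} F)
    (e : ∀ i, P.obj (B i)) : Prop :=
  ∀ (R : CommAlgCat.{u} F) (s : P.obj R) (p : PrimeSpectrum R), ∃ f ∉ p.asIdeal,
    ∃ (i : I) (ψ : B i ⟶ away R f), P.map (toAway R f) s = P.map ψ (e i)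

/-- No maximal ideal contains all elements satisfying Q, so finitely many of them generate the unit
ideal. -/
theorem exists_finite_cover {R : Type u} [CommRing R] {Q : R → Prop}
    (h : ∀ p : PrimeSpectrum R, ∃ f ∉ p.asIdeal, Q f) :
    ∃ (ι : Type u) (_ : Finite ι) (f : ι → R), Ideal.span (Set.range f) = ⊤ ∧ ∀ i, Q (f i) := by
  have h1 : Ideal.span {f | Q f} = ⊤ := by
    by_contra hne
    obtain ⟨m, hm, hle⟩ := Ideal.exists_le_maximal _ hne
    obtain ⟨f, hf, hQ⟩ := h ⟨m, hm.isPrime⟩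
    exact hf (hle (Ideal.subset_span hQ))
  rw [Ideal.span_eq_top_iff_finite] at h1
  obtain ⟨t, ht, h2⟩ := h1
  refine ⟨t, inferInstance, fun i => i.1, ?_, fun i => ht i.2⟩
  simpa using h2

theorem span_range_map {R S : CommAlgCat.{u} F} (a : R ⟶ S) {ι : Type u} {f : ι → R}
    (h : Ideal.span (Set.range f) = ⊤) : Ideal.span (Set.range fun i => a (f i)) = ⊤ := by
  have h2 := congrArg (Ideal.map a.hom.toRingHom) h
  rw [Ideal.map_span, Ideal.map_top, ← Set.range_comp] at h2
  exact h2

/-- The morphism of localizations induced by a morphism of algebras. -/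
def awayMap {R S : CommAlgCat.{u} F} (a : R ⟶ S) (f : R) : away R f ⟶ away S (a f) :=
  awayLift f (a ≫ toAway S (a f)) (isUnit_toAway S (a f))

@[simp]
theorem toAway_awayMap {R S : CommAlgCat.{u} F} (a : R ⟶ S) (f : R) :
    toAway R f ≫ awayMap a f = a ≫ toAway S (a f) :=
  toAway_awayLift _ _ _

section Transport

variable {P P' : CommAlgCat.{u} F ⥤ Type u} {I : Type*} {B : I → CommAlgCat.{u} F}
  {e : ∀ i, P.obj (B i)}

theorem natTrans_ext_of_locallyCovered (hP' : IsZariskiSheaf P') (hcov : LocallyCovered P B e)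
    {η θ : P ⟶ P'} (h : ∀ i, η.app _ (e i) = θ.app _ (e i)) : η = θ := by
  ext R s
  obtain ⟨ι, _, f, hf, hQ⟩ := exists_finite_cover (hcov R s)
  refine hP'.ext R f hf _ _ fun k => ?_
  obtain ⟨i, ψ, hψ⟩ := hQ k
  change P'.map _ (η.app R s) = P'.map _ (θ.app R s)
  rw [← NatTrans.naturality_apply, ← NatTrans.naturality_apply, hψ, NatTrans.naturality_apply,
    NatTrans.naturality_apply, h]

/-- A locally covered functor behaves like a sheaf quotient of its charts: a transformation to a
sheaf is determined by images of the `e i` that respect all coincidences between their pullbacks. -/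
theorem exists_natTrans_of_locallyCovered (hP' : IsZariskiSheaf P') (hcov : LocallyCovered P B e)
    (e' : ∀ i, P'.obj (B i))
    (hrel : ∀ (R : CommAlgCat.{u} F) (i j : I) (φ : B i ⟶ R) (ψ : B j ⟶ R),
      P.map φ (e i) = P.map ψ (e j) → P'.map φ (e' i) = P'.map ψ (e' j)) :
    ∃ η : P ⟶ P', ∀ i, η.app _ (e i) = e' i := by
  -- The property is asked for all pullbacks of s, not only for the cover used in the gluing. This
  -- makes s' unique, and uniqueness gives naturality.
  have key : ∀ (R : CommAlgCat.{u} F) (s : P.obj R), ∃ s' : P'.obj R,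
      ∀ (S : CommAlgCat.{u} F) (a : R ⟶ S) (i : I) (ψ : B i ⟶ S),
        P.map a s = P.map ψ (e i) → P'.map a s' = P'.map ψ (e' i) := by
    intro R s
    obtain ⟨ι, _, f, hf, hQ⟩ := exists_finite_cover (hcov R s)
    choose k ψ hψ using hQ
    obtain ⟨s', hs'⟩ := hP'.glue R f hf (fun i => P'.map (ψ i) (e' (k i))) (by
      intro i j S a b hab
      rw [← Functor.map_comp_apply, ← Functor.map_comp_apply]
      apply hrel
      rw [Functor.map_comp_apply, Functor.map_comp_apply, ← hψ, ← hψ, ← Functor.map_comp_apply,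
        ← Functor.map_comp_apply, hab])
    refine ⟨s', fun S a i χ h => hP'.ext S _ (span_range_map a hf) _ _ fun l => ?_⟩
    rw [← Functor.map_comp_apply, ← Functor.map_comp_apply, ← toAway_awayMap,
      Functor.map_comp_apply, hs', ← Functor.map_comp_apply]
    apply hrel
    rw [Functor.map_comp_apply, ← hψ, ← Functor.map_comp_apply, toAway_awayMap,
      Functor.map_comp_apply, h, ← Functor.map_comp_apply]
  have uniq : ∀ (R : CommAlgCat.{u} F) (s : P.obj R) (x y : P'.obj R),
      (∀ (S : CommAlgCat.{u} F) (a : R ⟶ S) (i : I) (ψ : B i ⟶ S),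
        P.map a s = P.map ψ (e i) → P'.map a x = P'.map ψ (e' i)) →
      (∀ (S : CommAlgCat.{u} F) (a : R ⟶ S) (i : I) (ψ : B i ⟶ S),
        P.map a s = P.map ψ (e i) → P'.map a y = P'.map ψ (e' i)) → x = y := by
    intro R s x y hx hy
    obtain ⟨ι, _, f, hf, hQ⟩ := exists_finite_cover (hcov R s)
    refine hP'.ext R f hf _ _ fun l => ?_
    obtain ⟨i, ψ, hψ⟩ := hQ l
    rw [hx _ _ _ _ hψ, hy _ _ _ _ hψ]
  choose G hG using key
  refine ⟨{ app := fun R => ↾(G R), naturality := ?_ }, ?_⟩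
  · intro R S a
    ext s
    refine uniq S (P.map a s) _ _ (hG S _) ?_
    intro T b i ψ h
    simp only [← Functor.map_comp_apply] at h
    have := hG R s T (a ≫ b) i ψ h
    rw [Functor.map_comp_apply] at this
    exact this
  · intro i
    have := hG _ (e i) _ (𝟙 _) i (𝟙 _) rfl
    simpa using this

end Transport

end ZariskiSheaf

/-! ### Affine schemes over F; functors of points are Zariski sheaves -/

section Spectrum

open Limits Opposite

variable {F : Type u} [Field F]

/-- The spectrum of an `F`-algebra as a scheme over `F`. -/
abbrev specOver (R : CommAlgCat.{u} F) : Over (Spec (.of F)) := (algSpec (.of F)).obj (op R)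

/-- The morphism of spectra over `F` induced by a morphism of `F`-algebras. -/
abbrev specMap {R S : CommAlgCat.{u} F} (a : R ⟶ S) : specOver S ⟶ specOver R :=
  (algSpec (.of F)).map a.op

theorem specMap_comp {R S T : CommAlgCat.{u} F} (a : R ⟶ S) (b : S ⟶ T) :
    specMap (a ≫ b) = specMap b ≫ specMap a := by
  simp [specMap]

theorem functorOfPoints_map (X : Over (Spec (.of F))) {R S : CommAlgCat.{u} F} (a : R ⟶ S)
    (x : specOver R ⟶ X) : (functorOfPoints F X).map a x = specMap a ≫ x := rfl

theorem specMap_injective {R S : CommAlgCat.{u} F} {a b : R ⟶ S} (h : specMap a = specMap b) :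
    a = b :=
  Quiver.Hom.op_inj ((algSpec.instFaithful (R := .of F)).map_injective h)

theorem exists_specMap_eq {R S : CommAlgCat.{u} F} (x : specOver S ⟶ specOver R) :
    ∃ a : R ⟶ S, specMap a = x := by
  obtain ⟨a, ha⟩ := (algSpec.instFull (R := .of F)).map_surjective x
  exact ⟨a.unop, ha⟩

instance isOpenImmersion_specMap_toAway (R : CommAlgCat.{u} F) (f : R) :
    IsOpenImmersion (specMap (toAway R f)).left :=
  IsOpenImmersion.of_isLocalization (S := Localization.Away f) f

theorem range_specMap_toAway (R : CommAlgCat.{u} F) (f : R) :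
    Set.range (specMap (toAway R f)).left = (PrimeSpectrum.basicOpen f : Set (PrimeSpectrum R)) :=
  PrimeSpectrum.localization_away_comap_range (Localization.Away f) f

theorem functorOfPoints_isZariskiSheaf (X : Over (Spec (.of F))) :
    IsZariskiSheaf (functorOfPoints F X) where
  ext R ι _ f hf x y h := by
    apply Over.OverMorphism.ext
    refine (Scheme.affineOpenCoverOfSpanRangeEqTop (R := .of R) f hf).openCover.hom_ext _ _ ?_
    intro i
    exact congrArg Over.Hom.left (h i)
  glue R ι _ f hf x hx := by
    let U := (Scheme.affineOpenCoverOfSpanRangeEqTop (R := .of R) f hf).openCover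
    have hU : ∀ i j, pullback.fst (U.f i) (U.f j) ≫ (x i).left = pullback.snd _ _ ≫ (x j).left := by
      intro i j
      -- Compatibility over all test algebras is needed only over this one, whose spectrum is the
      -- intersection of the two basic open sets.
      let S : CommAlgCat.{u} F := .of F (Localization.Away (f i) ⊗[R] Localization.Away (f j))
      let a : away R (f i) ⟶ S := CommAlgCat.ofHom
        ((Algebra.TensorProduct.includeLeft (R := R) (S := R) (A := Localization.Away (f i))
          (B := Localization.Away (f j))).restrictScalars F)
      let b : away R (f j) ⟶ S := CommAlgCat.ofHom
        ((Algebra.TensorProduct.includeRight (R := R) (A := Localization.Away (f i))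
          (B := Localization.Away (f j))).restrictScalars F)
      have hab : toAway R (f i) ≫ a = toAway R (f j) ≫ b := by
        ext r
        exact (AlgHom.commutes (Algebra.TensorProduct.includeLeft (R := R) (S := R)
          (A := Localization.Away (f i)) (B := Localization.Away (f j))) r).trans
          (AlgHom.commutes (Algebra.TensorProduct.includeRight (R := R)
          (A := Localization.Away (f i)) (B := Localization.Away (f j))) r).symm
      have h := congrArg Over.Hom.left (hx i j S a b hab)
      refine (cancel_epi
        (pullbackSpecIso R (Localization.Away (f i)) (Localization.Away (f j))).inv).1 ?_
      have h1 := pullbackSpecIso_inv_fst R (Localization.Away (f i)) (Localization.Away (f j))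
      have h2 := pullbackSpecIso_inv_snd R (Localization.Away (f i)) (Localization.Away (f j))
      refine (Category.assoc _ _ _).symm.trans (Eq.trans ?_ (Category.assoc _ _ _))
      exact (congrArg (· ≫ (x i).left) h1).trans (Eq.trans h (congrArg (· ≫ (x j).left) h2).symm)
    refine ⟨Over.homMk (U.glueMorphisms (fun i => (x i).left) hU) ?_, fun i => ?_⟩
    · refine U.hom_ext _ _ fun i => ?_
      refine (Category.assoc _ _ _).symm.trans ?_
      refine (congrArg (· ≫ X.hom) (U.ι_glueMorphisms (fun i => (x i).left) hU i)).trans ?_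
      exact (Over.w (x i)).trans (Over.w (specMap (toAway R (f i)))).symm
    · apply Over.OverMorphism.ext
      exact U.ι_glueMorphisms (fun i => (x i).left) hU i

end Spectrum

/-! ### Representability of a Zariski sheaf with an affine atlas -/

section Atlas

open Limits Opposite

variable {F : Type u} [Field F]

/-- An atlas of a functor on commutative `F`-algebras: elements `e i` over algebras `B i` which
define affine charts, such that the overlap of two charts is a basic open subset of each and such
that the charts cover the functor Zariski locally. -/
structure IsAtlas (P : CommAlgCat.{u} F ⥤ Type u) {I : Type u} (B : I → CommAlgCat.{u} F)
    (e : ∀ i, P.obj (B i)) : Prop where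
  mono : ∀ i (R : CommAlgCat.{u} F) (φ ψ : B i ⟶ R), P.map φ (e i) = P.map ψ (e i) → φ = ψ
  overlap : ∀ i j, ∃ d : B i, ∀ (R : CommAlgCat.{u} F) (φ : B i ⟶ R),
    IsUnit (φ d) ↔ ∃ ψ : B j ⟶ R, P.map φ (e i) = P.map ψ (e j)
  cov : LocallyCovered P B e

/-- A basic open subset of one of the charts `B i`. -/
structure Chart (P : CommAlgCat.{u} F ⥤ Type u) {I : Type u} (B : I → CommAlgCat.{u} F)
    (e : ∀ i, P.obj (B i)) : Type u where
  /-- the index of the chart -/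
  idx : I
  /-- the element defining the basic open subset -/
  elt : B idx

variable {P : CommAlgCat.{u} F ⥤ Type u} {I : Type u} {B : I → CommAlgCat.{u} F}
  {e : ∀ i, P.obj (B i)}

namespace Chart

/-- The coordinate ring of a basic open subset of a chart. -/
abbrev ring (a : Chart P B e) : CommAlgCat.{u} F := away (B a.idx) a.elt

/-- The canonical element over a basic open subset of a chart. -/
def point (a : Chart P B e) : P.obj a.ring := P.map (toAway (B a.idx) a.elt) (e a.idx)

instance : Category (Chart P B e) where
  Hom a b := {φ : b.ring ⟶ a.ring // P.map φ b.point = a.point}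
  id a := ⟨𝟙 _, by simp⟩
  comp f g := ⟨g.1 ≫ f.1, by rw [Functor.map_comp_apply, g.2, f.2]⟩

variable (P B e) in
/-- The diagram of the basic open subsets of all charts. -/
def diagram : Chart P B e ⥤ Over (Spec (.of F)) where
  obj a := specOver a.ring
  map f := specMap f.1
  map_id a := by
    change specMap (𝟙 _) = _
    simp [specMap]
  map_comp f g := specMap_comp _ _

end Chart

theorem isOpenImmersion_specMap_of_isIso {R S : CommAlgCat.{u} F} (a : R ⟶ S) [IsIso a] :
    IsOpenImmersion (specMap a).left := by
  have : IsIso (specMap a) := inferInstanceAs (IsIso ((algSpec (.of F)).map a.op))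
  have : IsIso (specMap a).left := inferInstanceAs (IsIso ((Over.forget _).map (specMap a)))
  exact .of_isIso _

theorem exists_comp_eq_of_range_subset {X Y Z : Over (Spec (.of F))} (k : Y ⟶ X)
    [IsOpenImmersion k.left] (s : Z ⟶ X) (h : Set.range s.left ⊆ Set.range k.left) :
    ∃ t : Z ⟶ Y, t ≫ k = s := by
  refine ⟨Over.homMk (IsOpenImmersion.lift k.left s.left h) ?_, ?_⟩
  · rw [← Over.w k, IsOpenImmersion.lift_fac_assoc, Over.w]
  · apply Over.OverMorphism.ext
    exact IsOpenImmersion.lift_fac _ _ _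

theorem exists_comp_toAway_range_subset {X : Over (Spec (.of F))} {R : CommAlgCat.{u} F}
    (s : specOver R ⟶ X) {U : Set X.left} (hU : IsOpen U) (p : PrimeSpectrum R)
    (hp : s.left p ∈ U) :
    ∃ f ∉ p.asIdeal, Set.range (specMap (toAway R f) ≫ s).left ⊆ U := by
  obtain ⟨_, ⟨_, ⟨f, rfl⟩, rfl⟩, hpf, hf⟩ :=
    (PrimeSpectrum.isBasis_basic_opens (R := R)).exists_subset_of_mem_open (u := s.left ⁻¹' U) hp
      (hU.preimage s.left.continuous)
  refine ⟨f, hpf, ?_⟩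
  rintro _ ⟨q, rfl⟩
  have : (specMap (toAway R f)).left q ∈ (PrimeSpectrum.basicOpen f : Set (PrimeSpectrum R)) := by
    rw [← range_specMap_toAway]
    exact ⟨q, rfl⟩
  exact hf this

namespace IsAtlas

variable (h : IsAtlas P B e)
include h

/-- Up to an isomorphism `β`, the morphism g is a composite of two localizations: at the equation d'
of the overlap with chart i, then at the image χ d of d under the transition map. -/
theorem isOpenImmersion_specMap {i j : I} {d : B i} (g : B j ⟶ away (B i) d)
    (hg : P.map g (e j) = P.map (toAway (B i) d) (e i)) : IsOpenImmersion (specMap g).left := by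
  obtain ⟨d', hd'⟩ := h.overlap j i
  obtain ⟨χ, hχ⟩ := (hd' _ (toAway (B j) d')).1 (isUnit_toAway _ _)
  let α : away (B j) d' ⟶ away (B i) d := awayLift d' g ((hd' _ g).2 ⟨_, hg⟩)
  have hχα : χ ≫ α = toAway (B i) d := by
    apply h.mono
    rw [Functor.map_comp_apply, ← hχ, ← Functor.map_comp_apply, toAway_awayLift, hg]
  let β : away (away (B j) d') (χ d) ⟶ away (B i) d := awayLift (χ d) α (by
    change IsUnit ((χ ≫ α) d)
    rw [hχα]
    exact isUnit_toAway _ _)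
  let γ : away (B i) d ⟶ away (away (B j) d') (χ d) :=
    awayLift d (χ ≫ toAway _ _) (isUnit_toAway _ (χ d))
  have hα : toAway (B j) d' ≫ α = g := toAway_awayLift _ _ _
  have hβ : toAway _ (χ d) ≫ β = α := toAway_awayLift _ _ _
  have hγ : toAway (B i) d ≫ γ = χ ≫ toAway _ (χ d) := toAway_awayLift _ _ _
  have h1 : γ ≫ β = 𝟙 _ := by
    apply away_hom_ext
    rw [reassoc_of% hγ, hβ, hχα, Category.comp_id]
  have h2 : β ≫ γ = 𝟙 _ := by
    apply away_hom_ext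
    rw [reassoc_of% hβ, Category.comp_id]
    apply away_hom_ext
    rw [reassoc_of% hα]
    apply h.mono
    rw [Functor.map_comp_apply, hg, ← Functor.map_comp_apply, hγ,
      Functor.map_comp_apply, ← hχ, ← Functor.map_comp_apply]
  have : IsIso β := ⟨γ, h2, h1⟩
  have := isOpenImmersion_specMap_of_isIso β
  have hfac : g = toAway (B j) d' ≫ toAway _ (χ d) ≫ β := by
    rw [hβ, hα]
  have := isOpenImmersion_specMap_toAway (B j) d'
  have := isOpenImmersion_specMap_toAway (away (B j) d') (χ d)
  rw [hfac, specMap_comp, specMap_comp, Over.comp_left, Over.comp_left]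
  infer_instance

theorem isOpenImmersion_diagram_map {a b : Chart P B e} (f : a ⟶ b) :
    IsOpenImmersion ((Chart.diagram P B e).map f).left := by
  have h1 : IsOpenImmersion ((specMap f.1).left ≫ (specMap (toAway (B b.idx) b.elt)).left) := by
    rw [← Over.comp_left, ← specMap_comp]
    apply h.isOpenImmersion_specMap
    rw [Functor.map_comp_apply]
    exact f.2
  have := isOpenImmersion_specMap_toAway (B b.idx) b.elt
  exact @IsOpenImmersion.of_comp _ _ _ (specMap f.1).left _ this h1

/-- Around a common point, two open subsets of a chart contain a common basic open subset of that
chart, which is again an object of the diagram. -/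
theorem isLocallyDirected_diagram :
    ((Chart.diagram P B e ⋙ Over.forget _) ⋙ Scheme.forget).IsLocallyDirected where
  cond {i j k} fi fj xi xj hx := by
    let q := toAway (B k.idx) k.elt
    have hopen : ∀ {l : Chart P B e} (f : l ⟶ k), IsOpenImmersion (specMap (q ≫ f.1)).left := by
      intro l f
      apply h.isOpenImmersion_specMap
      rw [Functor.map_comp_apply]
      exact f.2
    have hi := hopen fi
    have hj := hopen fj
    have hx' : (specMap (q ≫ fi.1)).left xi = (specMap (q ≫ fj.1)).left xj :=
      congrArg (specMap q).left hx
    obtain ⟨_, ⟨_, ⟨c, rfl⟩, rfl⟩, hyc, hc⟩ :=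
      (PrimeSpectrum.isBasis_basic_opens (R := B k.idx)).exists_subset_of_mem_open
        (u := Set.range (specMap (q ≫ fi.1)).left ∩ Set.range (specMap (q ≫ fj.1)).left)
        (a := (specMap (q ≫ fi.1)).left xi) ⟨⟨xi, rfl⟩, ⟨xj, hx'.symm⟩⟩
        (hi.isOpen_range.inter hj.isOpen_range)
    let l : Chart P B e := ⟨k.idx, c⟩
    have hl : Set.range (specMap (toAway (B k.idx) c)).left =
        (PrimeSpectrum.basicOpen c : Set (PrimeSpectrum (B k.idx))) := range_specMap_toAway _ _
    have lift : ∀ {m : Chart P B e} (f : m ⟶ k),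
        Set.range (specMap (toAway (B k.idx) c)).left ⊆ Set.range (specMap (q ≫ f.1)).left →
        ∃ g : l ⟶ m, specMap g.1 ≫ specMap (q ≫ f.1) = specMap (toAway (B k.idx) c) := by
      intro m f hf
      have := hopen f
      obtain ⟨t, ht⟩ := exists_comp_eq_of_range_subset (specMap (q ≫ f.1)) _ hf
      obtain ⟨g, rfl⟩ := exists_specMap_eq t
      refine ⟨⟨g, ?_⟩, ht⟩
      rw [← specMap_comp] at ht
      rw [← f.2, ← Functor.map_comp_apply]
      change P.map (f.1 ≫ g) (P.map q (e k.idx)) = P.map (toAway _ c) (e k.idx)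
      rw [← Functor.map_comp_apply, ← Category.assoc, specMap_injective ht]
    obtain ⟨gi, hgi⟩ := lift fi (hl.trans_subset (hc.trans Set.inter_subset_left))
    obtain ⟨gj, hgj⟩ := lift fj (hl.trans_subset (hc.trans Set.inter_subset_right))
    obtain ⟨z, hz⟩ := hl.ge hyc
    refine ⟨l, gi, gj, z, ?_, ?_⟩
    · apply (specMap (q ≫ fi.1)).left.isOpenEmbedding.injective
      exact (congrArg (fun t => t.left z) hgi).trans hz
    · apply (specMap (q ≫ fj.1)).left.isOpenEmbedding.injective
      exact (congrArg (fun t => t.left z) hgj).trans (hz.trans hx')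

theorem isThin : Quiver.IsThin (Chart P B e) := fun a b => ⟨fun f g => by
  apply Subtype.ext
  apply away_hom_ext
  apply h.mono
  rw [Functor.map_comp_apply, Functor.map_comp_apply]
  exact f.2.trans g.2.symm⟩

/-- The scheme is the colimit of all basic open subsets of all charts. Its functor of points and P
are both locally covered by the charts with the same relations, so they are isomorphic. The last
clause is a Yoneda lemma for affine test objects. -/
theorem exists_scheme (hP : IsZariskiSheaf P) :
    ∃ (X : Over (Spec (.of F))) (ε : functorOfPoints F X ≅ P) (k : ∀ i, specOver (B i) ⟶ X),
      (∀ i, IsOpenImmersion (k i).left) ∧ (∀ x : X.left, ∃ i y, (k i).left y = x) ∧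
      (∀ i, ε.hom.app (B i) (k i) = e i) ∧
      ∀ (Y : Over (Spec (.of F))) (η : functorOfPoints F X ⟶ functorOfPoints F Y),
        ∃ f : X ⟶ Y, ∀ (R : CommAlgCat.{u} F) (x : specOver R ⟶ X), η.app R x = x ≫ f := by
  let D : Chart P B e ⥤ Scheme.{u} := Chart.diagram P B e ⋙ Over.forget _
  have hD : ∀ {a b : Chart P B e} (f : a ⟶ b), IsOpenImmersion (D.map f) :=
    fun f => h.isOpenImmersion_diagram_map f
  have hdir : (D ⋙ Scheme.forget).IsLocallyDirected := h.isLocallyDirected_diagram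
  have hthin : Quiver.IsThin (Chart P B e) := h.isThin
  let X : Over (Spec (.of F)) := Over.mk (Y := colimit D) (colimit.desc D
    { pt := _, ι := { app := fun a => (specOver a.ring).hom
                      naturality := fun a b f => by
                        refine (Over.w (specMap f.1)).trans ?_
                        exact (Category.comp_id _).symm } })
  let inc : ∀ a : Chart P B e, specOver a.ring ⟶ X := fun a =>
    Over.homMk (colimit.ι D a) (colimit.ι_desc _ _)
  have hinc : ∀ {a b : Chart P B e} (f : a ⟶ b), specMap f.1 ≫ inc b = inc a := fun f =>
    Over.OverMorphism.ext (colimit.w D f)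
  have incOpen : ∀ a, IsOpenImmersion (inc a).left := fun a =>
    inferInstanceAs (IsOpenImmersion (colimit.ι D a))
  -- Localizing at 1 changes nothing, so the whole chart is an object of the diagram; `back` inverts
  -- the localization map.
  let whole : ∀ i, Chart P B e := fun i => ⟨i, 1⟩
  let back : ∀ i, (whole i).ring ⟶ B i := fun i =>
    awayLift 1 (𝟙 (B i)) (by simp)
  have toAway_back : ∀ i, toAway (B i) 1 ≫ back i = 𝟙 _ := fun i => toAway_awayLift _ _ _
  have back_toAway : ∀ i, back i ≫ toAway (B i) 1 = 𝟙 _ := fun i => by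
    apply away_hom_ext
    rw [← Category.assoc, toAway_back, Category.id_comp, Category.comp_id]
  let k : ∀ i, specOver (B i) ⟶ X := fun i => specMap (back i) ≫ inc (whole i)
  have kOpen : ∀ i, IsOpenImmersion (k i).left := fun i => by
    have : IsIso (back i) := ⟨toAway _ _, back_toAway i, toAway_back i⟩
    have := isOpenImmersion_specMap_of_isIso (back i)
    have := incOpen (whole i)
    rw [Over.comp_left]
    infer_instance
  have hkinc : ∀ (a : Chart P B e) (i : I) (χ : B i ⟶ a.ring), P.map χ (e i) = a.point →
      specMap χ ≫ k i = inc a := by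
    intro a i χ hχ
    let m : a ⟶ whole i := ⟨back i ≫ χ, by
      rw [Chart.point, ← Functor.map_comp_apply]
      refine Eq.trans ?_ hχ
      rw [← Category.assoc, toAway_back, Category.id_comp]⟩
    rw [← Category.assoc, ← specMap_comp]
    exact hinc m
  have incPoint : ∀ a : Chart P B e, specMap (toAway (B a.idx) a.elt) ≫ k a.idx = inc a :=
    fun a => hkinc a _ _ rfl
  have ksurj : ∀ x : X.left, ∃ i y, (k i).left y = x := by
    intro x
    obtain ⟨a, y, hy⟩ := Scheme.IsLocallyDirected.ι_jointly_surjective D x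
    refine ⟨a.idx, (specMap (toAway (B a.idx) a.elt)).left y, ?_⟩
    exact (congrArg (fun t => t.left y) (incPoint a)).trans hy
  -- Both maps factor through the overlap of the two charts, which is itself an object of the
  -- diagram.
  have rel : ∀ (R : CommAlgCat.{u} F) (i j : I) (φ : B i ⟶ R) (ψ : B j ⟶ R),
      P.map φ (e i) = P.map ψ (e j) → specMap φ ≫ k i = specMap ψ ≫ k j := by
    intro R i j φ ψ hφψ
    obtain ⟨d, hd⟩ := h.overlap i j
    obtain ⟨χ, hχ⟩ := (hd _ (toAway (B i) d)).1 (isUnit_toAway _ _)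
    let a : Chart P B e := ⟨i, d⟩
    let φ' : a.ring ⟶ R := awayLift d φ ((hd _ φ).2 ⟨ψ, hφψ⟩)
    have hφ' : toAway (B i) d ≫ φ' = φ := toAway_awayLift _ _ _
    have h2 : χ ≫ φ' = ψ := by
      apply h.mono
      rw [Functor.map_comp_apply, ← hχ, ← Functor.map_comp_apply, hφ', hφψ]
    rw [← hφ', ← h2, specMap_comp, specMap_comp, Category.assoc, Category.assoc,
      hkinc a j χ hχ.symm, hkinc a i (toAway (B i) d) rfl]
  -- Conversely, equality in the colimit is witnessed near each prime by a common object of the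
  -- diagram, and equality in P is a local question.
  have rel' : ∀ (R : CommAlgCat.{u} F) (i j : I) (φ : B i ⟶ R) (ψ : B j ⟶ R),
      specMap φ ≫ k i = specMap ψ ≫ k j → P.map φ (e i) = P.map ψ (e j) := by
    intro R i j φ ψ hφψ
    let φ₁ : (whole i).ring ⟶ R := back i ≫ φ
    let ψ₁ : (whole j).ring ⟶ R := back j ≫ ψ
    have hφψ₁ : specMap φ₁ ≫ inc (whole i) = specMap ψ₁ ≫ inc (whole j) := by
      rw [specMap_comp, specMap_comp, Category.assoc, Category.assoc]
      exact hφψ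
    have hφ₁ : P.map φ (e i) = P.map φ₁ (whole i).point := by
      rw [Chart.point, ← Functor.map_comp_apply]
      change _ = P.map (toAway (B i) 1 ≫ back i ≫ φ) (e i)
      rw [← Category.assoc, toAway_back, Category.id_comp]
    have hψ₁ : P.map ψ (e j) = P.map ψ₁ (whole j).point := by
      rw [Chart.point, ← Functor.map_comp_apply]
      change _ = P.map (toAway (B j) 1 ≫ back j ≫ ψ) (e j)
      rw [← Category.assoc, toAway_back, Category.id_comp]
    rw [hφ₁, hψ₁]
    have loc : ∀ p : PrimeSpectrum R, ∃ f ∉ p.asIdeal,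
        P.map (toAway R f) (P.map φ₁ (whole i).point) =
          P.map (toAway R f) (P.map ψ₁ (whole j).point) := by
      intro p
      have hp : colimit.ι D (whole i) ((specMap φ₁).left p) =
          colimit.ι D (whole j) ((specMap ψ₁).left p) := congrArg (fun t => t.left p) hφψ₁
      obtain ⟨l, gi, gj, z, hzi, hzj⟩ := (Scheme.IsLocallyDirected.ι_eq_ι_iff D).1 hp
      have := h.isOpenImmersion_diagram_map gi
      obtain ⟨f, hf, hsub⟩ := exists_comp_toAway_range_subset (specMap φ₁)
        (U := Set.range (specMap gi.1).left)
        (h.isOpenImmersion_diagram_map gi).isOpen_range p ⟨z, hzi⟩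
      refine ⟨f, hf, ?_⟩
      obtain ⟨t, ht⟩ := exists_comp_eq_of_range_subset ((Chart.diagram P B e).map gi) _ hsub
      obtain ⟨χ, rfl⟩ := exists_specMap_eq t
      have ht' : gi.1 ≫ χ = φ₁ ≫ toAway R f := by
        apply specMap_injective
        rw [specMap_comp, specMap_comp]
        exact ht
      have hj : gj.1 ≫ χ = ψ₁ ≫ toAway R f := by
        apply specMap_injective
        have : Mono (inc (whole j)) := by
          have := incOpen (whole j)
          exact Over.mono_of_mono_left _
        rw [← cancel_mono (inc (whole j)), specMap_comp, specMap_comp, Category.assoc,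
          Category.assoc, hinc gj, ← hφψ₁, ← hinc gi, ← Category.assoc, ← Category.assoc,
          ← specMap_comp, ← specMap_comp, ht']
      rw [← Functor.map_comp_apply, ← Functor.map_comp_apply, ← ht', ← hj,
        Functor.map_comp_apply, Functor.map_comp_apply, gi.2, gj.2]
    obtain ⟨ι, _, f, hf, hQ⟩ := exists_finite_cover loc
    exact hP.ext R f hf _ _ hQ
  have kcov : LocallyCovered (functorOfPoints F X) B k := by
    intro R s p
    obtain ⟨i, y, hy⟩ := ksurj (s.left p)
    have := kOpen i
    obtain ⟨f, hf, hsub⟩ := exists_comp_toAway_range_subset s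
      (U := Set.range (k i).left) (kOpen i).isOpen_range p ⟨y, hy⟩
    obtain ⟨t, ht⟩ := exists_comp_eq_of_range_subset (k i) _ hsub
    obtain ⟨ψ, rfl⟩ := exists_specMap_eq t
    exact ⟨f, hf, i, ψ, ht.symm⟩
  obtain ⟨η, hη⟩ := exists_natTrans_of_locallyCovered (P := functorOfPoints F X) (e := k) hP kcov e rel'
  obtain ⟨θ, hθ⟩ := exists_natTrans_of_locallyCovered (functorOfPoints_isZariskiSheaf X)
    h.cov k rel
  refine ⟨X, ⟨η, θ, ?_, ?_⟩, k, kOpen, ksurj, hη, ?_⟩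
  · apply natTrans_ext_of_locallyCovered (functorOfPoints_isZariskiSheaf X) kcov
    intro i
    change θ.app _ (η.app _ (k i)) = k i
    rw [hη, hθ]
  · apply natTrans_ext_of_locallyCovered hP h.cov
    intro i
    change η.app _ (θ.app _ (e i)) = e i
    rw [hθ, hη]
  · intro Y ζ
    let f : X ⟶ Y := Over.homMk (colimit.desc D
      { pt := _
        ι := { app := fun a => Over.Hom.left (ζ.app a.ring (inc a))
               naturality := fun a b g => by
                 have h1 := NatTrans.naturality_apply ζ g.1 (inc b)
                 rw [functorOfPoints_map, functorOfPoints_map] at h1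
                 erw [hinc g] at h1
                 refine Eq.trans ?_ (Category.comp_id _).symm
                 exact congrArg Over.Hom.left h1.symm } }) (by
        apply colimit.hom_ext
        intro a
        rw [colimit.ι_desc_assoc]
        exact (Over.w (ζ.app a.ring (inc a))).trans (Over.w (inc a)).symm)
    have hf : ∀ a, inc a ≫ f = ζ.app a.ring (inc a) := fun a =>
      Over.OverMorphism.ext (colimit.ι_desc _ _)
    let ξ : functorOfPoints F X ⟶ functorOfPoints F Y :=
      Functor.whiskerLeft _ (yoneda.map f)
    have hξ : ζ = ξ := by
      apply natTrans_ext_of_locallyCovered (functorOfPoints_isZariskiSheaf Y) kcov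
      intro i
      have h1 := NatTrans.naturality_apply ζ (back i) (inc (whole i))
      refine h1.trans ?_
      rw [← hf]
      exact (Category.assoc (specMap (back i)) (inc (whole i)) f).symm
    exact ⟨f, fun R x => by rw [hξ]; rfl⟩

end IsAtlas

end Atlas

/-! ### Scalar extensions of central simple algebras are simple -/

section Simple

variable {F L A : Type*} [Field F] [Field L] [Algebra F L] [Ring A] [Algebra F A]

open Classical in
/-- The scalar extension of a central simple algebra to a field is simple. -/
theorem isSimpleRing_tensorProduct [Algebra.IsCentral F A] [IsSimpleRing A] :
    IsSimpleRing (L ⊗[F] A) := by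
  let b := Module.Basis.ofVectorSpace F L
  let E : L ⊗[F] A ≃ₗ[F] _ →₀ A := TensorProduct.equivFinsuppOfBasisLeft b
  have hE : ∀ (x : L ⊗[F] A) (c d : A) i, E ((1 ⊗ₜ c) * x * (1 ⊗ₜ d)) i = c * E x i * d := by
    intro x c d i
    induction x with
    | zero => simp
    | add x y hx hy => rw [mul_add, add_mul, map_add, map_add, Finsupp.add_apply, Finsupp.add_apply,
        hx, hy, mul_add, add_mul]
    | tmul l a =>
      rw [Algebra.TensorProduct.tmul_mul_tmul, Algebra.TensorProduct.tmul_mul_tmul, one_mul,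
        mul_one]
      simp [E]
  have hnt : Nontrivial (L ⊗[F] A) :=
    (Algebra.TensorProduct.includeRight_injective (R := F) (A := L) (B := A)
      (algebraMap F L).injective).nontrivial
  refine ⟨⟨fun I => or_iff_not_imp_left.2 fun hI => ?_⟩⟩
  obtain ⟨x₀, hx₀I, hx₀⟩ : ∃ x ∈ I, x ≠ 0 := by
    by_contra! hcon
    exact hI (le_bot_iff.1 fun x hx => by simpa using hcon x hx)
  -- Shortest element argument: x is a nonzero element of I with the fewest coefficients in a basis
  -- of L over F.
  let Q : ℕ → Prop := fun m => ∃ x ∈ I, x ≠ 0 ∧ (E x).support.card = m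
  have hQ : ∃ m, Q m := ⟨_, x₀, hx₀I, hx₀, rfl⟩
  obtain ⟨x, hxI, hx0, hxm⟩ := Nat.find_spec hQ
  have hmin : ∀ y ∈ I, (E y).support ⊂ (E x).support → y = 0 := by
    intro y hy hlt
    by_contra hy0
    have h1 := Nat.find_min' hQ ⟨y, hy, hy0, rfl⟩
    exact absurd (Finset.card_lt_card hlt) (by omega)
  obtain ⟨i₀, hi₀⟩ : ∃ i, E x i ≠ 0 := by
    by_contra! hcon
    exact hx0 (E.map_eq_zero_iff.1 (Finsupp.ext hcon))
  -- The coefficients at i₀ form a nonzero two-sided ideal of A, hence all of A; this normalizes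
  -- some y ∈ I to have coefficient 1 at i₀.
  let T : TwoSidedIdeal A := .mk' {a | ∃ y ∈ I, (E y).support ⊆ (E x).support ∧ E y i₀ = a}
    ⟨0, I.zero_mem, by simp, by simp⟩
    (by
      rintro _ _ ⟨y, hy, hys, rfl⟩ ⟨z, hz, hzs, rfl⟩
      refine ⟨y + z, I.add_mem hy hz, ?_, by simp⟩
      rw [map_add]
      exact Finsupp.support_add.trans (Finset.union_subset hys hzs))
    (by
      rintro _ ⟨y, hy, hys, rfl⟩
      exact ⟨-y, I.neg_mem hy, by simpa using hys, by simp⟩)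
    (by
      rintro c _ ⟨y, hy, hys, rfl⟩
      have h1 := fun i => hE y c 1 i
      refine ⟨(1 ⊗ₜ c) * y * (1 ⊗ₜ 1), I.mul_mem_right _ _ (I.mul_mem_left _ _ hy), ?_, ?_⟩
      · intro i hi
        refine hys ?_
        rw [Finsupp.mem_support_iff, h1] at hi
        rw [Finsupp.mem_support_iff]
        rintro h0
        simp [h0] at hi
      · simp [h1])
    (by
      rintro _ c ⟨y, hy, hys, rfl⟩
      have h1 := fun i => hE y 1 c i
      refine ⟨(1 ⊗ₜ 1) * y * (1 ⊗ₜ c), I.mul_mem_right _ _ (I.mul_mem_left _ _ hy), ?_, ?_⟩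
      · intro i hi
        refine hys ?_
        rw [Finsupp.mem_support_iff, h1] at hi
        rw [Finsupp.mem_support_iff]
        rintro h0
        simp [h0] at hi
      · simp [h1])
  have hT : T = ⊤ := by
    refine (eq_bot_or_eq_top T).resolve_left fun hbot => hi₀ ?_
    have : E x i₀ ∈ T := (TwoSidedIdeal.mem_mk' _ _ _ _ _ _ _).2 ⟨x, hxI, subset_rfl, rfl⟩
    rw [hbot] at this
    simpa using this
  have h1T : (1 : A) ∈ T := hT ▸ trivial
  obtain ⟨y, hyI, hys, hy1⟩ := (TwoSidedIdeal.mem_mk' _ _ _ _ _ _ _).1 h1T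
  -- The commutator of 1 ⊗ a with y loses the index i₀, so it vanishes by minimality. The
  -- coefficients of y are then central, and y = l ⊗ 1 is a unit.
  have hcomm : ∀ (a : A) i, a * E y i = E y i * a := by
    intro a i
    have hz : (1 ⊗ₜ a) * y * (1 ⊗ₜ 1) - (1 ⊗ₜ 1) * y * (1 ⊗ₜ a) = 0 := by
      have hval : ∀ j, E ((1 ⊗ₜ a) * y * (1 ⊗ₜ 1) - (1 ⊗ₜ 1) * y * (1 ⊗ₜ a)) j =
          a * E y j - E y j * a := by
        intro j
        rw [map_sub, Finsupp.sub_apply, hE, hE, mul_one, one_mul]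
      apply hmin
      · exact I.sub_mem (I.mul_mem_right _ _ (I.mul_mem_left _ _ hyI))
          (I.mul_mem_right _ _ (I.mul_mem_left _ _ hyI))
      · rw [Finset.ssubset_iff_of_subset]
        · refine ⟨i₀, Finsupp.mem_support_iff.2 hi₀, ?_⟩
          rw [Finsupp.mem_support_iff, not_not, hval, hy1, mul_one, one_mul, sub_self]
        · intro j hj
          refine hys ?_
          rw [Finsupp.mem_support_iff, hval] at hj
          rw [Finsupp.mem_support_iff]
          rintro h0
          simp [h0] at hj
    have h2 := DFunLike.congr_fun (congrArg E hz) i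
    rw [map_sub, Finsupp.sub_apply, hE, hE, mul_one, one_mul, map_zero, Finsupp.zero_apply] at h2
    exact sub_eq_zero.1 h2
  have hcen : ∀ i, ∃ c : F, algebraMap F A c = E y i := by
    intro i
    have : E y i ∈ Subalgebra.center F A := Subalgebra.mem_center_iff.2 fun a => hcomm a i
    rw [Algebra.IsCentral.center_eq_bot] at this
    exact Algebra.mem_bot.1 this
  choose c hc using hcen
  obtain ⟨l, hl⟩ : ∃ l : L, l ⊗ₜ[F] (1 : A) = y := by
    refine ⟨(E y).sum fun i _ => c i • b i, ?_⟩
    refine Eq.trans ?_ (E.symm_apply_apply y)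
    rw [TensorProduct.equivFinsuppOfBasisLeft_symm_apply, Finsupp.sum, Finsupp.sum,
      TensorProduct.sum_tmul]
    refine Finset.sum_congr rfl fun i _ => ?_
    rw [TensorProduct.smul_tmul, ← Algebra.algebraMap_eq_smul_one, hc]
  have hl0 : l ≠ 0 := by
    rintro rfl
    rw [TensorProduct.zero_tmul] at hl
    rw [← hl, map_zero, Finsupp.zero_apply] at hy1
    exact zero_ne_one hy1
  rw [eq_top_iff]
  intro z _
  have h1 : z * ((l⁻¹ ⊗ₜ[F] (1 : A)) * y) ∈ I := I.mul_mem_left _ _ (I.mul_mem_left _ _ hyI)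
  rwa [← hl, Algebra.TensorProduct.tmul_mul_tmul, inv_mul_cancel₀ hl0, one_mul,
    ← Algebra.TensorProduct.one_def, mul_one] at h1

end Simple

/-! ### Splittings, their conjugacy, and Galois descent -/

section Splittings

variable {F : Type u} [Field F] {A : Type u} [Ring A] [Algebra F A] {n : ℕ}

theorem nonempty_splitting [FiniteDimensional F A] [Algebra.IsCentral F A] [IsSimpleRing A]
    (hA : Module.finrank F A = n ^ 2) : Nonempty (Splitting F A n) := by
  have := isSimpleRing_tensorProduct (F := F) (L := AlgebraicClosure F) (A := A)
  obtain ⟨m, _, ⟨e⟩⟩ := IsSimpleRing.exists_algEquiv_matrix_of_isAlgClosed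
    (AlgebraicClosure F) (AlgebraicClosure F ⊗[F] A)
  have h1 := e.toLinearEquiv.finrank_eq
  rw [Module.finrank_baseChange, hA, Module.finrank_matrix] at h1
  simp only [Fintype.card_fin, Module.finrank_self, mul_one] at h1
  have h2 : n = m := by
    rw [← sq] at h1
    exact Nat.pow_left_injective (n := 2) (by norm_num) h1
  subst h2
  exact ⟨e⟩

theorem splittingHom_tmul_eq_smul (φ : Splitting F A n) (R : Type u) [CommRing R] [Algebra F R]
    (r : R) (a : A) : splittingHom φ R (r ⊗ₜ[F] a) =
      r • (φ (1 ⊗ₜ[F] a)).map (Algebra.TensorProduct.includeRight :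
        AlgebraicClosure F →ₐ[F] R ⊗[F] AlgebraicClosure F) := by
  ext i j
  rw [splittingHom_tmul, Matrix.smul_apply, Matrix.map_apply,
    Algebra.TensorProduct.includeRight_apply, TensorProduct.smul_tmul', smul_eq_mul, mul_one]

/-- Any two splittings are conjugate. -/
theorem exists_conj_splitting (φ ψ : Splitting F A n) :
    ∃ U V : Matrix (Fin n) (Fin n) (AlgebraicClosure F), U * V = 1 ∧ ∀ y, ψ y = U * φ y * V := by
  let K := AlgebraicClosure F
  let θ : Module.End K (Fin n → K) ≃ₐ[K] Module.End K (Fin n → K) :=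
    (Matrix.toLinAlgEquiv'.symm.trans (φ.symm.trans ψ)).trans Matrix.toLinAlgEquiv'
  -- Skolem–Noether: the automorphism comparing the two splittings is conjugation by T.
  obtain ⟨T, hT⟩ := θ.eq_linearEquivConjAlgEquiv
  refine ⟨LinearMap.toMatrixAlgEquiv' T.toLinearMap,
    LinearMap.toMatrixAlgEquiv' T.symm.toLinearMap, ?_, fun y => ?_⟩
  · have h1 : T.toLinearMap * T.symm.toLinearMap = 1 := LinearMap.ext fun v => T.apply_symm_apply v
    rw [← map_mul, h1, map_one]
  · have h1 := DFunLike.congr_fun hT (Matrix.toLinAlgEquiv' (φ y))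
    have h2 : θ (Matrix.toLinAlgEquiv' (φ y)) = Matrix.toLinAlgEquiv' (ψ y) := by
      simp [θ]
    rw [h2, LinearEquiv.conjAlgEquiv_apply] at h1
    have h3 := congrArg LinearMap.toMatrixAlgEquiv' h1
    rw [LinearMap.toMatrixAlgEquiv'_toLinAlgEquiv', LinearMap.toMatrixAlgEquiv'_comp,
      LinearMap.toMatrixAlgEquiv'_comp, LinearMap.toMatrixAlgEquiv'_toLinAlgEquiv'] at h3
    rw [h3, Matrix.mul_assoc]

theorem splittingDet_eq (φ ψ : Splitting F A n) {R : Type u} [CommRing R] [Algebra F R]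
    (a : R ⊗[F] A) : splittingDet φ a = splittingDet ψ a := by
  obtain ⟨U, V, hUV, h⟩ := exists_conj_splitting φ ψ
  let ι : AlgebraicClosure F →ₐ[F] R ⊗[F] AlgebraicClosure F :=
    Algebra.TensorProduct.includeRight
  have hUV' : U.map ι * V.map ι = 1 := by
    rw [← Matrix.map_mul, hUV, Matrix.map_one _ (map_zero ι) (map_one ι)]
  have key : splittingHom ψ R a = U.map ι * splittingHom φ R a * V.map ι := by
    induction a with
    | zero => simp
    | add x y hx hy => rw [map_add, map_add, hx, hy, mul_add, add_mul]
    | tmul r a =>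
      rw [splittingHom_tmul_eq_smul, splittingHom_tmul_eq_smul, h, Matrix.mul_smul,
        Matrix.smul_mul, ← Matrix.map_mul, ← Matrix.map_mul]
  have hdet := congrArg Matrix.det hUV'
  rw [Matrix.det_mul, Matrix.det_one] at hdet
  rw [splittingDet, splittingDet, key, Matrix.det_mul, Matrix.det_mul, mul_right_comm, hdet,
    one_mul]

/-- The splitting obtained from a given one by conjugation with an automorphism of the algebraic
closure. -/
def conjSplitting (φ : Splitting F A n) (σ : AlgebraicClosure F ≃ₐ[F] AlgebraicClosure F) :
    Splitting F A n :=
  { ((Algebra.TensorProduct.congr σ.symm (AlgEquiv.refl : A ≃ₐ[F] A)).trans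
      (φ.restrictScalars F)).trans σ.mapMatrix with
    commutes' := fun x => by
      have h1 : Algebra.TensorProduct.congr σ.symm (AlgEquiv.refl : A ≃ₐ[F] A)
          (algebraMap (AlgebraicClosure F) _ x) = algebraMap (AlgebraicClosure F) _ (σ.symm x) := by
        simp [Algebra.TensorProduct.algebraMap_apply]
      change (φ (Algebra.TensorProduct.congr σ.symm (AlgEquiv.refl : A ≃ₐ[F] A) _)).map σ = _
      rw [h1, AlgEquiv.commutes]
      ext i j
      simp [Matrix.algebraMap_matrix_apply, apply_ite σ] }

theorem conjSplitting_one_tmul (φ : Splitting F A n)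
    (σ : AlgebraicClosure F ≃ₐ[F] AlgebraicClosure F) (a : A) :
    conjSplitting φ σ (1 ⊗ₜ a) = (φ (1 ⊗ₜ a)).map σ := by
  change (φ (Algebra.TensorProduct.congr σ.symm (AlgEquiv.refl : A ≃ₐ[F] A) (1 ⊗ₜ a))).map σ = _
  simp

/-- Together with independence of the splitting, this shows that the determinant is fixed by the
Galois group. -/
theorem splittingDet_conjSplitting (φ : Splitting F A n)
    (σ : AlgebraicClosure F ≃ₐ[F] AlgebraicClosure F) {R : Type u} [CommRing R] [Algebra F R]
    (a : R ⊗[F] A) : splittingDet (conjSplitting φ σ) a =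
      Algebra.TensorProduct.map (AlgHom.id F R) σ.toAlgHom (splittingDet φ a) := by
  rw [splittingDet, splittingDet, AlgHom.map_det]
  congr 1
  induction a with
  | zero => simp
  | add x y hx hy => rw [map_add, map_add, map_add, hx, hy]
  | tmul r a =>
    ext i j
    simp [splittingHom_tmul, conjSplitting_one_tmul]

-- The coordinates of z in a basis of R over F are elements of F̄ fixed by all automorphisms. F̄/F
-- is Galois since F is perfect, so they lie in F.
open Classical in
theorem exists_tmul_one_of_fixed [PerfectField F] {R : Type u} [CommRing R] [Algebra F R]
    (z : R ⊗[F] AlgebraicClosure F)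
    (hz : ∀ σ : AlgebraicClosure F ≃ₐ[F] AlgebraicClosure F,
      Algebra.TensorProduct.map (AlgHom.id F R) σ.toAlgHom z = z) :
    ∃ r : R, z = r ⊗ₜ 1 := by
  have : IsGalois F (AlgebraicClosure F) := {}
  let b := Module.Basis.ofVectorSpace F R
  let E : R ⊗[F] AlgebraicClosure F ≃ₗ[F] _ →₀ AlgebraicClosure F :=
    TensorProduct.equivFinsuppOfBasisLeft b
  have hE : ∀ (σ : AlgebraicClosure F ≃ₐ[F] AlgebraicClosure F) x i,
      E (Algebra.TensorProduct.map (AlgHom.id F R) σ.toAlgHom x) i = σ (E x i) := by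
    intro σ x i
    induction x with
    | zero => simp
    | add x y hx hy => rw [map_add, map_add, map_add, Finsupp.add_apply, Finsupp.add_apply, map_add,
        hx, hy]
    | tmul r l => simp [E]
  have hmem : ∀ i, ∃ c : F, algebraMap F (AlgebraicClosure F) c = E z i := by
    intro i
    have h1 : E z i ∈ (⊥ : IntermediateField F (AlgebraicClosure F)) :=
      (InfiniteGalois.mem_bot_iff_fixed _).2 fun σ => by rw [← hE, hz]
    exact IntermediateField.mem_bot.1 h1
  choose c hc using hmem
  refine ⟨(E z).sum fun i _ => c i • b i, ?_⟩
  refine (E.symm_apply_apply z).symm.trans ?_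
  rw [TensorProduct.equivFinsuppOfBasisLeft_symm_apply, Finsupp.sum, Finsupp.sum,
    TensorProduct.sum_tmul]
  refine Finset.sum_congr rfl fun i _ => ?_
  rw [TensorProduct.smul_tmul, ← Algebra.algebraMap_eq_smul_one, hc]

end Splittings

/-! ### Descent, multiplicativity and base change of the reduced norm -/

section ReducedNormProperties

variable {F : Type u} [Field F] [PerfectField F] {A : Type u} [Ring A] [Algebra F A]
  {n : ℕ} {R : Type u} [CommRing R] [Algebra F R]

/-- As soon as a splitting exists, descent shows that the default value in `reducedNorm` is not
taken. -/
theorem splittingDet_eq_reducedNorm (φ : Splitting F A n) (a : R ⊗[F] A) :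
    splittingDet φ a = reducedNorm n a ⊗ₜ 1 := by
  have h : Nonempty (Splitting F A n) ∧
      ∃ r : R, ∀ φ : Splitting F A n, splittingDet φ a = r ⊗ₜ[F] (1 : AlgebraicClosure F) := by
    obtain ⟨r, hr⟩ := exists_tmul_one_of_fixed (splittingDet φ a) fun σ => by
      rw [← splittingDet_conjSplitting, splittingDet_eq _ φ]
    exact ⟨⟨φ⟩, r, fun ψ => (splittingDet_eq ψ φ a).trans hr⟩
  rw [reducedNorm, dif_pos h]
  exact h.2.choose_spec φ

omit [PerfectField F] in
theorem tmul_one_injective {r s : R}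
    (h : r ⊗ₜ[F] (1 : AlgebraicClosure F) = s ⊗ₜ[F] (1 : AlgebraicClosure F)) : r = s :=
  Algebra.TensorProduct.includeLeft_injective (R := F) (S := F) (A := R)
    (B := AlgebraicClosure F) (algebraMap F (AlgebraicClosure F)).injective h

/-- The isomorphism (see `splitHom_bijective`) from `A ⊗ R` to a matrix algebra over `R` attached to
a splitting of `A`, for an algebra `R` over the algebraic closure. -/
def splitHom (φ : Splitting F A n) (ι : AlgebraicClosure F →ₐ[F] R) :
    R ⊗[F] A →ₐ[R] Matrix (Fin n) (Fin n) R :=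
  ((Algebra.TensorProduct.lift (AlgHom.id R R) ι fun _ _ => Commute.all _ _).mapMatrix).comp
    (splittingHom φ R)

omit [PerfectField F] in
theorem splitHom_tmul (φ : Splitting F A n) (ι : AlgebraicClosure F →ₐ[F] R) (r : R) (a : A) :
    splitHom φ ι (r ⊗ₜ a) = r • (φ (1 ⊗ₜ a)).map ι := by
  ext i j
  simp [splitHom, splittingHom_tmul]

theorem det_splitHom (φ : Splitting F A n) (ι : AlgebraicClosure F →ₐ[F] R) (a : R ⊗[F] A) :
    (splitHom φ ι a).det = reducedNorm n a := by
  rw [splitHom, AlgHom.comp_apply, ← AlgHom.map_det]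
  change (Algebra.TensorProduct.lift (AlgHom.id R R) ι fun _ _ => Commute.all _ _)
    (splittingDet φ a) = _
  rw [splittingDet_eq_reducedNorm]
  simp

omit [PerfectField F] in
theorem splitHom_map {S : Type u} [CommRing S] [Algebra F S] (φ : Splitting F A n)
    (ι : AlgebraicClosure F →ₐ[F] R) (f : R →ₐ[F] S) (a : R ⊗[F] A) :
    splitHom φ (f.comp ι) (Algebra.TensorProduct.map f (AlgHom.id F A) a) =
      (splitHom φ ι a).map f := by
  induction a with
  | zero => ext; simp
  | add x y hx hy =>
    rw [map_add, map_add, map_add, hx, hy]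
    ext; simp
  | tmul r a =>
    ext i j
    simp [splitHom_tmul]

-- The image contains the matrix units, which come from the splitting. A surjection between free
-- modules of the same finite rank is injective.
omit [PerfectField F] in
theorem splitHom_bijective [FiniteDimensional F A] (hA : Module.finrank F A = n ^ 2)
    (φ : Splitting F A n) (ι : AlgebraicClosure F →ₐ[F] R) :
    Function.Bijective (splitHom φ ι) := by
  have hsurj : Function.Surjective (splitHom φ ι) := by
    let N := LinearMap.range (splitHom φ ι).toLinearMap
    have hmap : ∀ y : AlgebraicClosure F ⊗[F] A, (φ y).map ι ∈ N := by
      intro y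
      induction y with
      | zero => convert! N.zero_mem; ext; simp
      | add x y hx hy =>
        convert! N.add_mem hx hy
        ext; simp
      | tmul l a =>
        refine ⟨ι l ⊗ₜ a, ?_⟩
        have h1 : l ⊗ₜ[F] a = l • (1 ⊗ₜ a) := by rw [TensorProduct.smul_tmul', smul_eq_mul, mul_one]
        rw [h1, map_smul, AlgHom.toLinearMap_apply, splitHom_tmul]
        ext i j
        simp
    intro M
    change M ∈ N
    rw [Matrix.matrix_eq_sum_single M]
    refine Submodule.sum_mem _ fun i _ => Submodule.sum_mem _ fun j _ => ?_
    have h1 : Matrix.single i j (M i j) =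
        M i j • (φ (φ.symm (Matrix.single i j 1))).map ι := by
      rw [AlgEquiv.apply_symm_apply]
      ext k l
      simp [Matrix.single_apply]
    rw [h1]
    exact N.smul_mem _ (hmap _)
  refine ⟨?_, hsurj⟩
  rcases subsingleton_or_nontrivial R with hR | hR
  · have : Subsingleton (R ⊗[F] A) := Module.subsingleton R _
    exact Function.injective_of_subsingleton _
  have hrank : Module.finrank R (Matrix (Fin n) (Fin n) R) = Module.finrank R (R ⊗[F] A) := by
    rw [Module.finrank_baseChange, hA, Module.finrank_matrix]
    simp [sq]
  let e : Matrix (Fin n) (Fin n) R ≃ₗ[R] R ⊗[F] A := LinearEquiv.ofFinrankEq _ _ hrank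
  have hinj := OrzechProperty.injective_of_surjective_endomorphism
    (e.toLinearMap ∘ₗ (splitHom φ ι).toLinearMap) (e.surjective.comp hsurj)
  exact fun x y hxy => hinj (congrArg e hxy)

variable [FiniteDimensional F A] [Algebra.IsCentral F A] [IsSimpleRing A]

theorem reducedNorm_mul (hA : Module.finrank F A = n ^ 2) (a b : R ⊗[F] A) :
    reducedNorm n (a * b) = reducedNorm n a * reducedNorm n b := by
  obtain ⟨φ⟩ := nonempty_splitting hA
  apply tmul_one_injective (F := F)
  rw [← splittingDet_eq_reducedNorm φ, splittingDet, map_mul, Matrix.det_mul]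
  change splittingDet φ a * splittingDet φ b = _
  rw [splittingDet_eq_reducedNorm, splittingDet_eq_reducedNorm,
    Algebra.TensorProduct.tmul_mul_tmul, one_mul]

theorem reducedNorm_one (hA : Module.finrank F A = n ^ 2) :
    reducedNorm n (1 : R ⊗[F] A) = 1 := by
  obtain ⟨φ⟩ := nonempty_splitting hA
  apply tmul_one_injective (F := F)
  rw [← splittingDet_eq_reducedNorm φ, splittingDet, map_one, Matrix.det_one,
    Algebra.TensorProduct.one_def]

theorem reducedNorm_map {S : Type u} [CommRing S] [Algebra F S]
    (hA : Module.finrank F A = n ^ 2) (f : R →ₐ[F] S) (a : R ⊗[F] A) :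
    reducedNorm n (Algebra.TensorProduct.map f (AlgHom.id F A) a) = f (reducedNorm n a) := by
  obtain ⟨φ⟩ := nonempty_splitting hA
  apply tmul_one_injective (F := F)
  rw [← splittingDet_eq_reducedNorm φ, splittingDet_map, splittingDet_eq_reducedNorm]
  simp

end ReducedNormProperties

/-! ### Invertibility in A ⊗ R -/

section Units

variable {F : Type u} [Field F] {A : Type u} [Ring A] [Algebra F A]
  {R S : Type u} [CommRing R] [Algebra F R] [CommRing S] [Algebra F S]

/-- The change of the base algebra `A ⊗ R → A ⊗ S`. -/
abbrev baseMap (A : Type u) [Ring A] [Algebra F A] (f : R →ₐ[F] S) : R ⊗[F] A →ₐ[F] S ⊗[F] A :=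
  Algebra.TensorProduct.map f (AlgHom.id F A)

theorem baseMap_smul (f : R →ₐ[F] S) (r : R) (x : R ⊗[F] A) :
    baseMap A f (r • x) = f r • baseMap A f x := by
  induction x with
  | zero => simp
  | add x y hx hy => rw [smul_add, map_add, hx, hy, map_add, smul_add]
  | tmul s a => simp [TensorProduct.smul_tmul']

theorem baseMap_baseMap {T : Type u} [CommRing T] [Algebra F T] (f : R →ₐ[F] S) (g : S →ₐ[F] T)
    (x : R ⊗[F] A) : baseMap A g (baseMap A f x) = baseMap A (g.comp f) x := by
  induction x with
  | zero => simp
  | add x y hx hy => rw [map_add, map_add, hx, hy, map_add]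
  | tmul s a => simp

/-- The determinant of the left multiplication by an element of `A ⊗ R`. -/
def mulDet (a : R ⊗[F] A) : R := LinearMap.det (LinearMap.mulLeft R a)

theorem mulDet_mul (a b : R ⊗[F] A) : mulDet (a * b) = mulDet a * mulDet b := by
  rw [mulDet, LinearMap.mulLeft_mul, LinearMap.det_comp]
  rfl

theorem mulDet_one : mulDet (1 : R ⊗[F] A) = 1 := by
  rw [mulDet, LinearMap.mulLeft_one, LinearMap.det_id]

variable [FiniteDimensional F A]

theorem mulDet_map (f : R →ₐ[F] S) (a : R ⊗[F] A) : mulDet (baseMap A f a) = f (mulDet a) := by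
  let _ : Algebra R S := f.toAlgebra
  have : IsScalarTower F R S := IsScalarTower.of_algebraMap_eq' f.comp_algebraMap.symm
  let e := AlgebraTensorModule.cancelBaseChange F R S S A
  have h1 : LinearMap.mulLeft S (baseMap A f a) =
      e.toLinearMap ∘ₗ (LinearMap.mulLeft R a).baseChange S ∘ₗ e.symm.toLinearMap := by
    ext b
    simp only [e, AlgebraTensorModule.curry_apply,
      TensorProduct.curry_apply, LinearMap.coe_restrictScalars, LinearMap.mulLeft_apply,
      LinearMap.comp_apply, LinearEquiv.coe_coe,
      AlgebraTensorModule.cancelBaseChange_symm_tmul, LinearMap.baseChange_tmul]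
    induction a with
    | zero => simp
    | add x y hx hy => rw [map_add, add_mul, hx, hy, add_mul, TensorProduct.tmul_add, map_add]
    | tmul r a =>
      simp [Algebra.smul_def, RingHom.algebraMap_toAlgebra]
  rw [mulDet, h1, LinearMap.det_conj, LinearMap.det_baseChange]
  rfl

/-- If left multiplication by a is bijective, the preimage of 1 is a right inverse, and injectivity
makes it a left inverse as well. -/
theorem isUnit_iff_isUnit_mulDet (a : R ⊗[F] A) : IsUnit a ↔ IsUnit (mulDet a) := by
  constructor
  · rintro ⟨u, rfl⟩
    refine IsUnit.of_mul_eq_one (mulDet (u⁻¹ : (R ⊗[F] A)ˣ).1) ?_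
    rw [← mulDet_mul, Units.mul_inv, mulDet_one]
  · intro h
    have h1 := (LinearMap.isUnit_iff_isUnit_det _).2 h
    rw [Module.End.isUnit_iff] at h1
    obtain ⟨b, hb⟩ := h1.2 1
    rw [LinearMap.mulLeft_apply] at hb
    refine ⟨⟨a, b, hb, h1.1 ?_⟩, rfl⟩
    rw [LinearMap.mulLeft_apply, LinearMap.mulLeft_apply, ← mul_assoc, hb, one_mul, mul_one]

theorem isUnit_of_mul_eq_one {a b : R ⊗[F] A} (h : a * b = 1) : IsUnit a := by
  rw [isUnit_iff_isUnit_mulDet]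
  refine IsUnit.of_mul_eq_one (mulDet b) ?_
  rw [← mulDet_mul, h, mulDet_one]

-- An F-linear retraction of L onto F extends to an R-linear map R ⊗ L → R, which sends the inverse
-- of r ⊗ 1 to an inverse of r.
omit [Algebra F S] [FiniteDimensional F A] in
theorem isUnit_of_isUnit_tmul_one {L : Type*} [Field L] [Algebra F L] {r : R}
    (h : IsUnit (r ⊗ₜ[F] (1 : L))) : IsUnit r := by
  obtain ⟨g, hg⟩ := (Algebra.linearMap F L).exists_leftInverse_of_injective
    (LinearMap.ker_eq_bot.2 (algebraMap F L).injective)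
  obtain ⟨z, hz⟩ := h.exists_right_inv
  have hg1 : g 1 = 1 := by simpa using LinearMap.congr_fun hg 1
  let T : R ⊗[F] L →ₗ[R] R := (AlgebraTensorModule.rid F R R).toLinearMap ∘ₗ g.baseChange R
  have h1 : (r ⊗ₜ[F] (1 : L)) * z = r • z := by
    rw [Algebra.smul_def]
    rfl
  refine IsUnit.of_mul_eq_one (T z) ?_
  rw [← smul_eq_mul, ← map_smul, ← h1, hz, Algebra.TensorProduct.one_def]
  simp [T, hg1]

/-- Over R ⊗ F̄ the algebra consists of matrices and the reduced norm is the determinant.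
Invertibility descends to R through `mulDet`. -/
theorem isUnit_iff_isUnit_reducedNorm [PerfectField F] [Algebra.IsCentral F A] [IsSimpleRing A]
    {n : ℕ} (hA : Module.finrank F A = n ^ 2) (a : R ⊗[F] A) :
    IsUnit a ↔ IsUnit (reducedNorm n a) := by
  constructor
  · rintro ⟨u, rfl⟩
    refine IsUnit.of_mul_eq_one (reducedNorm n (u⁻¹ : (R ⊗[F] A)ˣ).1) ?_
    rw [← reducedNorm_mul hA, Units.mul_inv, reducedNorm_one hA]
  · intro h
    obtain ⟨φ⟩ := nonempty_splitting hA
    let f : R →ₐ[F] R ⊗[F] AlgebraicClosure F := Algebra.TensorProduct.includeLeft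
    let ι : AlgebraicClosure F →ₐ[F] R ⊗[F] AlgebraicClosure F :=
      Algebra.TensorProduct.includeRight
    have h1 : IsUnit (splitHom φ ι (baseMap A f a)).det := by
      rw [det_splitHom, reducedNorm_map hA]
      exact h.map f
    rw [← Matrix.isUnit_iff_isUnit_det] at h1
    have h2 : IsUnit (baseMap A f a) :=
      (MulEquiv.isUnit_map (AlgEquiv.ofBijective _ (splitHom_bijective hA φ ι))).1 h1
    rw [isUnit_iff_isUnit_mulDet, mulDet_map] at h2
    rw [isUnit_iff_isUnit_mulDet]
    exact isUnit_of_isUnit_tmul_one h2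

end Units

/-! ### The generic element of A and the affine space of A -/

section Coordinates

variable (F : Type u) [Field F] (A : Type u) [Ring A] [Algebra F A] [FiniteDimensional F A]

/-- The coordinate ring of the affine space `R ↦ A ⊗ R`. -/
abbrev CoordRing : Type u := MvPolynomial (Fin (Module.finrank F A)) F

/-- The generic element of `A`. -/
def generic : CoordRing F A ⊗[F] A := ∑ i, MvPolynomial.X i ⊗ₜ Module.finBasis F A i

variable {F A} {R : Type u} [CommRing R] [Algebra F R]

/-- The morphism from the coordinate ring that maps the generic element to the given one. -/
def coordHom (x : R ⊗[F] A) : CoordRing F A →ₐ[F] R :=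
  MvPolynomial.aeval fun i => (Algebra.TensorProduct.basis R (Module.finBasis F A)).repr x i

theorem baseMap_coordHom_generic (x : R ⊗[F] A) : baseMap A (coordHom x) (generic F A) = x := by
  rw [generic, map_sum]
  refine Eq.trans ?_ ((Algebra.TensorProduct.basis R (Module.finBasis F A)).sum_repr x)
  refine Finset.sum_congr rfl fun i _ => ?_
  simp [coordHom, TensorProduct.smul_tmul']

theorem coordRing_hom_ext {f g : CoordRing F A →ₐ[F] R}
    (h : baseMap A f (generic F A) = baseMap A g (generic F A)) : f = g := by
  have key : ∀ (f : CoordRing F A →ₐ[F] R) i, f (MvPolynomial.X i) =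
      (Algebra.TensorProduct.basis R (Module.finBasis F A)).repr
        (baseMap A f (generic F A)) i := by
    intro f i
    rw [generic, map_sum, map_sum, Finsupp.finsetSum_apply, Finset.sum_eq_single i]
    · simp
    · intro j _ hj
      simp [hj]
    · simp
  apply MvPolynomial.algHom_ext
  intro i
  rw [key, key, h]

end Coordinates

/-! ### Entries of elements of M₂(A) ⊗ R -/

section MatrixEntries

variable {F : Type u} [Field F] {A : Type u} [Ring A] [Algebra F A]
  {R S : Type u} [CommRing R] [Algebra F R] [CommRing S] [Algebra F S]

/-- The identification of `M₂(A) ⊗ R` with `M₂(A ⊗ R)`. -/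
def toMat : R ⊗[F] Matrix (Fin 2) (Fin 2) A →ₐ[R] Matrix (Fin 2) (Fin 2) (R ⊗[F] A) :=
  Algebra.TensorProduct.lift (Algebra.ofId R _)
    (Algebra.TensorProduct.includeRight : A →ₐ[F] R ⊗[F] A).mapMatrix
    fun r a => by
      rw [Algebra.ofId_apply]
      exact Algebra.commute_algebraMap_left _ _

theorem toMat_tmul (r : R) (M : Matrix (Fin 2) (Fin 2) A) (i j : Fin 2) :
    toMat (r ⊗ₜ[F] M) i j = r ⊗ₜ M i j := by
  rw [toMat, Algebra.TensorProduct.lift_tmul, Algebra.ofId_apply, ← Algebra.smul_def]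
  simp [TensorProduct.smul_tmul']

/-- The matrix with one prescribed entry and all other entries `0`, as an element of
`M₂(A) ⊗ R`. -/
def entry (i j : Fin 2) : R ⊗[F] A →ₗ[R] R ⊗[F] Matrix (Fin 2) (Fin 2) A :=
  (Matrix.singleLinearMap F i j).baseChange R

theorem toMat_entry (i j : Fin 2) (a : R ⊗[F] A) : toMat (entry i j a) = Matrix.single i j a := by
  induction a with
  | zero => simp
  | add x y hx hy => rw [map_add, map_add, hx, hy, Matrix.single_add]
  | tmul r a =>
    ext k l
    rw [entry, LinearMap.baseChange_tmul, toMat_tmul]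
    simp only [Matrix.singleLinearMap_apply, Matrix.single_apply]
    split_ifs <;> simp

theorem sum_entry (z : R ⊗[F] Matrix (Fin 2) (Fin 2) A) :
    ∑ i, ∑ j, entry i j (toMat z i j) = z := by
  induction z with
  | zero => simp
  | add x y hx hy =>
    conv_rhs => rw [← hx, ← hy]
    simp only [map_add, Matrix.add_apply, Finset.sum_add_distrib]
  | tmul r M =>
    simp only [toMat_tmul, entry, LinearMap.baseChange_tmul, ← TensorProduct.tmul_sum]
    congr 1
    exact (Matrix.matrix_eq_sum_single M).symm

theorem toMat_injective : Function.Injective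
    (toMat : R ⊗[F] Matrix (Fin 2) (Fin 2) A → Matrix (Fin 2) (Fin 2) (R ⊗[F] A)) := by
  intro x y h
  rw [← sum_entry x, ← sum_entry y, h]

theorem column_eq (a b : R ⊗[F] A) : column a b = entry 0 0 a + entry 1 0 b := rfl

theorem toMat_column (a b : R ⊗[F] A) : toMat (column a b) = !![a, 0; b, 0] := by
  rw [column_eq, map_add, toMat_entry, toMat_entry]
  ext i j
  fin_cases i <;> fin_cases j <;> simp

theorem toMat_baseMap (f : R →ₐ[F] S) (z : R ⊗[F] Matrix (Fin 2) (Fin 2) A) (i j : Fin 2) :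
    toMat (baseMap _ f z) i j = baseMap A f (toMat z i j) := by
  induction z with
  | zero => simp
  | add x y hx hy => rw [map_add, map_add, map_add, Matrix.add_apply, Matrix.add_apply, hx, hy,
      map_add]
  | tmul r M => simp [toMat_tmul]

theorem baseMap_column (f : R →ₐ[F] S) (a b : R ⊗[F] A) :
    baseMap _ f (column a b) = column (baseMap A f a) (baseMap A f b) := by
  apply toMat_injective
  ext i j
  rw [toMat_baseMap, toMat_column, toMat_column]
  fin_cases i <;> fin_cases j <;> simp

end MatrixEntries

/-! ### The ideals [g(1, x)] as points of the Grassmannian -/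

section Charts

variable {F : Type u} [Field F] {A : Type u} [Ring A] [Algebra F A]
  {R S : Type u} [CommRing R] [Algebra F R] [CommRing S] [Algebra F S]

/-- The first entry of the column `g (1, x)`. -/
def chartTop (g : Matrix (Fin 2) (Fin 2) A) (x : R ⊗[F] A) : R ⊗[F] A :=
  1 ⊗ₜ g 0 0 + (1 ⊗ₜ g 0 1) * x

/-- The second entry of the column `g (1, x)`. -/
def chartBot (g : Matrix (Fin 2) (Fin 2) A) (x : R ⊗[F] A) : R ⊗[F] A :=
  1 ⊗ₜ g 1 0 + (1 ⊗ₜ g 1 1) * x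

/-- The column `g (1, x)`. -/
def chartColumn (g : Matrix (Fin 2) (Fin 2) A) (x : R ⊗[F] A) :
    R ⊗[F] Matrix (Fin 2) (Fin 2) A :=
  column (chartTop g x) (chartBot g x)

theorem tmul_mul_column (g : Matrix (Fin 2) (Fin 2) A) (a b : R ⊗[F] A) :
    ((1 : R) ⊗ₜ[F] g) * column a b = column ((1 ⊗ₜ g 0 0) * a + (1 ⊗ₜ g 0 1) * b)
      ((1 ⊗ₜ g 1 0) * a + (1 ⊗ₜ g 1 1) * b) := by
  apply toMat_injective
  rw [map_mul, toMat_column, toMat_column]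
  ext i j
  fin_cases i <;> fin_cases j <;> simp [Matrix.mul_apply, toMat_tmul]

theorem column_mul_entry (a b c : R ⊗[F] A) (j : Fin 2) :
    column a b * entry 0 j c = entry 0 j (a * c) + entry 1 j (b * c) := by
  apply toMat_injective
  rw [map_mul, map_add, toMat_column, toMat_entry, toMat_entry, toMat_entry]
  ext k l
  fin_cases k <;> fin_cases l <;> fin_cases j <;> simp [Matrix.mul_apply]

theorem chartColumn_eq (g : Matrix (Fin 2) (Fin 2) A) (x : R ⊗[F] A) :
    chartColumn g x = (1 ⊗ₜ g) * column 1 x := by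
  rw [tmul_mul_column, mul_one, mul_one]
  rfl

theorem baseMap_chartTop (f : R →ₐ[F] S) (g : Matrix (Fin 2) (Fin 2) A) (x : R ⊗[F] A) :
    baseMap A f (chartTop g x) = chartTop g (baseMap A f x) := by
  simp [chartTop]

theorem baseMap_chartBot (f : R →ₐ[F] S) (g : Matrix (Fin 2) (Fin 2) A) (x : R ⊗[F] A) :
    baseMap A f (chartBot g x) = chartBot g (baseMap A f x) := by
  simp [chartBot]

theorem baseMap_chartColumn (f : R →ₐ[F] S) (g : Matrix (Fin 2) (Fin 2) A) (x : R ⊗[F] A) :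
    baseMap _ f (chartColumn g x) = chartColumn g (baseMap A f x) := by
  rw [chartColumn, baseMap_column, baseMap_chartTop, baseMap_chartBot, chartColumn]

theorem mem_columnIdeal {a b : R ⊗[F] A} {z : R ⊗[F] Matrix (Fin 2) (Fin 2) A} :
    z ∈ columnIdeal a b ↔ ∃ w, column a b * w = z := Iff.rfl

theorem isRightIdeal_columnIdeal (a b : R ⊗[F] A) : IsRightIdeal (columnIdeal a b) := by
  rintro _ ⟨w, rfl⟩ z
  exact ⟨w * z, (mul_assoc _ _ _).symm⟩

theorem columnIdeal_le_iff {a b : R ⊗[F] A} {J : Submodule R (R ⊗[F] Matrix (Fin 2) (Fin 2) A)}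
    (hJ : IsRightIdeal J) : columnIdeal a b ≤ J ↔ column a b ∈ J := by
  constructor
  · intro h
    exact h ⟨1, mul_one _⟩
  · rintro h _ ⟨w, rfl⟩
    exact hJ _ h _

/-- The linear map whose kernel is the ideal generated by the column `g (1, x)`. -/
def chartMap (g : (Matrix (Fin 2) (Fin 2) A)ˣ) (x : R ⊗[F] A) :
    R ⊗[F] Matrix (Fin 2) (Fin 2) A →ₗ[R] (Fin 2 → R ⊗[F] A) :=
  LinearMap.pi fun j =>
    ((Matrix.entryLinearMap R _ 1 j - LinearMap.mulLeft R x ∘ₗ Matrix.entryLinearMap R _ 0 j) ∘ₗ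
      (toMat (F := F) (A := A) (R := R)).toLinearMap) ∘ₗ LinearMap.mulLeft R (1 ⊗ₜ g⁻¹.1)

theorem chartMap_apply (g : (Matrix (Fin 2) (Fin 2) A)ˣ) (x : R ⊗[F] A)
    (z : R ⊗[F] Matrix (Fin 2) (Fin 2) A) (j : Fin 2) :
    chartMap g x z j = toMat ((1 ⊗ₜ g⁻¹.1) * z) 1 j - x * toMat ((1 ⊗ₜ g⁻¹.1) * z) 0 j := rfl

theorem tmul_inv_mul_cancel_left (g : (Matrix (Fin 2) (Fin 2) A)ˣ)
    (z : R ⊗[F] Matrix (Fin 2) (Fin 2) A) : (1 ⊗ₜ g⁻¹.1) * ((1 ⊗ₜ g.1) * z) = z := by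
  rw [← mul_assoc, Algebra.TensorProduct.tmul_mul_tmul, one_mul, Units.inv_mul,
    ← Algebra.TensorProduct.one_def, one_mul]

theorem tmul_mul_inv_cancel_left (g : (Matrix (Fin 2) (Fin 2) A)ˣ)
    (z : R ⊗[F] Matrix (Fin 2) (Fin 2) A) : (1 ⊗ₜ g.1) * ((1 ⊗ₜ g⁻¹.1) * z) = z := by
  rw [← mul_assoc, Algebra.TensorProduct.tmul_mul_tmul, one_mul, Units.mul_inv,
    ← Algebra.TensorProduct.one_def, one_mul]

/-- Multiplication by g⁻¹ reduces to the ideal [1, x], the matrices whose second row is x times the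
first. -/
theorem ker_chartMap (g : (Matrix (Fin 2) (Fin 2) A)ˣ) (x : R ⊗[F] A) :
    LinearMap.ker (chartMap g x) = columnIdeal (chartTop g.1 x) (chartBot g.1 x) := by
  ext z
  rw [LinearMap.mem_ker, mem_columnIdeal]
  change _ ↔ ∃ w, chartColumn g.1 x * w = z
  constructor
  · intro h
    have h1 : ∀ j, toMat ((1 ⊗ₜ g⁻¹.1) * z) 1 j = x * toMat ((1 ⊗ₜ g⁻¹.1) * z) 0 j := fun j => by
      rw [← sub_eq_zero, ← chartMap_apply, h, Pi.zero_apply]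
    refine ⟨∑ j, entry 0 j (toMat ((1 ⊗ₜ g⁻¹.1) * z) 0 j), ?_⟩
    rw [chartColumn_eq, mul_assoc, Finset.mul_sum]
    simp only [column_mul_entry, one_mul, ← h1]
    rw [Finset.sum_add_distrib]
    refine Eq.trans ?_ (tmul_mul_inv_cancel_left g z)
    conv_rhs => rw [← sum_entry ((1 ⊗ₜ g⁻¹.1) * z)]
    exact congrArg _ (Fin.sum_univ_two
      (fun i => ∑ j, entry i j (toMat ((1 ⊗ₜ g⁻¹.1) * z) i j))).symm
  · rintro ⟨w, rfl⟩
    ext j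
    rw [chartMap_apply, chartColumn_eq, mul_assoc, tmul_inv_mul_cancel_left, map_mul, toMat_column]
    simp [Matrix.mul_apply]

theorem chartMap_surjective (g : (Matrix (Fin 2) (Fin 2) A)ˣ) (x : R ⊗[F] A) :
    Function.Surjective (chartMap g x) := by
  intro y
  refine ⟨(1 ⊗ₜ g.1) * ∑ j, entry 1 j (y j), ?_⟩
  ext j
  rw [chartMap_apply, tmul_inv_mul_cancel_left, map_sum]
  simp only [toMat_entry, Fin.sum_univ_two, Matrix.add_apply]
  fin_cases j <;> simp

/-- The quotient by the ideal generated by `g (1, x)` is free. -/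
def chartQuotientEquiv (g : (Matrix (Fin 2) (Fin 2) A)ˣ) (x : R ⊗[F] A) :
    ((R ⊗[F] Matrix (Fin 2) (Fin 2) A) ⧸ columnIdeal (chartTop g.1 x) (chartBot g.1 x)) ≃ₗ[R]
      (Fin 2 → R ⊗[F] A) :=
  (Submodule.quotEquivOfEq _ _ (ker_chartMap g x).symm).trans
    ((chartMap g x).quotKerEquivOfSurjective (chartMap_surjective g x))

variable [FiniteDimensional F A] {n : ℕ}

/-- The point `[g (1, x)]` of the Grassmannian. -/
def chartPoint (hA : Module.finrank F A = n ^ 2) (g : (Matrix (Fin 2) (Fin 2) A)ˣ)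
    (x : R ⊗[F] A) :
    Module.Grassmannian R (R ⊗[F] Matrix (Fin 2) (Fin 2) A) ((2 * n) ^ 2 - n * (2 * n)) where
  toSubmodule := columnIdeal (chartTop g.1 x) (chartBot g.1 x)
  finite_quotient := Module.Finite.equiv (chartQuotientEquiv g x).symm
  projective_quotient := Module.Projective.of_equiv (chartQuotientEquiv g x).symm
  rankAtStalk_eq p := by
    have : Nontrivial R := ⟨⟨0, 1, fun h => p.isPrime.ne_top (Ideal.eq_top_iff_one _ |>.2
      (h ▸ p.asIdeal.zero_mem))⟩⟩
    rw [Module.rankAtStalk_eq_of_equiv (chartQuotientEquiv g x),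
      Module.rankAtStalk_eq_finrank_of_free, Module.finrank_pi_fintype]
    simp only [Module.finrank_baseChange, hA, Finset.sum_const, Finset.card_univ,
      Fintype.card_fin, smul_eq_mul]
    have : (2 * n) ^ 2 - n * (2 * n) = 2 * n ^ 2 := by
      rw [show (2 * n) ^ 2 = 2 * n ^ 2 + n * (2 * n) by ring, Nat.add_sub_cancel]
    rw [this]
    rfl

end Charts

/-! ### Equality and base change of points of the Grassmannian -/

section Grassmannian

variable {F : Type u} [Field F] {M : Type u} [AddCommGroup M] [Module F M]
  {R S : Type u} [CommRing R] [Algebra F R] [CommRing S] [Algebra F S] {k : ℕ}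

/-- A surjective linear map between finite projective modules of the same rank is injective. -/
theorem injective_of_surjective_of_rankAtStalk_eq {P Q : Type*} [AddCommGroup P] [Module R P]
    [AddCommGroup Q] [Module R Q] [Module.Finite R P] [Module.Projective R P] [Module.Finite R Q]
    [Module.Projective R Q] (f : P →ₗ[R] Q) (hf : Function.Surjective f)
    (h : Module.rankAtStalk (R := R) P = Module.rankAtStalk (R := R) Q) :
    Function.Injective f := by
  -- A section g of f gives P ≃ ker f × Q, so the kernel is finite projective of rank 0, hence zero.
  obtain ⟨g, hg⟩ := Module.projective_lifting_property f LinearMap.id hf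
  let e : P ≃ₗ[R] LinearMap.ker f × Q := LinearEquiv.ofBijective
    ((LinearMap.codRestrict (LinearMap.ker f) (LinearMap.id - g ∘ₗ f) (fun x => by
      have := LinearMap.congr_fun hg (f x)
      simp only [LinearMap.comp_apply, LinearMap.id_apply] at this
      simp [this])).prod f) (by
    have hgf : ∀ y, f (g y) = y := fun y => LinearMap.congr_fun hg y
    constructor
    · rw [← LinearMap.ker_eq_bot, LinearMap.ker_eq_bot']
      intro x hx
      have h1 : f x = 0 := congrArg Prod.snd hx
      have h2 : x - g (f x) = 0 := congrArg (fun t => (Prod.fst t).1) hx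
      rwa [h1, map_zero, sub_zero] at h2
    · rintro ⟨⟨x, hx⟩, y⟩
      refine ⟨x + g y, ?_⟩
      rw [LinearMap.mem_ker] at hx
      ext
      · simp [hx, hgf]
      · simp [hx, hgf])
  have h1 : Module.Finite R (LinearMap.ker f) :=
    Module.Finite.of_surjective ((LinearMap.fst R (LinearMap.ker f) Q) ∘ₗ e.toLinearMap)
      (fun y => ⟨e.symm (y, 0), by simp⟩)
  have h2 : Module.Projective R (LinearMap.ker f) :=
    Module.Projective.of_split (e.symm.toLinearMap ∘ₗ LinearMap.inl R _ _)
      (LinearMap.fst R _ _ ∘ₗ e.toLinearMap) (by ext x; simp)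
  have h3 := Module.rankAtStalk_eq_of_equiv e
  rw [Module.rankAtStalk_prod, h] at h3
  have h4 : Module.rankAtStalk (R := R) (LinearMap.ker f) = 0 := by
    simpa using h3
  rw [Module.rankAtStalk_eq_zero_iff_subsingleton] at h4
  rw [← LinearMap.ker_eq_bot]
  exact Submodule.eq_bot_of_subsingleton

/-- The surjection between the two quotients is injective because the ranks agree. Equality with a
column ideal thus reduces to membership of one column. -/
theorem grassmannian_eq_of_le {V : Type*} [AddCommGroup V] [Module R V]
    {N N' : Module.Grassmannian R V k} (h : N.toSubmodule ≤ N'.toSubmodule) : N = N' := by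
  apply Module.Grassmannian.ext
  refine le_antisymm h fun x hx => ?_
  have hinj := injective_of_surjective_of_rankAtStalk_eq
    (Submodule.factor h) (Submodule.factor_surjective h) (by
      ext p
      rw [N.rankAtStalk_eq, N'.rankAtStalk_eq])
  rw [← Submodule.Quotient.mk_eq_zero]
  apply hinj
  rw [map_zero]
  exact (Submodule.Quotient.mk_eq_zero _).2 hx

theorem baseChangeMkQ_baseMap {B : Type u} [Ring B] [Algebra F B] (f : R →ₐ[F] S)
    (N : Submodule R (R ⊗[F] B)) (z : R ⊗[F] B) :
    letI : Algebra R S := f.toAlgebra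
    haveI : IsScalarTower F R S := IsScalarTower.of_algebraMap_eq' f.comp_algebraMap.symm
    Module.Grassmannian.baseChangeMkQ S N (baseMap B f z) =
      (1 : S) ⊗ₜ[R] (Submodule.Quotient.mk z : (R ⊗[F] B) ⧸ N) := by
  let _ : Algebra R S := f.toAlgebra
  have : IsScalarTower F R S := IsScalarTower.of_algebraMap_eq' f.comp_algebraMap.symm
  induction z with
  | zero =>
    rw [map_zero, Submodule.Quotient.mk_zero, TensorProduct.tmul_zero]
    exact map_zero _
  | add x y hx hy => rw [map_add, map_add, hx, hy, ← TensorProduct.tmul_add]; rfl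
  | tmul r b =>
    have h1 : (r ⊗ₜ[F] b : R ⊗[F] B) = r • (1 ⊗ₜ b) := by
      rw [TensorProduct.smul_tmul', smul_eq_mul, mul_one]
    rw [h1, Submodule.Quotient.mk_smul, ← TensorProduct.smul_tmul]
    simp only [Module.Grassmannian.baseChangeMkQ, LinearMap.comp_apply,
      Algebra.TensorProduct.map_tmul, LinearEquiv.coe_coe,
      AlgebraTensorModule.cancelBaseChange_symm_tmul, LinearMap.baseChange_tmul,
      TensorProduct.smul_tmul', Submodule.mkQ_apply]
    congr 1
    rw [smul_eq_mul, Algebra.smul_def (A := S), mul_one, mul_one]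
    rfl

theorem mem_grassmannian_map_of_mem {B : Type u} [Ring B] [Algebra F B] (f : R →ₐ[F] S)
    {J : Module.Grassmannian R (R ⊗[F] B) k} {z : R ⊗[F] B} (hz : z ∈ J.toSubmodule) :
    baseMap B f z ∈ (Module.Grassmannian.map f J).toSubmodule := by
  rw [Module.Grassmannian.map_toSubmodule, LinearMap.mem_ker]
  refine (baseChangeMkQ_baseMap f J.toSubmodule z).trans ?_
  rw [(Submodule.Quotient.mk_eq_zero _).2 hz, TensorProduct.tmul_zero]

/-- Base change is defined through the quotient; right exactness of the tensor product identifies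
its kernel. -/
theorem grassmannian_map_eq_span {B : Type u} [Ring B] [Algebra F B] (f : R →ₐ[F] S)
    (J : Module.Grassmannian R (R ⊗[F] B) k) :
    (Module.Grassmannian.map f J).toSubmodule =
      Submodule.span S (baseMap B f '' (J.toSubmodule : Set (R ⊗[F] B))) := by
  let _ : Algebra R S := f.toAlgebra
  have : IsScalarTower F R S := IsScalarTower.of_algebraMap_eq' f.comp_algebraMap.symm
  apply le_antisymm
  · intro z hz
    rw [Module.Grassmannian.map_toSubmodule, LinearMap.mem_ker] at hz
    have h1 : J.toSubmodule.mkQ.lTensor S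
        ((AlgebraTensorModule.cancelBaseChange F R S S B).symm z) = 0 := hz
    have h2 := (lTensor_exact S (LinearMap.exact_subtype_mkQ J.toSubmodule)
      J.toSubmodule.mkQ_surjective _).1 h1
    obtain ⟨w, hw⟩ := h2
    have key : ∀ (s : S) (x : R ⊗[F] B), AlgebraTensorModule.cancelBaseChange F R S S B (s ⊗ₜ x) =
        s • baseMap B f x := by
      intro s x
      induction x with
      | zero => rw [TensorProduct.tmul_zero, map_zero, map_zero, smul_zero]
      | add x y hx hy => rw [TensorProduct.tmul_add, map_add, map_add, hx, hy, smul_add]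
      | tmul r b =>
        rw [AlgebraTensorModule.cancelBaseChange_tmul, Algebra.TensorProduct.map_tmul,
          TensorProduct.smul_tmul', smul_eq_mul, mul_comm]
        rfl
    have h3 : z = AlgebraTensorModule.cancelBaseChange F R S S B
        (J.toSubmodule.subtype.lTensor S w) := by
      rw [hw, LinearEquiv.apply_symm_apply]
    rw [h3]
    clear h3 hw
    induction w with
    | zero => rw [map_zero, map_zero]; exact Submodule.zero_mem _
    | add x y hx hy => rw [map_add, map_add]; exact Submodule.add_mem _ hx hy
    | tmul s x =>
      rw [LinearMap.lTensor_tmul, key]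
      exact Submodule.smul_mem _ _ (Submodule.subset_span ⟨x, x.2, rfl⟩)
  · rw [Submodule.span_le]
    rintro _ ⟨z, hz, rfl⟩
    exact mem_grassmannian_map_of_mem f hz

end Grassmannian

/-! ### Transition between charts -/

section SeveriBrauerCharts

variable {F : Type u} [Field F] {A : Type u} [Ring A] [Algebra F A] [FiniteDimensional F A] {n : ℕ}
  {R S : Type u} [CommRing R] [Algebra F R] [CommRing S] [Algebra F S]

theorem isRightIdeal_chartPoint (hA : Module.finrank F A = n ^ 2)
    (g : (Matrix (Fin 2) (Fin 2) A)ˣ) (x : R ⊗[F] A) :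
    IsRightIdeal (chartPoint hA g x).toSubmodule :=
  isRightIdeal_columnIdeal _ _

theorem chartColumn_mem_chartPoint (hA : Module.finrank F A = n ^ 2)
    (g : (Matrix (Fin 2) (Fin 2) A)ˣ) (x : R ⊗[F] A) :
    chartColumn g.1 x ∈ (chartPoint hA g x).toSubmodule :=
  (columnIdeal_le_iff (isRightIdeal_columnIdeal _ _)).1 le_rfl

theorem chartPoint_eq_of_mem (hA : Module.finrank F A = n ^ 2)
    {g : (Matrix (Fin 2) (Fin 2) A)ˣ} {x : R ⊗[F] A}
    {J : Module.Grassmannian R (R ⊗[F] Matrix (Fin 2) (Fin 2) A) ((2 * n) ^ 2 - n * (2 * n))}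
    (hJ : IsRightIdeal J.toSubmodule) (h : chartColumn g.1 x ∈ J.toSubmodule) :
    chartPoint hA g x = J :=
  grassmannian_eq_of_le ((columnIdeal_le_iff hJ).2 h)

theorem grassmannian_map_chartPoint (hA : Module.finrank F A = n ^ 2) (f : R →ₐ[F] S)
    (g : (Matrix (Fin 2) (Fin 2) A)ˣ) (x : R ⊗[F] A) :
    Module.Grassmannian.map f (chartPoint hA g x) = chartPoint hA g (baseMap A f x) := by
  refine (chartPoint_eq_of_mem hA
    (IsRightIdeal.grassmannian_map f (isRightIdeal_chartPoint hA g x)) ?_).symm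
  rw [← baseMap_chartColumn]
  exact mem_grassmannian_map_of_mem f (chartColumn_mem_chartPoint hA g x)

omit [FiniteDimensional F A] in
theorem toMat_tmul_inv_mul_chartColumn (g : (Matrix (Fin 2) (Fin 2) A)ˣ) (x : R ⊗[F] A) :
    toMat ((1 ⊗ₜ g⁻¹.1) * chartColumn g.1 x) = !![1, 0; x, 0] := by
  rw [chartColumn_eq, tmul_inv_mul_cancel_left, toMat_column]

theorem chartPoint_injective (hA : Module.finrank F A = n ^ 2)
    (g : (Matrix (Fin 2) (Fin 2) A)ˣ) {x y : R ⊗[F] A}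
    (h : chartPoint hA g x = chartPoint hA g y) : x = y := by
  have h1 := chartColumn_mem_chartPoint hA g x
  rw [h] at h1
  change _ ∈ columnIdeal (chartTop g.1 y) (chartBot g.1 y) at h1
  rw [← ker_chartMap, LinearMap.mem_ker] at h1
  have h2 := congrFun h1 0
  rw [chartMap_apply, toMat_tmul_inv_mul_chartColumn] at h2
  simpa [sub_eq_zero] using h2

/-- The first entry of `g⁻¹ h (1, y)`. -/
def transitionEntry (g h : (Matrix (Fin 2) (Fin 2) A)ˣ) (y : R ⊗[F] A) : R ⊗[F] A :=
  chartTop (g⁻¹.1 * h.1) y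

omit [FiniteDimensional F A] in
theorem baseMap_transitionEntry (f : R →ₐ[F] S) (g h : (Matrix (Fin 2) (Fin 2) A)ˣ)
    (y : R ⊗[F] A) :
    baseMap A f (transitionEntry g h y) = transitionEntry g h (baseMap A f y) :=
  baseMap_chartTop _ _ _

omit [FiniteDimensional F A] in
theorem tmul_inv_mul_chartColumn (g h : (Matrix (Fin 2) (Fin 2) A)ˣ) (y : R ⊗[F] A) :
    (1 ⊗ₜ g⁻¹.1) * chartColumn h.1 y =
      column (transitionEntry g h y) (chartBot (g⁻¹.1 * h.1) y) := by
  rw [chartColumn_eq, ← mul_assoc, Algebra.TensorProduct.tmul_mul_tmul, one_mul, ← chartColumn_eq]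
  rfl

/-- If g⁻¹h(1, y) = (a, b) with a invertible, right division by a gives (1, b a⁻¹). Conversely,
equality of the ideals yields a right inverse of a, which suffices by `isUnit_of_mul_eq_one`. -/
theorem isUnit_transitionEntry_iff (hA : Module.finrank F A = n ^ 2)
    (g h : (Matrix (Fin 2) (Fin 2) A)ˣ) (y : R ⊗[F] A) :
    IsUnit (transitionEntry g h y) ↔ ∃ x : R ⊗[F] A, chartPoint hA h y = chartPoint hA g x := by
  constructor
  · rintro ⟨a, ha⟩
    refine ⟨chartBot (g⁻¹.1 * h.1) y * a⁻¹.1, (chartPoint_eq_of_mem hA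
      (isRightIdeal_chartPoint hA h y) ?_).symm⟩
    refine ⟨entry 0 0 a⁻¹.1, ?_⟩
    change chartColumn h.1 y * _ = _
    rw [← tmul_mul_inv_cancel_left g (chartColumn h.1 y), tmul_inv_mul_chartColumn, mul_assoc,
      column_mul_entry, ← ha, Units.mul_inv, chartColumn_eq]
    rfl
  · rintro ⟨x, hx⟩
    have h1 := chartColumn_mem_chartPoint hA g x
    rw [← hx] at h1
    obtain ⟨w, hw⟩ := h1
    change chartColumn h.1 y * w = _ at hw
    have h2 := congrArg (fun z => toMat ((1 ⊗ₜ g⁻¹.1) * z) 0 0) hw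
    simp only [toMat_tmul_inv_mul_chartColumn] at h2
    rw [← mul_assoc, tmul_inv_mul_chartColumn, map_mul, toMat_column] at h2
    simp only [Matrix.mul_apply, Fin.sum_univ_two] at h2
    refine isUnit_of_mul_eq_one (b := toMat w 0 0) ?_
    simpa using h2

/-- The right ideal generated by `γ e₁₁`. -/
def chartComplement (γ : R ⊗[F] Matrix (Fin 2) (Fin 2) A) :
    Submodule R (R ⊗[F] Matrix (Fin 2) (Fin 2) A) :=
  LinearMap.range (LinearMap.mulLeft R (γ * entry 1 1 1))

/-- With indices from 0, write 1 = j + g e₁₁ w. The first column of j g = g(1 − e₁₁ w g) is g(1, −(w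
g)₁₀), and it lies in J. Directness of the sum is not needed, since the ranks agree. -/
theorem exists_eq_chartPoint (hA : Module.finrank F A = n ^ 2)
    (g : (Matrix (Fin 2) (Fin 2) A)ˣ)
    {J : Module.Grassmannian R (R ⊗[F] Matrix (Fin 2) (Fin 2) A) ((2 * n) ^ 2 - n * (2 * n))}
    (hJ : IsRightIdeal J.toSubmodule)
    (h : (1 : R ⊗[F] Matrix (Fin 2) (Fin 2) A) ∈ J.toSubmodule ⊔ chartComplement (1 ⊗ₜ g.1)) :
    ∃ x : R ⊗[F] A, J = chartPoint hA g x := by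
  obtain ⟨j, hj, _, ⟨w, rfl⟩, hw⟩ := Submodule.mem_sup.1 h
  rw [LinearMap.mulLeft_apply] at hw
  refine ⟨- toMat (w * (1 ⊗ₜ g.1)) 1 0, (chartPoint_eq_of_mem hA hJ ?_).symm⟩
  have h1 := hJ _ (hJ _ hj (1 ⊗ₜ g.1)) (entry 0 0 1)
  convert h1 using 1
  rw [eq_sub_of_add_eq hw, sub_mul, one_mul, sub_mul, chartColumn_eq, mul_assoc, mul_assoc,
    mul_assoc, ← mul_sub]
  congr 1
  apply toMat_injective
  simp only [map_sub, toMat_column, map_mul, toMat_entry]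
  ext k l
  fin_cases k <;> fin_cases l <;> simp [Matrix.mul_apply]

end SeveriBrauerCharts

/-! ### The atlas of the Severi–Brauer functor -/

section Atlas

variable {F : Type u} [Field F] {A : Type u} [Ring A] [Algebra F A] [FiniteDimensional F A] {n : ℕ}

/-- The point of the Severi–Brauer functor given by `[g (1, x)]`. -/
def sbPoint (hA : Module.finrank F A = n ^ 2) (g : (Matrix (Fin 2) (Fin 2) A)ˣ)
    {R : CommAlgCat.{u} F} (x : R ⊗[F] A) :
    (severiBrauer F (Matrix (Fin 2) (Fin 2) A) (2 * n) n).toFunctor.obj R :=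
  ⟨chartPoint hA g x, isRightIdeal_chartPoint hA g x⟩

theorem severiBrauer_map_sbPoint (hA : Module.finrank F A = n ^ 2)
    (g : (Matrix (Fin 2) (Fin 2) A)ˣ) {R S : CommAlgCat.{u} F} (f : R ⟶ S) (x : R ⊗[F] A) :
    (severiBrauer F (Matrix (Fin 2) (Fin 2) A) (2 * n) n).toFunctor.map f (sbPoint hA g x) =
      sbPoint hA g (baseMap A f.hom x) :=
  Subtype.ext (grassmannian_map_chartPoint hA f.hom g x)

theorem sbPoint_eq_iff (hA : Module.finrank F A = n ^ 2)
    (g h : (Matrix (Fin 2) (Fin 2) A)ˣ) {R : CommAlgCat.{u} F} (x y : R ⊗[F] A) :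
    sbPoint hA g x = sbPoint hA h y ↔ chartPoint hA g x = chartPoint hA h y :=
  Subtype.ext_iff

variable (F A) in
/-- The coordinate ring of the affine space `R ↦ A ⊗ R`, as an object of the category of
algebras. -/
abbrev coordAlg : CommAlgCat.{u} F := .of F (CoordRing F A)

/-- The determinant describing the intersection of the charts indexed by `h` and `g` in the chart
indexed by `h`. -/
def overlapElement (h g : (Matrix (Fin 2) (Fin 2) A)ˣ) : coordAlg F A :=
  mulDet (transitionEntry g h (generic F A))

theorem isUnit_overlapElement_iff (hA : Module.finrank F A = n ^ 2)
    (h g : (Matrix (Fin 2) (Fin 2) A)ˣ) {R : CommAlgCat.{u} F} (φ : coordAlg F A ⟶ R) :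
    IsUnit (φ (overlapElement h g)) ↔
      ∃ x : R ⊗[F] A, chartPoint hA h (baseMap A φ.hom (generic F A)) = chartPoint hA g x := by
  rw [← isUnit_transitionEntry_iff, ← baseMap_transitionEntry, isUnit_iff_isUnit_mulDet,
    mulDet_map]
  rfl

theorem severiBrauer_isAtlas (hA : Module.finrank F A = n ^ 2)
    (hcov : LocallyCovered (severiBrauer F (Matrix (Fin 2) (Fin 2) A) (2 * n) n).toFunctor
      (fun _ : (Matrix (Fin 2) (Fin 2) A)ˣ => coordAlg F A)
      fun g => sbPoint hA g (generic F A)) :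
    IsAtlas (severiBrauer F (Matrix (Fin 2) (Fin 2) A) (2 * n) n).toFunctor
      (fun _ : (Matrix (Fin 2) (Fin 2) A)ˣ => coordAlg F A)
      fun g => sbPoint hA g (generic F A) where
  mono g R φ ψ h := by
    rw [severiBrauer_map_sbPoint, severiBrauer_map_sbPoint, sbPoint_eq_iff] at h
    exact CommAlgCat.hom_ext (coordRing_hom_ext (chartPoint_injective hA g h))
  overlap h g := by
    refine ⟨overlapElement h g, fun R φ => ?_⟩
    rw [isUnit_overlapElement_iff hA]
    constructor
    · rintro ⟨x, hx⟩
      refine ⟨CommAlgCat.ofHom (coordHom x), ?_⟩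
      rw [severiBrauer_map_sbPoint, severiBrauer_map_sbPoint, sbPoint_eq_iff, hx,
        CommAlgCat.hom_ofHom, baseMap_coordHom_generic]
    · rintro ⟨ψ, hψ⟩
      rw [severiBrauer_map_sbPoint, severiBrauer_map_sbPoint, sbPoint_eq_iff] at hψ
      exact ⟨_, hψ⟩
  cov := hcov

end Atlas

/-! ### The Severi–Brauer functor is a Zariski sheaf -/

section GrassmannianSheaf

variable {F : Type u} [Field F] {B : Type u} [Ring B] [Algebra F B] {k : ℕ}

theorem baseMap_mem_map_iff {R S : Type u} [CommRing R] [Algebra F R] [CommRing S] [Algebra F S]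
    (φ : R →ₐ[F] S) (f : R) (hφ : letI := φ.toAlgebra; IsLocalization.Away f S)
    {J : Module.Grassmannian R (R ⊗[F] B) k} {x : R ⊗[F] B} :
    baseMap B φ x ∈ (Module.Grassmannian.map φ J).toSubmodule ↔
      ∃ N : ℕ, f ^ N • x ∈ J.toSubmodule := by
  let _ : Algebra R S := φ.toAlgebra
  have : IsScalarTower F R S := IsScalarTower.of_algebraMap_eq' φ.comp_algebraMap.symm
  have : IsLocalization.Away f S := hφ
  rw [Module.Grassmannian.map_toSubmodule, LinearMap.mem_ker]
  have h := IsLocalizedModule.eq_zero_iff (Submonoid.powers f)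
    (TensorProduct.mk R S ((R ⊗[F] B) ⧸ J.toSubmodule) 1) (m := Submodule.Quotient.mk x)
  rw [TensorProduct.mk_apply] at h
  refine (Eq.congr_left (baseChangeMkQ_baseMap φ J.toSubmodule x)).trans ?_
  rw [h]
  constructor
  · rintro ⟨⟨_, N, rfl⟩, hN⟩
    exact ⟨N, (Submodule.Quotient.mk_eq_zero _).1 hN⟩
  · rintro ⟨N, hN⟩
    exact ⟨⟨_, N, rfl⟩, (Submodule.Quotient.mk_eq_zero _).2 hN⟩

theorem baseMap_toAway_mem_map_iff {R : CommAlgCat.{u} F} (f : R)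
    {J : Module.Grassmannian R (R ⊗[F] B) k} {x : R ⊗[F] B} :
    baseMap B (toAway R f).hom x ∈ (Module.Grassmannian.map (toAway R f).hom J).toSubmodule ↔
      ∃ N : ℕ, f ^ N • x ∈ J.toSubmodule := by
  refine baseMap_mem_map_iff _ f ?_
  have h : (toAway R f).hom.toAlgebra =
      (inferInstance : Algebra R (Localization.Away f)) := Algebra.algebra_ext _ _ fun _ => rfl
  rw [h]
  exact inferInstanceAs (IsLocalization.Away f (Localization.Away f))

theorem exists_baseMap_toAway_eq {R : CommAlgCat.{u} F} (f : R) (y : away R f ⊗[F] B) :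
    ∃ (N : ℕ) (x : R ⊗[F] B), baseMap B (toAway R f).hom x = (toAway R f f) ^ N • y := by
  induction y with
  | zero => exact ⟨0, 0, by simp⟩
  | add y z hy hz =>
    obtain ⟨N, x, hx⟩ := hy
    obtain ⟨M, w, hw⟩ := hz
    refine ⟨N + M, f ^ M • x + f ^ N • w, ?_⟩
    rw [map_add, baseMap_smul, baseMap_smul, hx, hw, map_pow, map_pow, smul_smul, smul_smul,
      smul_add, pow_add, mul_comm]
  | tmul s b =>
    obtain ⟨⟨r, ⟨_, N, rfl⟩⟩, hr⟩ := IsLocalization.surj (Submonoid.powers f) s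
    refine ⟨N, r ⊗ₜ b, ?_⟩
    rw [Algebra.TensorProduct.map_tmul, TensorProduct.smul_tmul', smul_eq_mul]
    congr 1
    refine Eq.trans hr.symm ?_
    rw [mul_comm, map_pow]
    rfl

theorem exists_pow_smul_mem_of_forall {R : CommAlgCat.{u} F} {ι : Type u} [Finite ι] {f : R}
    {M : Type u} [AddCommGroup M] [Module R M] {N : ι → Submodule R M} {x : M}
    (h : ∀ i, ∃ K : ℕ, f ^ K • x ∈ N i) : ∃ K : ℕ, ∀ i, f ^ K • x ∈ N i := by
  classical
  have := Fintype.ofFinite ι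
  choose K hK using h
  refine ⟨∑ i, K i, fun i => ?_⟩
  rw [← Finset.sum_erase_add _ _ (Finset.mem_univ i), pow_add, mul_smul]
  exact (N i).smul_mem _ (hK i)

theorem grassmannian_ext_of_away {R : CommAlgCat.{u} F} {ι : Type u} (f : ι → R)
    (hf : Ideal.span (Set.range f) = ⊤) {J J' : Module.Grassmannian R (R ⊗[F] B) k}
    (h : ∀ i, Module.Grassmannian.map (toAway R (f i)).hom J =
      Module.Grassmannian.map (toAway R (f i)).hom J') : J = J' := by
  refine grassmannian_eq_of_le fun x hx => ?_
  refine Submodule.mem_of_span_eq_top_of_smul_pow_mem _ _ hf _ ?_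
  rintro ⟨_, i, rfl⟩
  rw [← baseMap_toAway_mem_map_iff, ← h i]
  exact mem_grassmannian_map_of_mem _ hx

section Glue

variable {R : CommAlgCat.{u} F} {ι : Type u} (f : ι → R)
  (x : ∀ i, Module.Grassmannian (away R (f i)) (away R (f i) ⊗[F] B) k)

/-- The submodule glued from submodules over localizations. -/
def gluedSubmodule : Submodule R (R ⊗[F] B) where
  carrier := {z | ∀ i, baseMap B (toAway R (f i)).hom z ∈ (x i).toSubmodule}
  add_mem' hy hz i := by
    rw [map_add]
    exact (x i).toSubmodule.add_mem (hy i) (hz i)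
  zero_mem' i := by
    rw [map_zero]
    exact (x i).toSubmodule.zero_mem
  smul_mem' r z hz i := by
    rw [baseMap_smul]
    exact (x i).toSubmodule.smul_mem _ (hz i)

/-- The quotient map to the given quotients over the localizations. -/
def gluedQuotientMap (i : ι) : ((R ⊗[F] B) ⧸ gluedSubmodule f x) →ₗ[R]
    (Localization.Away (f i) ⊗[F] B) ⧸ (x i).toSubmodule :=
  (gluedSubmodule f x).liftQ
    (((x i).toSubmodule.mkQ.restrictScalars R) ∘ₗ
      AlgebraTensorModule.rTensor F B (Algebra.linearMap R (Localization.Away (f i))))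
    fun z hz => by
      rw [LinearMap.mem_ker]
      exact (Submodule.Quotient.mk_eq_zero _).2 (hz i)

theorem gluedQuotientMap_mk (i : ι) (z : R ⊗[F] B) :
    gluedQuotientMap f x i (Submodule.Quotient.mk z) =
      Submodule.Quotient.mk (baseMap B (toAway R (f i)).hom z) := rfl

variable (hx : ∀ i j (S : CommAlgCat.{u} F) (a : away R (f i) ⟶ S) (b : away R (f j) ⟶ S),
    toAway R (f i) ≫ a = toAway R (f j) ≫ b →
      Module.Grassmannian.map a.hom (x i) = Module.Grassmannian.map b.hom (x j))
include hx

/-- Over the overlap with the j-th open set the ideals x i and x j agree, so a power of f i moves z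
into x j. Since there are finitely many j, one exponent serves for all. -/
theorem exists_pow_smul_mem_gluedSubmodule [Finite ι] {i : ι} {z : R ⊗[F] B}
    (hz : baseMap B (toAway R (f i)).hom z ∈ (x i).toSubmodule) :
    ∃ N : ℕ, f i ^ N • z ∈ gluedSubmodule f x := by
  -- The one-element family isolates the condition at j.
  have h : ∀ j, ∃ N : ℕ, f i ^ N • z ∈ gluedSubmodule (ι := PUnit.{u + 1}) (fun _ => f j)
      fun _ => x j := by
    intro j
    let b := toAway (away R (f j)) (toAway R (f j) (f i))
    let a : away R (f i) ⟶ away (away R (f j)) (toAway R (f j) (f i)) :=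
      awayLift (f i) (toAway R (f j) ≫ b) (isUnit_toAway _ _)
    have hab : toAway R (f i) ≫ a = toAway R (f j) ≫ b := toAway_awayLift _ _ _
    have h1 := mem_grassmannian_map_of_mem a.hom hz
    rw [hx i j _ a b hab, baseMap_baseMap] at h1
    have h2 : a.hom.comp (toAway R (f i)).hom = b.hom.comp (toAway R (f j)).hom :=
      congrArg CommAlgCat.Hom.hom hab
    rw [h2, ← baseMap_baseMap, baseMap_toAway_mem_map_iff] at h1
    obtain ⟨N, hN⟩ := h1
    refine ⟨N, fun _ => ?_⟩
    rw [baseMap_smul, map_pow]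
    exact hN
  obtain ⟨N, hN⟩ := exists_pow_smul_mem_of_forall h
  exact ⟨N, fun j => hN j ⟨⟩⟩

/-- The glued quotient localizes to the given quotients, from which it inherits finiteness,
projectivity and rank. -/
theorem gluedQuotientMap_isLocalizedModule [Finite ι] (i : ι) :
    IsLocalizedModule (Submonoid.powers (f i)) (gluedQuotientMap f x i) where
  map_units s := by
    rw [← (Algebra.lsmul R (A := Localization.Away (f i)) R _).commutes]
    exact (IsLocalization.map_units (Localization.Away (f i)) s).map _
  surj y := by
    obtain ⟨y, rfl⟩ := Submodule.Quotient.mk_surjective _ y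
    obtain ⟨N, z, hz⟩ := exists_baseMap_toAway_eq (f i) y
    refine ⟨⟨Submodule.Quotient.mk z, ⟨_, N, rfl⟩⟩, ?_⟩
    rw [gluedQuotientMap_mk, hz, Submonoid.smul_def, ← algebraMap_smul (Localization.Away (f i)),
      map_pow]
    rfl
  exists_of_eq {y z} h := by
    obtain ⟨y, rfl⟩ := Submodule.Quotient.mk_surjective _ y
    obtain ⟨z, rfl⟩ := Submodule.Quotient.mk_surjective _ z
    rw [gluedQuotientMap_mk, gluedQuotientMap_mk, Submodule.Quotient.eq, ← map_sub] at h
    obtain ⟨N, hN⟩ := exists_pow_smul_mem_gluedSubmodule f x hx h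
    refine ⟨⟨_, N, rfl⟩, (Submodule.Quotient.eq _).2 ?_⟩
    rw [← smul_sub]
    exact hN

/-- Finite presentation and flatness are local on the base, and together they imply projectivity. -/
theorem finitePresentation_projective_gluedQuotient [Finite ι]
    (hf : Ideal.span (Set.range f) = ⊤) :
    Module.Finite R ((R ⊗[F] B) ⧸ gluedSubmodule f x) ∧
      Module.Projective R ((R ⊗[F] B) ⧸ gluedSubmodule f x) := by
  choose idx hidx using fun r : Set.range f => r.2
  have hloc : ∀ r : Set.range f, IsLocalization.Away r.1 (Localization.Away (f (idx r))) := by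
    intro r
    rw [← hidx r]
    infer_instance
  have hmod : ∀ r : Set.range f, IsLocalizedModule (Submonoid.powers r.1)
      (gluedQuotientMap f x (idx r)) := by
    intro r
    rw [← hidx r]
    exact gluedQuotientMap_isLocalizedModule f x hx _
  have hproj : ∀ i, Module.Projective (Localization.Away (f i))
      ((Localization.Away (f i) ⊗[F] B) ⧸ (x i).toSubmodule) := fun i => (x i).projective_quotient
  have hfin : ∀ i, Module.Finite (Localization.Away (f i))
      ((Localization.Away (f i) ⊗[F] B) ⧸ (x i).toSubmodule) := fun i => (x i).finite_quotient
  have h1 : Module.FinitePresentation R ((R ⊗[F] B) ⧸ gluedSubmodule f x) :=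
    Module.FinitePresentation.of_localizationSpan' (Set.range f) hf
      (Rₚ := fun r => Localization.Away (f (idx r)))
      (fun r => gluedQuotientMap f x (idx r))
      fun r => Module.finitePresentation_of_projective _ _
  have h2 : Module.Flat R ((R ⊗[F] B) ⧸ gluedSubmodule f x) :=
    Module.flat_of_isLocalized_span R _ (Set.range f) hf
      (fun r => (Localization.Away (f (idx r)) ⊗[F] B) ⧸ (x (idx r)).toSubmodule)
      (fun r => gluedQuotientMap f x (idx r)) fun r => by
        have : Module.Flat R (Localization.Away (f (idx r))) :=
          IsLocalization.flat _ (Submonoid.powers (f (idx r)))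
        exact Module.Flat.trans R (Localization.Away (f (idx r))) _
  exact ⟨inferInstance, Module.Flat.projective_of_finitePresentation⟩

theorem exists_grassmannian_glue [Finite ι] (hf : Ideal.span (Set.range f) = ⊤) :
    ∃ J : Module.Grassmannian R (R ⊗[F] B) k, J.toSubmodule = gluedSubmodule f x ∧
      ∀ i, Module.Grassmannian.map (toAway R (f i)).hom J = x i := by
  obtain ⟨hfin, hproj⟩ := finitePresentation_projective_gluedQuotient f x hx hf
  let J : Module.Grassmannian R (R ⊗[F] B) k :=
    { toSubmodule := gluedSubmodule f x
      finite_quotient := hfin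
      projective_quotient := hproj
      rankAtStalk_eq := fun p => by
        obtain ⟨i, hi⟩ : ∃ i, f i ∉ p.asIdeal := by
          by_contra! h
          refine p.isPrime.ne_top (top_le_iff.1 (hf ▸ Ideal.span_le.2 ?_))
          rintro _ ⟨i, rfl⟩
          exact h i
        have hp : p ∈ Set.range (PrimeSpectrum.comap
            (algebraMap R (Localization.Away (f i)))) := by
          rw [PrimeSpectrum.localization_away_comap_range (Localization.Away (f i)) (f i)]
          exact hi
        obtain ⟨q, rfl⟩ := hp
        have := gluedQuotientMap_isLocalizedModule f x hx i
        have h1 := IsLocalizedModule.isBaseChange (Submonoid.powers (f i))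
          (Localization.Away (f i)) (gluedQuotientMap f x i)
        rw [← Module.rankAtStalk_isBaseChange h1]
        exact (x i).rankAtStalk_eq q }
  refine ⟨J, rfl, fun i => (grassmannian_eq_of_le fun y hy => ?_).symm⟩
  obtain ⟨N, z, hz⟩ := exists_baseMap_toAway_eq (f i) y
  have h1 : baseMap B (toAway R (f i)).hom z ∈ (x i).toSubmodule := by
    rw [hz]
    exact (x i).toSubmodule.smul_mem _ hy
  have h2 := (baseMap_toAway_mem_map_iff (J := J) (f i)).2
    (exists_pow_smul_mem_gluedSubmodule f x hx h1)
  rw [hz] at h2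
  exact (Submodule.smul_mem_iff_of_isUnit _ ((isUnit_toAway R (f i)).pow N)).1 h2

end Glue

theorem severiBrauer_isZariskiSheaf (d m : ℕ) :
    IsZariskiSheaf (severiBrauer F B d m).toFunctor where
  ext R ι _ f hf x y h :=
    Subtype.ext (grassmannian_ext_of_away f hf fun i => congrArg Subtype.val (h i))
  glue R ι _ f hf x hx := by
    obtain ⟨J, hJ, h⟩ := exists_grassmannian_glue f (fun i => (x i).1)
      (fun i j S a b hab => congrArg Subtype.val (hx i j S a b hab)) hf
    refine ⟨⟨J, ?_⟩, fun i => Subtype.ext (h i)⟩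
    change IsRightIdeal J.toSubmodule
    rw [hJ]
    intro z hz b i
    rw [map_mul]
    exact (x i).2 _ (hz i) _

end GrassmannianSheaf

/-! ### The norm section is a Zariski sheaf -/

section NormSectionSheaf

variable {F : Type u} [Field F] {A : Type u} [Ring A] [Algebra F A] {n : ℕ}

theorem eq_of_forall_toAway_eq {R : CommAlgCat.{u} F} {ι : Type u} (f : ι → R)
    (hf : Ideal.span (Set.range f) = ⊤) {x y : R}
    (h : ∀ i, toAway R (f i) x = toAway R (f i) y) : x = y := by
  rw [← sub_eq_zero, ← Submodule.mem_bot R]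
  refine Submodule.mem_of_span_eq_top_of_smul_pow_mem _ _ hf _ ?_
  rintro ⟨_, i, rfl⟩
  have h1 : algebraMap R (Localization.Away (f i)) (x - y) = 0 := by
    rw [map_sub, sub_eq_zero]
    exact h i
  rw [IsLocalization.map_eq_zero_iff (Submonoid.powers (f i))] at h1
  obtain ⟨⟨_, N, rfl⟩, hN⟩ := h1
  exact ⟨N, hN⟩

theorem columnIdeal_map {R S : Type u} [CommRing R] [Algebra F R] [CommRing S] [Algebra F S]
    (φ : R →ₐ[F] S) {k : ℕ}
    {J : Module.Grassmannian R (R ⊗[F] Matrix (Fin 2) (Fin 2) A) k} {a b : R ⊗[F] A}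
    (h : J.toSubmodule = columnIdeal a b) :
    (Module.Grassmannian.map φ J).toSubmodule = columnIdeal (baseMap A φ a) (baseMap A φ b) := by
  apply le_antisymm
  · rw [grassmannian_map_eq_span, Submodule.span_le]
    rintro _ ⟨z, hz, rfl⟩
    rw [h] at hz
    obtain ⟨w, rfl⟩ := hz
    rw [LinearMap.mulLeft_apply, map_mul, baseMap_column]
    exact ⟨_, rfl⟩
  · have hJ : IsRightIdeal J.toSubmodule := h ▸ isRightIdeal_columnIdeal a b
    rw [columnIdeal_le_iff (hJ.grassmannian_map φ), ← baseMap_column]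
    refine mem_grassmannian_map_of_mem φ ?_
    rw [h]
    exact (columnIdeal_le_iff (isRightIdeal_columnIdeal a b)).1 le_rfl

variable [FiniteDimensional F A] [PerfectField F] [Algebra.IsCentral F A] [IsSimpleRing A]

theorem mem_normSection_of_forall_away (hA : Module.finrank F A = n ^ 2) {R : CommAlgCat.{u} F}
    {ι : Type u} (f : ι → R) (hf : Ideal.span (Set.range f) = ⊤)
    (J : (severiBrauer F (Matrix (Fin 2) (Fin 2) A) (2 * n) n).toFunctor.obj R)
    (h : ∀ i, (severiBrauer F (Matrix (Fin 2) (Fin 2) A) (2 * n) n).toFunctor.map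
      (toAway R (f i)) J ∈ (normSection F A n).obj (away R (f i))) :
    J ∈ (normSection F A n).obj R := by
  intro S φ a b hab
  refine eq_of_forall_toAway_eq (fun i => φ (f i)) (span_range_map φ hf) fun i => ?_
  have h1 := h i _ (awayMap φ (f i)) (baseMap A (toAway S (φ (f i))).hom a)
    (baseMap A (toAway S (φ (f i))).hom b) ?_
  · rw [reducedNorm_map hA, reducedNorm_map hA] at h1
    exact h1
  · rw [← columnIdeal_map _ hab]
    refine congrArg Module.Grassmannian.toSubmodule ?_
    refine ((Module.Grassmannian.map_comp _ _ _ J.1).symm.trans ?_).trans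
      (Module.Grassmannian.map_comp _ _ _ J.1)
    exact congrArg (fun c : R ⟶ away S (φ (f i)) => Module.Grassmannian.map c.hom J.1)
      (toAway_awayMap φ (f i))

theorem normSection_isZariskiSheaf (hA : Module.finrank F A = n ^ 2) :
    IsZariskiSheaf (normSection F A n).toFunctor where
  ext R ι _ f hf x y h :=
    Subtype.ext ((severiBrauer_isZariskiSheaf (2 * n) n).ext R f hf _ _ fun i =>
      congrArg Subtype.val (h i))
  glue R ι _ f hf x hx := by
    obtain ⟨J, hJ⟩ := (severiBrauer_isZariskiSheaf (2 * n) n).glue R f hf (fun i => (x i).1)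
      (fun i j S a b hab => congrArg Subtype.val (hx i j S a b hab))
    refine ⟨⟨J, mem_normSection_of_forall_away hA f hf J fun i => ?_⟩,
      fun i => Subtype.ext (hJ i)⟩
    rw [hJ i]
    exact (x i).2

end NormSectionSheaf

/-! ### Complements of right ideals in matrix algebras -/

section PermutationComplement

variable {K : Type u} [Field K]

/-- A right ideal of a matrix algebra consists of the matrices with columns in some subspace, and
some of the vectors of the standard basis span a complement of the latter. -/
theorem exists_complement_of_isRightIdeal {ι : Type} [Fintype ι] [DecidableEq ι] [Nonempty ι]
    {m : ℕ} (J : Submodule K (Matrix ι ι K)) (hJ : IsRightIdeal J)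
    (hm : Module.finrank K (Matrix ι ι K ⧸ J) = Fintype.card ι * m) :
    ∃ a : Fin m → ι, Function.Injective a ∧
      ∀ M : Matrix ι ι K, ∃ j ∈ J, ∀ i ∉ Set.range a, ∀ k, M i k = j i k := by
  obtain ⟨k₀⟩ := ‹Nonempty ι›
  let c : (ι → K) →ₗ[K] Matrix ι ι K :=
    { toFun := fun v => Matrix.vecMulVec v (Pi.single k₀ 1)
      map_add' := fun v w => Matrix.add_vecMulVec _ _ _
      map_smul' := fun r v => Matrix.smul_vecMulVec _ _ _ }
  -- U is the space of columns of elements of J: right multiplication by matrix units moves any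
  -- column to position k₀.
  let U : Submodule K (ι → K) := J.comap c
  have hc : ∀ v i k, c v i k = v i * (Pi.single k₀ 1 : ι → K) k := fun v i k => rfl
  have hJU : ∀ M, M ∈ J ↔ ∀ k, (fun i => M i k) ∈ U := by
    intro M
    constructor
    · intro hM k
      have h1 := hJ M hM (Matrix.single k k₀ 1)
      change c _ ∈ J
      convert h1 using 1
      ext i l
      rw [hc, Matrix.mul_apply, Finset.sum_eq_single k]
      · by_cases hl : k₀ = l
        · subst hl
          simp
        · simp [hl, Ne.symm hl]
      · intro l' _ hl'
        simp [hl'.symm]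
      · simp
    · intro h
      have h1 : M = ∑ k, c (fun i => M i k) * Matrix.single k₀ k 1 := by
        ext i l
        rw [Matrix.sum_apply, Finset.sum_eq_single l]
        · rw [Matrix.mul_apply, Finset.sum_eq_single k₀]
          · simp [hc]
          · intro b _ hb
            simp [hc, hb]
          · simp
        · intro b _ hb
          rw [Matrix.mul_apply]
          refine Finset.sum_eq_zero fun d _ => ?_
          simp [hb]
        · simp
      rw [h1]
      exact J.sum_mem fun k _ => hJ _ (h k) _
  let Q := (ι → K) ⧸ U
  let q : Matrix ι ι K →ₗ[K] (ι → Q) :=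
    LinearMap.pi fun k => U.mkQ ∘ₗ LinearMap.pi fun i => Matrix.entryLinearMap K K i k
  have hq : ∀ M k, q M k = U.mkQ fun i => M i k := fun _ _ => rfl
  have hqs : Function.Surjective q := by
    intro y
    choose w hw using fun k => U.mkQ_surjective (y k)
    exact ⟨Matrix.of fun i k => w k i, funext fun k => hw k⟩
  have hqk : LinearMap.ker q = J := by
    ext M
    rw [LinearMap.mem_ker, hJU, funext_iff]
    refine forall_congr' fun k => ?_
    rw [hq, Pi.zero_apply, Submodule.mkQ_apply, Submodule.Quotient.mk_eq_zero]
  have hQ : Module.finrank K Q = m := by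
    have h1 := ((Submodule.quotEquivOfEq _ _ hqk.symm).trans
      (q.quotKerEquivOfSurjective hqs)).finrank_eq
    rw [hm, Module.finrank_pi_fintype, Finset.sum_const, Finset.card_univ, smul_eq_mul] at h1
    exact (Nat.eq_of_mul_eq_mul_left Fintype.card_pos h1).symm
  -- A subfamily of the standard basis becomes a basis of the quotient by U, so it spans a
  -- complement of U.
  obtain ⟨κ, a, ha, hspan, hli⟩ := exists_linearIndependent' K
    (fun i : ι => U.mkQ (Pi.single i (1 : K)))
  have htop : ⊤ ≤ Submodule.span K
      (Set.range ((fun i : ι => U.mkQ (Pi.single i (1 : K))) ∘ a)) := by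
    rw [hspan]
    intro y _
    obtain ⟨v, rfl⟩ := U.mkQ_surjective y
    rw [← (Pi.basisFun K ι).sum_repr v, map_sum]
    refine Submodule.sum_mem _ fun i _ => ?_
    rw [map_smul]
    refine Submodule.smul_mem _ _ (Submodule.subset_span ⟨i, ?_⟩)
    simp
  let b := Module.Basis.mk hli htop
  have : Fintype κ := @Fintype.ofFinite _ (Finite.of_injective a ha)
  have hcard : Fintype.card κ = m := by
    rw [← hQ, Module.finrank_eq_card_basis b]
  let e : Fin m ≃ κ := (Fintype.equivFinOfCardEq hcard).symm
  refine ⟨a ∘ e, ha.comp e.injective, fun M => ?_⟩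
  -- N collects the components of the columns of M in the complement; M − N lies in J and agrees
  -- with M in the other rows.
  let N : Matrix ι ι K := Matrix.of fun i k =>
    ∑ l, b.repr (U.mkQ fun i => M i k) l * (Pi.single (a l) (1 : K) : ι → K) i
  refine ⟨M - N, (hJU _).2 fun k => ?_, ?_⟩
  · have h1 : (fun i => (M - N) i k) = (fun i => M i k) -
        ∑ l, b.repr (U.mkQ fun i => M i k) l • (Pi.single (a l) (1 : K) : ι → K) := by
      ext i
      simp [N]
    rw [h1, ← Submodule.Quotient.mk_eq_zero, ← Submodule.mkQ_apply, map_sub, sub_eq_zero, map_sum]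
    conv_lhs => rw [← b.sum_repr (U.mkQ fun i => M i k)]
    refine Finset.sum_congr rfl fun l _ => ?_
    rw [map_smul, Module.Basis.mk_apply]
    rfl
  · intro i hi k
    rw [Matrix.sub_apply, eq_comm, sub_eq_self]
    refine Finset.sum_eq_zero fun l _ => ?_
    rw [Pi.single_apply, if_neg, mul_zero]
    rintro rfl
    exact hi ⟨e.symm l, by simp⟩

/-- The projection to the second block. -/
def blockProjection (K : Type*) [Field K] (n : ℕ) : Matrix (Fin 2 × Fin n) (Fin 2 × Fin n) K :=
  Matrix.diagonal fun p => if p.1 = 1 then 1 else 0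

/-- σ carries the n complementary indices to the second block, so the permuted projection corrects
exactly the rows in which j may differ from 1. -/
theorem exists_permMatrix_of_isRightIdeal {n : ℕ} (hn : n ≠ 0)
    (J : Submodule K (Matrix (Fin 2 × Fin n) (Fin 2 × Fin n) K)) (hJ : IsRightIdeal J)
    (hm : Module.finrank K (Matrix (Fin 2 × Fin n) (Fin 2 × Fin n) K ⧸ J) = 2 * n ^ 2) :
    ∃ σ : Equiv.Perm (Fin 2 × Fin n), ∃ j ∈ J, ∃ w,
      j + σ.permMatrix K * blockProjection K n * w = 1 := by
  have : NeZero n := ⟨hn⟩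
  obtain ⟨a, ha, h⟩ := exists_complement_of_isRightIdeal (m := n) J hJ (by
    rw [hm, Fintype.card_prod, Fintype.card_fin, Fintype.card_fin]
    ring)
  obtain ⟨σ, hσ⟩ := Equiv.Perm.exists_extending_pair a (fun b : Fin n => ((1 : Fin 2), b)) ha
    (fun b c hbc => (Prod.ext_iff.1 hbc).2)
  obtain ⟨j, hj, h1⟩ := h 1
  -- Row σ i of this witness is row i of 1 − j.
  refine ⟨σ, j, hj, ((1 : Matrix _ _ K) - j).submatrix σ.symm id, ?_⟩
  ext i k
  rw [Matrix.mul_assoc, PEquiv.toMatrix_toPEquiv_mul, Matrix.add_apply, Matrix.submatrix_apply,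
    blockProjection, Matrix.diagonal_mul, Matrix.submatrix_apply, Equiv.symm_apply_apply]
  split_ifs with hi
  · simp
  · rw [h1 i _ k]
    · simp
    · rintro ⟨b, rfl⟩
      exact hi (by rw [hσ])

end PermutationComplement

/-! ### Spreading out a complement from a point to a neighbourhood -/

section Complement

variable {F : Type u} [Field F] {A : Type u} [Ring A] [Algebra F A]
  {R S : Type u} [CommRing R] [Algebra F R] [CommRing S] [Algebra F S] {k : ℕ}

theorem baseMap_entry (f : R →ₐ[F] S) (i j : Fin 2) (a : R ⊗[F] A) :
    baseMap _ f (entry i j a) = entry i j (baseMap A f a) := by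
  apply toMat_injective
  ext k l
  rw [toMat_baseMap, toMat_entry, toMat_entry, Matrix.single_apply, Matrix.single_apply]
  split_ifs <;> simp

theorem baseMap_mem_sup_chartComplement (f : R →ₐ[F] S)
    {J : Module.Grassmannian R (R ⊗[F] Matrix (Fin 2) (Fin 2) A) k}
    {γ z : R ⊗[F] Matrix (Fin 2) (Fin 2) A} (hz : z ∈ J.toSubmodule ⊔ chartComplement γ) :
    baseMap _ f z ∈
      (Module.Grassmannian.map f J).toSubmodule ⊔ chartComplement (baseMap _ f γ) := by
  obtain ⟨j, hj, _, ⟨w, rfl⟩, rfl⟩ := Submodule.mem_sup.1 hz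
  rw [map_add]
  refine Submodule.add_mem_sup (mem_grassmannian_map_of_mem f hj) ⟨baseMap _ f w, ?_⟩
  rw [LinearMap.mulLeft_apply, LinearMap.mulLeft_apply, map_mul, map_mul, baseMap_entry,
    map_one (baseMap A f)]

/-- Nakayama's lemma: the quotient by the sum of the two ideals vanishes over K, hence over the
residue field at the kernel of φ. So this prime is outside its support, and the class of 1 is killed
by some f outside the prime. -/
theorem exists_smul_one_mem_sup_chartComplement [FiniteDimensional F A] {K : Type u} [Field K]
    [Algebra F K] (φ : R →ₐ[F] K)
    {J : Module.Grassmannian R (R ⊗[F] Matrix (Fin 2) (Fin 2) A) k}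
    (hJ : IsRightIdeal J.toSubmodule) (γ : R ⊗[F] Matrix (Fin 2) (Fin 2) A)
    (h : (1 : K ⊗[F] Matrix (Fin 2) (Fin 2) A) ∈
      (Module.Grassmannian.map φ J).toSubmodule ⊔ chartComplement (baseMap _ φ γ)) :
    ∃ f : R, φ f ≠ 0 ∧ f • (1 : R ⊗[F] Matrix (Fin 2) (Fin 2) A) ∈
      J.toSubmodule ⊔ chartComplement γ := by
  let _ : Algebra R K := φ.toAlgebra
  have : IsScalarTower F R K := IsScalarTower.of_algebraMap_eq' φ.comp_algebraMap.symm
  let N := J.toSubmodule ⊔ chartComplement γ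
  let Q := (R ⊗[F] Matrix (Fin 2) (Fin 2) A) ⧸ N
  let T : K ⊗[F] Matrix (Fin 2) (Fin 2) A →ₗ[K] K ⊗[R] Q := Module.Grassmannian.baseChangeMkQ K N
  have hT : ∀ z ∈ N, T (baseMap _ φ z) = 0 := fun z hz => by
    refine (baseChangeMkQ_baseMap φ N z).trans ?_
    rw [(Submodule.Quotient.mk_eq_zero _).2 hz, TensorProduct.tmul_zero]
  have h1 : (Module.Grassmannian.map φ J).toSubmodule ⊔ chartComplement (baseMap _ φ γ) ≤
      LinearMap.ker T := by
    refine sup_le ?_ ?_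
    · rw [grassmannian_map_eq_span, Submodule.span_le]
      rintro _ ⟨z, hz, rfl⟩
      exact hT z (Submodule.mem_sup_left hz)
    · rintro _ ⟨w, rfl⟩
      rw [LinearMap.mulLeft_apply, LinearMap.mem_ker]
      induction w with
      | zero => rw [mul_zero, map_zero]
      | add x y hx hy => rw [mul_add, map_add, hx, hy, add_zero]
      | tmul s b =>
        have h2 : (baseMap _ φ γ * entry 1 1 1) * (s ⊗ₜ[F] b) =
            s • baseMap _ φ ((γ * entry 1 1 1) * (1 ⊗ₜ b)) := by
          rw [map_mul, map_mul, baseMap_entry, map_one (baseMap A φ), ← mul_smul_comm]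
          simp [TensorProduct.smul_tmul']
        have h3 : (γ * entry 1 1 1) * (1 ⊗ₜ[F] b) ∈ N := Submodule.mem_sup_right ⟨1 ⊗ₜ b, rfl⟩
        rw [h2, map_smul, hT _ h3, smul_zero]
  have h2 : ∀ z, T z = 0 := by
    intro z
    obtain ⟨j, hj, _, ⟨w, rfl⟩, hw⟩ := Submodule.mem_sup.1 h
    rw [← one_mul z, ← hw, add_mul]
    refine h1 (Submodule.add_mem_sup (hJ.grassmannian_map φ _ hj _) ⟨w * z, ?_⟩)
    exact (mul_assoc _ _ _).symm
  have h3 : Subsingleton (K ⊗[R] Q) := by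
    refine subsingleton_of_forall_eq 0 fun y => ?_
    obtain ⟨z, rfl⟩ := Module.Grassmannian.baseChangeMkQ_surjective (B := K) N y
    exact h2 z
  let p : PrimeSpectrum R := ⟨RingHom.ker (algebraMap R K), RingHom.ker_isPrime _⟩
  have : p.asIdeal.IsPrime := p.isPrime
  let ψ : p.asIdeal.ResidueField →ₐ[R] K :=
    Ideal.ResidueField.liftₐ p.asIdeal (Algebra.ofId R K) (fun x hx => hx)
      fun x hx => isUnit_iff_ne_zero.2 hx
  let _ : Algebra p.asIdeal.ResidueField K := ψ.toAlgebra
  have : IsScalarTower R p.asIdeal.ResidueField K :=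
    IsScalarTower.of_algebraMap_eq' ψ.comp_algebraMap.symm
  have h4 : Subsingleton (K ⊗[p.asIdeal.ResidueField] (p.asIdeal.ResidueField ⊗[R] Q)) :=
    (AlgebraTensorModule.cancelBaseChange R p.asIdeal.ResidueField p.asIdeal.ResidueField K
      Q).toEquiv.subsingleton
  have h5 : Subsingleton (p.asIdeal.ResidueField ⊗[R] Q) :=
    Module.FaithfullyFlat.lTensor_reflects_triviality p.asIdeal.ResidueField K _
  have h6 : p ∉ Module.support R Q := by
    rw [Module.mem_support_iff_nontrivial_residueField_tensorProduct,
      not_nontrivial_iff_subsingleton]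
    exact h5
  obtain ⟨f, hf, hf'⟩ := Module.notMem_support_iff'.1 h6 (Submodule.Quotient.mk 1)
  exact ⟨f, hf, (Submodule.Quotient.mk_eq_zero _).1 hf'⟩

end Complement

/-! ### Passage from M₂(A) ⊗ R to matrices of size 2n -/

section Blocks

variable {F : Type u} [Field F] {A : Type u} [Ring A] [Algebra F A] {n : ℕ}
  {R : Type u} [CommRing R] [Algebra F R]

/-- The homomorphism from `M₂(A) ⊗ R` to `M₂ₙ(R)` attached to a homomorphism from `A ⊗ R` to
`Mₙ(R)`. -/
def blockHom (Ψ : R ⊗[F] A →ₐ[R] Matrix (Fin n) (Fin n) R) :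
    R ⊗[F] Matrix (Fin 2) (Fin 2) A →ₐ[R] Matrix (Fin 2 × Fin n) (Fin 2 × Fin n) R :=
  ((Matrix.compAlgEquiv (Fin 2) (Fin n) R R).toAlgHom.comp Ψ.mapMatrix).comp toMat

theorem blockHom_apply (Ψ : R ⊗[F] A →ₐ[R] Matrix (Fin n) (Fin n) R)
    (z : R ⊗[F] Matrix (Fin 2) (Fin 2) A) (p q : Fin 2 × Fin n) :
    blockHom Ψ z p q = Ψ (toMat z p.1 q.1) p.2 q.2 := rfl

theorem blockHom_bijective {Ψ : R ⊗[F] A →ₐ[R] Matrix (Fin n) (Fin n) R}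
    (hΨ : Function.Bijective Ψ) : Function.Bijective (blockHom Ψ) := by
  constructor
  · intro y z h
    apply toMat_injective
    ext i j
    apply hΨ.1
    ext a b
    exact congrFun (congrFun h (i, a)) (j, b)
  · intro M
    choose y hy using fun i j => hΨ.2 (Matrix.of fun a b => M (i, a) (j, b))
    refine ⟨∑ i, ∑ j, entry i j (y i j), ?_⟩
    ext p q
    rw [blockHom_apply]
    have h : toMat (∑ i, ∑ j, entry i j (y i j)) p.1 q.1 = y p.1 q.1 := by
      simp only [map_sum, toMat_entry, Matrix.sum_apply, Matrix.single_apply]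
      rw [Finset.sum_eq_single p.1, Finset.sum_eq_single q.1]
      · simp
      · intro j _ hj
        simp [hj]
      · simp
      · intro i _ hi
        simp [hi]
      · simp
    rw [h, hy]
    rfl

theorem blockHom_entry {K : Type u} [Field K] [Algebra F K]
    (Ψ : K ⊗[F] A →ₐ[K] Matrix (Fin n) (Fin n) K) :
    blockHom Ψ (entry 1 1 1) = blockProjection K n := by
  ext ⟨i, a⟩ ⟨j, b⟩
  rw [blockHom_apply, toMat_entry, blockProjection]
  fin_cases i <;> fin_cases j <;> simp [Matrix.diagonal_apply, Matrix.one_apply]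

theorem exists_permMatrix_mem_sup_chartComplement [FiniteDimensional F A] {K : Type u} [Field K]
    [Algebra F K] (hn : n ≠ 0) {Ψ : K ⊗[F] A →ₐ[K] Matrix (Fin n) (Fin n) K}
    (hΨ : Function.Bijective Ψ)
    {J : Module.Grassmannian K (K ⊗[F] Matrix (Fin 2) (Fin 2) A) ((2 * n) ^ 2 - n * (2 * n))}
    (hJ : IsRightIdeal J.toSubmodule) :
    ∃ σ : Equiv.Perm (Fin 2 × Fin n), ∀ γ, blockHom Ψ γ = σ.permMatrix K →
      1 ∈ J.toSubmodule ⊔ chartComplement γ := by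
  let Θ := AlgEquiv.ofBijective (blockHom Ψ) (blockHom_bijective hΨ)
  have hΘ : ∀ z, Θ z = blockHom Ψ z := fun _ => rfl
  let J' := J.toSubmodule.map Θ.toLinearEquiv.toLinearMap
  have hJ' : IsRightIdeal J' := by
    rintro _ ⟨x, hx, rfl⟩ y
    obtain ⟨y, rfl⟩ := Θ.surjective y
    exact ⟨x * y, hJ x hx y, map_mul Θ x y⟩
  have h1 : Module.finrank K
      ((K ⊗[F] Matrix (Fin 2) (Fin 2) A) ⧸ J.toSubmodule) = 2 * n ^ 2 := by
    have h2 := J.rankAtStalk_eq ⊥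
    rw [Module.rankAtStalk_eq_finrank_of_free] at h2
    refine h2.trans ?_
    rw [show (2 * n) ^ 2 = 2 * n ^ 2 + n * (2 * n) by ring]
    simp
  obtain ⟨σ, _, ⟨j, hj, rfl⟩, w, hw⟩ := exists_permMatrix_of_isRightIdeal hn J' hJ' (by
    rw [← h1]
    exact (Submodule.Quotient.equiv _ J' Θ.toLinearEquiv rfl).symm.finrank_eq)
  refine ⟨σ, fun γ hγ => ?_⟩
  obtain ⟨w, rfl⟩ := Θ.surjective w
  refine Submodule.mem_sup.2 ⟨j, hj, _, ⟨w, rfl⟩, ?_⟩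
  apply Θ.injective
  rw [map_one Θ, ← hw, map_add, LinearMap.mulLeft_apply, map_mul, map_mul, hΘ γ, hγ,
    hΘ (entry 1 1 1), blockHom_entry]
  rfl

end Blocks

/-! ### A rational complement over an infinite field -/

section InfiniteField

variable {F : Type u} [Field F]

theorem isUnit_of_isUnit_one_tmul {B : Type u} [Ring B] [Algebra F B] [FiniteDimensional F B]
    {K : Type u} [Field K] [Algebra F K] {b : B} (h : IsUnit ((1 : K) ⊗ₜ[F] b)) : IsUnit b := by
  have h1 : IsUnit ((1 : F) ⊗ₜ[F] b) := by
    rw [isUnit_iff_isUnit_mulDet] at h ⊢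
    have h2 := mulDet_map (Algebra.ofId F K) ((1 : F) ⊗ₜ[F] b)
    rw [Algebra.TensorProduct.map_tmul, map_one, AlgHom.id_apply] at h2
    rw [h2] at h
    rw [isUnit_iff_ne_zero] at h ⊢
    intro h3
    exact h (by rw [h3, map_zero])
  simpa using h1.map (Algebra.TensorProduct.lid F B)

variable {A : Type u} [Ring A] [Algebra F A] [FiniteDimensional F A] {n : ℕ}

/-- A permutation matrix γ₀ gives a complement over K. Being a complement and being invertible both
hold for γ off the zero set of a nonzero polynomial, which cannot vanish at all points with
coordinates in the infinite field F. -/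
theorem exists_unit_mem_sup_chartComplement_of_infinite [Infinite F] {K : Type u} [Field K]
    [Algebra F K] (hn : n ≠ 0) {Ψ : K ⊗[F] A →ₐ[K] Matrix (Fin n) (Fin n) K}
    (hΨ : Function.Bijective Ψ)
    {J : Module.Grassmannian K (K ⊗[F] Matrix (Fin 2) (Fin 2) A) ((2 * n) ^ 2 - n * (2 * n))}
    (hJ : IsRightIdeal J.toSubmodule) :
    ∃ g : (Matrix (Fin 2) (Fin 2) A)ˣ, 1 ∈ J.toSubmodule ⊔ chartComplement (1 ⊗ₜ g.1) := by
  obtain ⟨σ, hσ⟩ := exists_permMatrix_mem_sup_chartComplement hn hΨ hJ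
  obtain ⟨γ₀, hγ₀⟩ := (blockHom_bijective hΨ).2 (σ.permMatrix K)
  replace hσ := hσ γ₀ hγ₀
  let b := Module.finBasis F (Matrix (Fin 2) (Fin 2) A)
  let ι := Fin (Module.finrank F (Matrix (Fin 2) (Fin 2) A))
  let S := MvPolynomial ι K
  let γ : S ⊗[F] Matrix (Fin 2) (Fin 2) A := ∑ i, MvPolynomial.X i ⊗ₜ b i
  let ev : (ι → K) → S →ₐ[F] K := fun x => (MvPolynomial.aeval x).restrictScalars F
  have hev : ∀ x p, ev x p = MvPolynomial.eval x p := fun x p => by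
    rw [← MvPolynomial.coe_aeval_eq_eval]
    rfl
  have hγ : ∀ x, baseMap _ (ev x) γ = ∑ i, x i ⊗ₜ b i := by
    intro x
    rw [map_sum]
    refine Finset.sum_congr rfl fun i _ => ?_
    rw [Algebra.TensorProduct.map_tmul, hev, MvPolynomial.eval_X]
    rfl
  have hsurj : ∀ z : K ⊗[F] Matrix (Fin 2) (Fin 2) A, ∃ x, baseMap _ (ev x) γ = z := by
    intro z
    refine ⟨fun i => (Algebra.TensorProduct.basis K b).repr z i, ?_⟩
    rw [hγ]
    refine Eq.trans ?_ ((Algebra.TensorProduct.basis K b).sum_repr z)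
    refine Finset.sum_congr rfl fun i _ => ?_
    simp [TensorProduct.smul_tmul']
  let c : K →ₐ[F] S := IsScalarTower.toAlgHom F K S
  have hc : ∀ x, Module.Grassmannian.map (ev x) (Module.Grassmannian.map c J) = J := by
    intro x
    rw [← Module.Grassmannian.map_comp]
    have h1 : (ev x).comp c = AlgHom.id F K := by
      ext r
      rw [AlgHom.comp_apply, hev]
      exact MvPolynomial.eval_C r
    rw [h1]
    exact Module.Grassmannian.map_id _ (CommAlgCat.of F K) J
  obtain ⟨x₀, hx₀⟩ := hsurj γ₀
  obtain ⟨x₁, hx₁⟩ := hsurj 1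
  -- The polynomial f is nonzero at γ₀ and `mulDet γ` is nonzero at 1, so neither is the zero
  -- polynomial.
  obtain ⟨f, hf, hfmem⟩ := exists_smul_one_mem_sup_chartComplement (ev x₀)
    (hJ.grassmannian_map c) γ (by rw [hc, hx₀]; exact hσ)
  have hf0 : f ≠ 0 := by
    rintro rfl
    exact hf (map_zero _)
  have hD0 : mulDet γ ≠ 0 := by
    intro h
    have h1 := mulDet_map (ev x₁) γ
    rw [hx₁, mulDet_one, h, map_zero] at h1
    exact one_ne_zero h1
  obtain ⟨y, hy⟩ : ∃ y : ι → F, MvPolynomial.eval (fun i => algebraMap F K (y i))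
      (f * mulDet γ) ≠ 0 := by
    by_contra! h
    refine mul_ne_zero hf0 hD0 (MvPolynomial.funext_set (fun _ => Set.range (algebraMap F K))
      (fun _ => Set.infinite_range_of_injective (algebraMap F K).injective) fun x hx => ?_)
    choose y hy using fun i => hx i trivial
    rw [map_zero, ← h y]
    exact congrArg (fun x => MvPolynomial.eval x (f * mulDet γ)) (funext fun i => (hy i).symm)
  let x : ι → K := fun i => algebraMap F K (y i)
  have hy' : ev x f ≠ 0 ∧ ev x (mulDet γ) ≠ 0 := by
    rw [map_mul, ← hev, ← hev] at hy
    exact mul_ne_zero_iff.1 hy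
  have hg : baseMap _ (ev x) γ = 1 ⊗ₜ ∑ i, y i • b i := by
    rw [hγ, TensorProduct.tmul_sum]
    refine Finset.sum_congr rfl fun i _ => ?_
    rw [← TensorProduct.smul_tmul, Algebra.smul_def, mul_one]
  have hu : IsUnit (∑ i, y i • b i) := by
    refine isUnit_of_isUnit_one_tmul (F := F) (K := K) ?_
    rw [← hg, isUnit_iff_isUnit_mulDet, mulDet_map]
    exact isUnit_iff_ne_zero.2 hy'.2
  obtain ⟨g, hg'⟩ := hu
  refine ⟨g, ?_⟩
  have h1 := baseMap_mem_sup_chartComplement (ev x) hfmem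
  rw [hc, hg, baseMap_smul, map_one, ← hg'] at h1
  exact (Submodule.smul_mem_iff _ hy'.1).1 h1

end InfiniteField

/-! ### A rational complement over a finite field -/

section FiniteField

variable {F : Type u} [Field F] {A : Type u} [Ring A] [Algebra F A] [FiniteDimensional F A] {n : ℕ}

/-- By Wedderburn's little theorem the division ring D is commutative; its scalar matrices are then
central, so D = F. -/
theorem exists_algEquiv_matrix_of_finite [Finite F] [Algebra.IsCentral F A] [IsSimpleRing A]
    (hA : Module.finrank F A = n ^ 2) : Nonempty (A ≃ₐ[F] Matrix (Fin n) (Fin n) F) := by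
  have := IsArtinianRing.of_finite F A
  obtain ⟨m, hm, D, _, _, _, ⟨e⟩⟩ := IsSimpleRing.exists_algEquiv_matrix_divisionRing_finite F A
  have : Finite D := Module.finite_of_finite F
  have hcomm : ∀ a b : D, a * b = b * a := (littleWedderburn D).mul_comm
  have hsurj : Function.Surjective (algebraMap F D) := by
    intro d
    have h1 : e.symm (Matrix.scalar (Fin m) d) ∈ Subalgebra.center F A := by
      rw [Subalgebra.mem_center_iff]
      intro a
      apply e.injective
      rw [map_mul, map_mul, AlgEquiv.apply_symm_apply]
      exact (Matrix.scalar_commute d (fun r => hcomm d r) (e a)).symm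
    rw [Algebra.IsCentral.center_eq_bot, Algebra.mem_bot] at h1
    obtain ⟨r, hr⟩ := h1
    refine ⟨r, ?_⟩
    have h2 := congrArg e hr
    rw [AlgEquiv.commutes, AlgEquiv.apply_symm_apply] at h2
    have h3 := congrFun (congrFun h2 (0 : Fin m)) (0 : Fin m)
    simpa [Matrix.algebraMap_matrix_apply] using h3
  let e' : F ≃ₐ[F] D := AlgEquiv.ofBijective (Algebra.ofId F D)
    ⟨(algebraMap F D).injective, hsurj⟩
  let e'' := e.trans e'.symm.mapMatrix
  have h1 := e''.toLinearEquiv.finrank_eq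
  rw [hA, Module.finrank_matrix, Module.finrank_self, Fintype.card_fin, mul_one, ← sq] at h1
  obtain rfl := Nat.pow_left_injective two_ne_zero h1
  exact ⟨e''⟩

/-- A is split over F, and a permutation matrix has entries 0 and 1, so it comes from M₂(A). -/
theorem exists_unit_mem_sup_chartComplement_of_finite [Finite F] [Algebra.IsCentral F A]
    [IsSimpleRing A] (hA : Module.finrank F A = n ^ 2) (hn : n ≠ 0) {K : Type u} [Field K]
    [Algebra F K]
    {J : Module.Grassmannian K (K ⊗[F] Matrix (Fin 2) (Fin 2) A) ((2 * n) ^ 2 - n * (2 * n))}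
    (hJ : IsRightIdeal J.toSubmodule) :
    ∃ g : (Matrix (Fin 2) (Fin 2) A)ˣ, 1 ∈ J.toSubmodule ⊔ chartComplement (1 ⊗ₜ g.1) := by
  obtain ⟨α⟩ := exists_algEquiv_matrix_of_finite hA
  have : NeZero n := ⟨hn⟩
  let Ψ : K ⊗[F] A →ₐ[K] Matrix (Fin n) (Fin n) K :=
    Algebra.TensorProduct.lift (Algebra.ofId K _)
      ((Algebra.ofId F K).mapMatrix.comp α.toAlgHom) fun r a => by
        rw [Algebra.ofId_apply]
        exact Algebra.commute_algebraMap_left _ _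
  have hΨ1 : ∀ a, Ψ (1 ⊗ₜ a) = (α a).map (algebraMap F K) := fun a => by
    rw [Algebra.TensorProduct.lift_tmul, map_one, one_mul]
    rfl
  have hsimple := isSimpleRing_tensorProduct (F := F) (L := K) (A := A)
  have hinj : Function.Injective Ψ := RingHom.injective Ψ.toRingHom
  have hΨ : Function.Bijective Ψ := by
    refine ⟨hinj, (LinearMap.injective_iff_surjective_of_finrank_eq_finrank
      (f := Ψ.toLinearMap) ?_).1 hinj⟩
    rw [Module.finrank_baseChange, hA, Module.finrank_matrix, Module.finrank_self,
      Fintype.card_fin, mul_one, sq]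
  obtain ⟨σ, hσ⟩ := exists_permMatrix_mem_sup_chartComplement hn hΨ hJ
  let E : Matrix (Fin 2) (Fin 2) A ≃ₐ[F] Matrix (Fin 2 × Fin n) (Fin 2 × Fin n) F :=
    α.mapMatrix.trans (Matrix.compAlgEquiv (Fin 2) (Fin n) F F)
  have hE : ∀ g p q, E g p q = α (g p.1 q.1) p.2 q.2 := fun _ _ _ => rfl
  have hperm : IsUnit (σ.permMatrix F) := by
    rw [Matrix.isUnit_iff_isUnit_det, Matrix.det_permutation]
    exact (Units.isUnit _).map (Int.castRingHom F)
  obtain ⟨g, hg⟩ := hperm.map E.symm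
  refine ⟨g, hσ _ ?_⟩
  ext p q
  rw [blockHom_apply, toMat_tmul, hΨ1, Matrix.map_apply, ← hE, hg, AlgEquiv.apply_symm_apply]
  change algebraMap F K (if q ∈ σ.toPEquiv p then 1 else 0) = if q ∈ σ.toPEquiv p then 1 else 0
  split_ifs <;> simp

end FiniteField

/-! ### The charts cover the Severi–Brauer functor -/

section Covering

variable {F : Type u} [Field F] {A : Type u} [Ring A] [Algebra F A]
  [FiniteDimensional F A] [Algebra.IsCentral F A] [IsSimpleRing A] {n : ℕ}

theorem exists_unit_mem_sup_chartComplement (hA : Module.finrank F A = n ^ 2) {K : Type u}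
    [Field K] [IsAlgClosed K] [Algebra F K]
    {J : Module.Grassmannian K (K ⊗[F] Matrix (Fin 2) (Fin 2) A) ((2 * n) ^ 2 - n * (2 * n))}
    (hJ : IsRightIdeal J.toSubmodule) :
    ∃ g : (Matrix (Fin 2) (Fin 2) A)ˣ, 1 ∈ J.toSubmodule ⊔ chartComplement (1 ⊗ₜ g.1) := by
  have hn : n ≠ 0 := by
    rintro rfl
    rw [zero_pow two_ne_zero] at hA
    have := Module.finrank_zero_iff.1 hA
    exact one_ne_zero (Subsingleton.elim (1 : A) 0)
  rcases finite_or_infinite F with hF | hF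
  · exact exists_unit_mem_sup_chartComplement_of_finite hA hn hJ
  · obtain ⟨φ⟩ := nonempty_splitting hA
    exact exists_unit_mem_sup_chartComplement_of_infinite hn
      (splitHom_bijective hA φ (IsAlgClosed.lift (R := F))) hJ

/-- A chart is found at a geometric point above p, and the complement it provides persists on a
basic open neighbourhood of p. -/
theorem severiBrauer_locallyCovered (hA : Module.finrank F A = n ^ 2) :
    LocallyCovered (severiBrauer F (Matrix (Fin 2) (Fin 2) A) (2 * n) n).toFunctor
      (fun _ : (Matrix (Fin 2) (Fin 2) A)ˣ => coordAlg F A)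
      fun g => sbPoint hA g (generic F A) := by
  rintro R ⟨J, hJ⟩ p
  let K := AlgebraicClosure p.asIdeal.ResidueField
  let φ : R →ₐ[F] K := IsScalarTower.toAlgHom F R K
  obtain ⟨g, hg⟩ := exists_unit_mem_sup_chartComplement hA (hJ.grassmannian_map φ)
  obtain ⟨f, hf, hfmem⟩ := exists_smul_one_mem_sup_chartComplement φ hJ (1 ⊗ₜ g.1) (by
    rw [Algebra.TensorProduct.map_tmul, map_one, AlgHom.id_apply]
    exact hg)
  have h1 := baseMap_mem_sup_chartComplement (toAway R f).hom hfmem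
  rw [Algebra.TensorProduct.map_tmul, map_one, AlgHom.id_apply, baseMap_smul, map_one,
    Submodule.smul_mem_iff_of_isUnit _ (isUnit_toAway R f)] at h1
  obtain ⟨x, hx⟩ := exists_eq_chartPoint hA g (hJ.grassmannian_map (toAway R f).hom) h1
  refine ⟨f, fun hfp => hf ?_, g, CommAlgCat.ofHom (coordHom x), ?_⟩
  · change algebraMap R K f = 0
    rw [IsScalarTower.algebraMap_apply R p.asIdeal.ResidueField K,
      Ideal.algebraMap_residueField_eq_zero.2 hfp, map_zero]
  · rw [severiBrauer_map_sbPoint, CommAlgCat.hom_ofHom, baseMap_coordHom_generic]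
    exact Subtype.ext hx

end Covering

/-! ### The norm section as a hypersurface in each chart -/

section NormSectionCharts

variable {F : Type u} [Field F] {A : Type u} [Ring A] [Algebra F A] {n : ℕ}

theorem grassmannian_map_id {B : Type u} [Ring B] [Algebra F B] {k : ℕ} (R : CommAlgCat.{u} F)
    (J : Module.Grassmannian R (R ⊗[F] B) k) :
    Module.Grassmannian.map (𝟙 R : R ⟶ R).hom J = J :=
  Module.Grassmannian.map_id k R J

variable [FiniteDimensional F A]

theorem reducedNorm_chart_eq_of_mem (hA : Module.finrank F A = n ^ 2)
    {g : (Matrix (Fin 2) (Fin 2) A)ˣ} {R : CommAlgCat.{u} F} {x : R ⊗[F] A}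
    (h : sbPoint hA g x ∈ (normSection F A n).obj R) :
    reducedNorm n (chartTop g.1 x) = reducedNorm n (chartBot g.1 x) :=
  h R (𝟙 R) _ _ (congrArg Module.Grassmannian.toSubmodule (grassmannian_map_id R _))

variable [PerfectField F] [Algebra.IsCentral F A] [IsSimpleRing A]

/-- Any other presentation of the ideal, also after base change, is g(1, x) times a single element
of the algebra on the right. This multiplies both norms by the same factor, so one presentation
decides. -/
theorem sbPoint_mem_normSection_iff (hA : Module.finrank F A = n ^ 2)
    {g : (Matrix (Fin 2) (Fin 2) A)ˣ} {R : CommAlgCat.{u} F} {x : R ⊗[F] A} :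
    sbPoint hA g x ∈ (normSection F A n).obj R ↔
      reducedNorm n (chartTop g.1 x) = reducedNorm n (chartBot g.1 x) := by
  refine ⟨reducedNorm_chart_eq_of_mem hA, fun h S f a b hab => ?_⟩
  have h1 : columnIdeal (chartTop g.1 (baseMap A f.hom x)) (chartBot g.1 (baseMap A f.hom x)) =
      columnIdeal a b := by
    rw [← hab]
    exact congrArg Module.Grassmannian.toSubmodule (grassmannian_map_chartPoint hA f.hom g x).symm
  have h2 : column a b ∈ columnIdeal a b :=
    (columnIdeal_le_iff (isRightIdeal_columnIdeal a b)).1 le_rfl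
  rw [← h1] at h2
  obtain ⟨w, hw⟩ := h2
  rw [LinearMap.mulLeft_apply] at hw
  have h3 := congrArg toMat hw
  rw [map_mul, toMat_column, toMat_column] at h3
  have ha : chartTop g.1 (baseMap A f.hom x) * toMat w 0 0 = a := by
    simpa [Matrix.mul_apply] using congrFun (congrFun h3 0) 0
  have hb : chartBot g.1 (baseMap A f.hom x) * toMat w 0 0 = b := by
    simpa [Matrix.mul_apply] using congrFun (congrFun h3 1) 0
  rw [← ha, ← hb, reducedNorm_mul hA, reducedNorm_mul hA, ← baseMap_chartTop, ← baseMap_chartBot,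
    reducedNorm_map hA, reducedNorm_map hA, h]

omit [FiniteDimensional F A] [PerfectField F] [Algebra.IsCentral F A] [IsSimpleRing A] in
theorem exists_hom_of_quotient {B : Type u} [CommRing B] [Algebra F B] {f : B}
    {R : Type u} [CommRing R] [Algebra F R] (φ : B →ₐ[F] R) (h : φ f = 0) :
    ∃ ψ : (B ⧸ Ideal.span {f}) →ₐ[F] R, ψ.comp (Ideal.Quotient.mkₐ F (Ideal.span {f})) = φ := by
  refine ⟨Ideal.Quotient.liftₐ _ φ fun a ha => ?_, Ideal.Quotient.liftₐ_comp _ _ _⟩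
  obtain ⟨b, rfl⟩ := Ideal.mem_span_singleton'.1 ha
  rw [map_mul, h, mul_zero]

variable (F A n) in
omit [PerfectField F] [Algebra.IsCentral F A] [IsSimpleRing A] in
/-- The equation of the norm section in the chart indexed by `g`. -/
def normEquation (g : Matrix (Fin 2) (Fin 2) A) : CoordRing F A :=
  reducedNorm n (chartTop g (generic F A)) - reducedNorm n (chartBot g (generic F A))

theorem map_normEquation (hA : Module.finrank F A = n ^ 2) (g : Matrix (Fin 2) (Fin 2) A)
    {R : Type u} [CommRing R] [Algebra F R] (φ : CoordRing F A →ₐ[F] R) :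
    φ (normEquation F A n g) = reducedNorm n (chartTop g (baseMap A φ (generic F A))) -
      reducedNorm n (chartBot g (baseMap A φ (generic F A))) := by
  rw [normEquation, map_sub, ← reducedNorm_map hA, ← reducedNorm_map hA]
  erw [baseMap_chartTop, baseMap_chartBot]

variable (F A n) in
omit [PerfectField F] [Algebra.IsCentral F A] [IsSimpleRing A] in
/-- The coordinate ring of the chart of the norm section indexed by `g`. -/
abbrev normAlg (g : Matrix (Fin 2) (Fin 2) A) : CommAlgCat.{u} F :=
  .of F (CoordRing F A ⧸ Ideal.span {normEquation F A n g})

variable (F A n) in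
omit [PerfectField F] [Algebra.IsCentral F A] [IsSimpleRing A] in
/-- The projection from the coordinate ring of the chart of the Severi–Brauer variety. -/
abbrev normAlgMk (g : Matrix (Fin 2) (Fin 2) A) : coordAlg F A ⟶ normAlg F A n g :=
  CommAlgCat.ofHom (Ideal.Quotient.mkₐ F _)

variable (F A n) in
omit [PerfectField F] [Algebra.IsCentral F A] [IsSimpleRing A] in
/-- The generic point of the chart of the norm section. -/
def normGeneric (g : Matrix (Fin 2) (Fin 2) A) : normAlg F A n g ⊗[F] A :=
  baseMap A (normAlgMk F A n g).hom (generic F A)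

theorem reducedNorm_normGeneric (hA : Module.finrank F A = n ^ 2)
    (g : Matrix (Fin 2) (Fin 2) A) :
    reducedNorm n (chartTop g (normGeneric F A n g)) =
      reducedNorm n (chartBot g (normGeneric F A n g)) := by
  rw [← sub_eq_zero]
  refine (map_normEquation hA g (normAlgMk F A n g).hom).symm.trans ?_
  exact Ideal.Quotient.eq_zero_iff_mem.2 (Ideal.mem_span_singleton_self _)

theorem reducedNorm_of_normAlg_hom (hA : Module.finrank F A = n ^ 2)
    (g : Matrix (Fin 2) (Fin 2) A) {R : Type u} [CommRing R] [Algebra F R]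
    (φ : normAlg F A n g →ₐ[F] R) :
    reducedNorm n (chartTop g (baseMap A φ (normGeneric F A n g))) =
      reducedNorm n (chartBot g (baseMap A φ (normGeneric F A n g))) := by
  rw [← baseMap_chartTop, ← baseMap_chartBot, reducedNorm_map hA, reducedNorm_map hA,
    reducedNorm_normGeneric hA]

theorem exists_normAlg_hom (hA : Module.finrank F A = n ^ 2)
    {g : Matrix (Fin 2) (Fin 2) A} {R : Type u} [CommRing R] [Algebra F R] {x : R ⊗[F] A}
    (h : reducedNorm n (chartTop g x) = reducedNorm n (chartBot g x)) :
    ∃ φ : normAlg F A n g →ₐ[F] R, baseMap A φ (normGeneric F A n g) = x := by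
  obtain ⟨φ, hφ⟩ := exists_hom_of_quotient (f := normEquation F A n g) (coordHom x) (by
    rw [map_normEquation hA, baseMap_coordHom_generic, h, sub_self])
  refine ⟨φ, ?_⟩
  rw [normGeneric, baseMap_baseMap]
  refine Eq.trans (congrArg (fun c => baseMap A c (generic F A)) hφ) ?_
  exact baseMap_coordHom_generic x

omit [PerfectField F] [Algebra.IsCentral F A] [IsSimpleRing A] in
theorem normAlg_hom_ext {g : Matrix (Fin 2) (Fin 2) A} {R : Type u} [CommRing R] [Algebra F R]
    {φ ψ : normAlg F A n g →ₐ[F] R}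
    (h : baseMap A φ (normGeneric F A n g) = baseMap A ψ (normGeneric F A n g)) : φ = ψ := by
  rw [normGeneric, baseMap_baseMap, baseMap_baseMap] at h
  exact Ideal.Quotient.algHom_ext _ (coordRing_hom_ext h)

/-- The point `[g (1, x)]` of the norm section. -/
def normPoint (hA : Module.finrank F A = n ^ 2) (g : (Matrix (Fin 2) (Fin 2) A)ˣ)
    {R : CommAlgCat.{u} F} (x : R ⊗[F] A)
    (h : reducedNorm n (chartTop g.1 x) = reducedNorm n (chartBot g.1 x)) :
    (normSection F A n).toFunctor.obj R :=
  ⟨sbPoint hA g x, (sbPoint_mem_normSection_iff hA).2 h⟩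

/-- The generic point of the chart of the norm section indexed by `g`, as a point of the
functor. -/
def normChart (hA : Module.finrank F A = n ^ 2) (g : (Matrix (Fin 2) (Fin 2) A)ˣ) :
    (normSection F A n).toFunctor.obj (normAlg F A n g.1) :=
  normPoint hA g (normGeneric F A n g.1) (reducedNorm_normGeneric hA g.1)

theorem normSection_map_normChart (hA : Module.finrank F A = n ^ 2)
    (g : (Matrix (Fin 2) (Fin 2) A)ˣ) {R : CommAlgCat.{u} F} (φ : normAlg F A n g.1 ⟶ R) :
    ((normSection F A n).toFunctor.map φ (normChart hA g)).1 =
      sbPoint hA g (baseMap A φ.hom (normGeneric F A n g.1)) :=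
  severiBrauer_map_sbPoint hA g φ _

theorem exists_normChart_eq (hA : Module.finrank F A = n ^ 2)
    {g : (Matrix (Fin 2) (Fin 2) A)ˣ} {R : CommAlgCat.{u} F} {x : R ⊗[F] A}
    {s : (normSection F A n).toFunctor.obj R} (h : s.1 = sbPoint hA g x) :
    ∃ φ : normAlg F A n g.1 ⟶ R, s = (normSection F A n).toFunctor.map φ (normChart hA g) := by
  obtain ⟨φ, hφ⟩ := exists_normAlg_hom hA
    ((sbPoint_mem_normSection_iff hA (g := g) (x := x)).1 (h ▸ s.2))
  refine ⟨CommAlgCat.ofHom φ, Subtype.ext ?_⟩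
  rw [normSection_map_normChart, h, CommAlgCat.hom_ofHom, hφ]

theorem normSection_isAtlas (hA : Module.finrank F A = n ^ 2) :
    IsAtlas (normSection F A n).toFunctor
      (fun g : (Matrix (Fin 2) (Fin 2) A)ˣ => normAlg F A n g.1) (normChart hA) where
  mono g R φ ψ h := by
    have h1 := congrArg Subtype.val h
    rw [normSection_map_normChart, normSection_map_normChart, sbPoint_eq_iff] at h1
    exact CommAlgCat.hom_ext (normAlg_hom_ext (chartPoint_injective hA g h1))
  overlap h g := by
    refine ⟨normAlgMk F A n h.1 (overlapElement h g), fun R φ => ?_⟩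
    have h1 := isUnit_overlapElement_iff hA h g (normAlgMk F A n h.1 ≫ φ)
    have h2 : baseMap A (normAlgMk F A n h.1 ≫ φ).hom (generic F A) =
        baseMap A φ.hom (normGeneric F A n h.1) := (baseMap_baseMap _ _ _).symm
    rw [h2] at h1
    refine h1.trans ?_
    constructor
    · rintro ⟨x, hx⟩
      refine exists_normChart_eq hA (x := x) ?_
      rw [normSection_map_normChart, sbPoint_eq_iff, hx]
    · rintro ⟨ψ, hψ⟩
      have h3 := congrArg Subtype.val hψ
      rw [normSection_map_normChart, normSection_map_normChart, sbPoint_eq_iff] at h3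
      exact ⟨_, h3⟩
  cov R s p := by
    obtain ⟨f, hf, g, ψ, hψ⟩ := severiBrauer_locallyCovered hA R s.1 p
    rw [severiBrauer_map_sbPoint] at hψ
    exact ⟨f, hf, g, exists_normChart_eq hA hψ⟩

end NormSectionCharts

/-! ### The Jacobian criterion for hypersurfaces -/

section Hypersurface

variable {F : Type u} [Field F] {ι : Type} [Fintype ι]

/-- The first order Taylor expansion of a polynomial. -/
theorem aeval_add_mul {T : Type*} [CommRing T] [Algebra F T] {t : T} (ht : t * t = 0)
    (x y : ι → T) (p : MvPolynomial ι F) :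
    MvPolynomial.aeval (fun i => x i + t * y i) p = MvPolynomial.aeval x p +
      t * ∑ i, y i * MvPolynomial.aeval x (MvPolynomial.pderiv i p) := by
  classical
  induction p using MvPolynomial.induction_on with
  | C a => simp
  | add p q hp hq =>
    simp only [map_add, hp, hq, mul_add, Finset.sum_add_distrib]
    ring
  | mul_X p j hp =>
    have h1 : ∀ i, y i * MvPolynomial.aeval x (MvPolynomial.pderiv i (p * MvPolynomial.X j)) =
        x j * (y i * MvPolynomial.aeval x (MvPolynomial.pderiv i p)) +
          (if i = j then y i * MvPolynomial.aeval x p else 0) := by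
      intro i
      rw [Derivation.leibniz, MvPolynomial.pderiv_X, map_add, smul_eq_mul, smul_eq_mul, map_mul,
        map_mul, MvPolynomial.aeval_X]
      split_ifs with h
      · subst h
        simp
        ring
      · rw [Pi.single_eq_of_ne' h]
        simp
        ring
    rw [map_mul, hp, MvPolynomial.aeval_X, map_mul, MvPolynomial.aeval_X,
      Finset.sum_congr rfl fun i _ => h1 i, Finset.sum_add_distrib, ← Finset.mul_sum,
      Finset.sum_ite_eq' Finset.univ j, if_pos (Finset.mem_univ j)]
    linear_combination (y j * ∑ i, y i * MvPolynomial.aeval x (MvPolynomial.pderiv i p)) * ht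

/-- The Jacobian criterion for hypersurfaces. -/
theorem smooth_quotient_of_span_pderiv (f : MvPolynomial ι F)
    (hf : Ideal.span (insert f (Set.range fun i => MvPolynomial.pderiv i f)) = ⊤) :
    Algebra.Smooth F (MvPolynomial ι F ⧸ Ideal.span {f}) := by
  let q := Ideal.Quotient.mkₐ F (Ideal.span {f})
  have hq : RingHom.ker q.toRingHom = Ideal.span {f} := Ideal.mk_ker
  let T := MvPolynomial ι F ⧸ RingHom.ker q.toRingHom ^ 2
  let π : MvPolynomial ι F →ₐ[F] T := Ideal.Quotient.mkₐ F _
  have hff : π f * π f = 0 := by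
    rw [← map_mul]
    refine Ideal.Quotient.eq_zero_iff_mem.2 ?_
    rw [hq, sq]
    exact Ideal.mul_mem_mul (Ideal.mem_span_singleton_self f) (Ideal.mem_span_singleton_self f)
  have h1 : (1 : MvPolynomial ι F) ∈
      Ideal.span (insert f (Set.range fun i => MvPolynomial.pderiv i f)) := by
    rw [hf]
    trivial
  obtain ⟨a, z, hz, h1⟩ := Ideal.mem_span_insert.1 h1
  obtain ⟨c, rfl⟩ := (Ideal.mem_span_range_iff_exists_fun).1 hz
  -- From 1 = a f + ∑ c i ∂ᵢf, the shift of each variable by −f c i sends f to f − f ∑ c i ∂ᵢf = a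
  -- f², zero modulo f². So it factors through the quotient by f and splits the square-zero
  -- extension, which is formal smoothness.
  let ψ : MvPolynomial ι F →ₐ[F] T :=
    MvPolynomial.aeval fun i => π (MvPolynomial.X i) + π f * -π (c i)
  have hπ : MvPolynomial.aeval (fun i => π (MvPolynomial.X i)) = π :=
    MvPolynomial.algHom_ext fun i => by rw [MvPolynomial.aeval_X]
  have hψ : ψ f = 0 := by
    refine (aeval_add_mul hff _ _ f).trans ?_
    rw [hπ]
    have h2 := congrArg π h1
    simp only [map_add, map_sum, map_mul, map_one] at h2
    have h3 : ∑ i, -π (c i) * π (MvPolynomial.pderiv i f) =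
        -∑ i, π (c i) * π (MvPolynomial.pderiv i f) := by
      rw [← Finset.sum_neg_distrib]
      exact Finset.sum_congr rfl fun i _ => neg_mul _ _
    rw [h3]
    linear_combination π f * h2 + π a * hff
  obtain ⟨g, hg⟩ := exists_hom_of_quotient ψ hψ
  have hfs : Algebra.FormallySmooth F (MvPolynomial ι F ⧸ Ideal.span {f}) := by
    refine Algebra.FormallySmooth.of_split q g ?_
    apply Ideal.Quotient.algHom_ext
    rw [AlgHom.comp_assoc, hg]
    refine MvPolynomial.algHom_ext fun i => ?_
    rw [AlgHom.comp_apply, MvPolynomial.aeval_X, map_add, map_mul]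
    have h3 : q.kerSquareLift (π f) = 0 :=
      (AlgHom.kerSquareLift_mk q f).trans
        (Ideal.Quotient.eq_zero_iff_mem.2 (Ideal.mem_span_singleton_self f))
    rw [h3, zero_mul, add_zero]
    exact AlgHom.kerSquareLift_mk q _
  have hfp : Algebra.FinitePresentation F (MvPolynomial ι F ⧸ Ideal.span {f}) :=
    Algebra.FinitePresentation.quotient ⟨{f}, by simp⟩
  exact {}

end Hypersurface

/-! ### Matrices with vanishing adjugate -/

section Adjugate

variable {K : Type*} [Field K]

/-- The ranks are at most n − 2, and 2(n − 2) < n. Algebraically, det(S + T) is det S + det T +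
tr(adj S · T) for n = 2, with the further term tr(adj T · S) for n = 3. The restriction on n is
essential here. -/
theorem det_add_eq_zero_of_adjugate_eq_zero {n : ℕ} (hn : n = 2 ∨ n = 3)
    {S T : Matrix (Fin n) (Fin n) K} (hS : S.adjugate = 0) (hT : T.adjugate = 0) :
    (S + T).det = 0 := by
  have hdet : ∀ M : Matrix (Fin n) (Fin n) K, M.adjugate = 0 → M.det = 0 := by
    intro M hM
    have : NeZero n := ⟨by omega⟩
    have h := M.mul_adjugate
    rw [hM, mul_zero] at h
    have h1 := congrFun (congrFun h 0) 0
    simpa using h1.symm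
  have h1 := hdet S hS
  have h2 := hdet T hT
  have h3 : (S.adjugate * T).trace = 0 := by rw [hS, zero_mul, Matrix.trace_zero]
  have h4 : (T.adjugate * S).trace = 0 := by rw [hT, zero_mul, Matrix.trace_zero]
  rcases hn with rfl | rfl
  · simp only [Matrix.adjugate_fin_two, Matrix.trace_fin_two, Matrix.mul_apply, Fin.sum_univ_two,
      Matrix.of_apply, Matrix.cons_val', Matrix.cons_val_zero, Matrix.cons_val_one,
      Matrix.empty_val', Matrix.cons_val_fin_one, Matrix.det_fin_two, Matrix.add_apply] at *
    linear_combination h1 + h2 + h3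
  · simp only [Matrix.adjugate_fin_three, Matrix.trace_fin_three, Matrix.mul_apply,
      Fin.sum_univ_three, Matrix.of_apply, Matrix.cons_val', Matrix.cons_val_zero,
      Matrix.cons_val_one, Matrix.cons_val, Matrix.empty_val', Matrix.cons_val_fin_one,
      Matrix.det_fin_three, Matrix.add_apply] at *
    linear_combination h1 + h2 + h3 + h4

/-- `hadj` says that the differential of det α − det β in X vanishes. With det α = det β it extends
to the other block column, so (adj α, −adj β) P = 0, and both adjugates vanish as P is invertible
with inverse H. Then 1 = H₀₀α + H₀₁β would be singular. -/
theorem false_of_adjugate_mul_eq {n : ℕ} (hn : n = 2 ∨ n = 3)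
    {P H : Fin 2 → Fin 2 → Matrix (Fin n) (Fin n) K}
    (hPH : ∀ i j, P i 0 * H 0 j + P i 1 * H 1 j = if i = j then 1 else 0)
    (hHP : ∀ i j, H i 0 * P 0 j + H i 1 * P 1 j = if i = j then 1 else 0)
    (X : Matrix (Fin n) (Fin n) K)
    (hdet : (P 0 0 + P 0 1 * X).det = (P 1 0 + P 1 1 * X).det)
    (hadj : (P 0 0 + P 0 1 * X).adjugate * P 0 1 = (P 1 0 + P 1 1 * X).adjugate * P 1 1) :
    False := by
  set α := P 0 0 + P 0 1 * X with hα
  set β := P 1 0 + P 1 1 * X with hβ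
  have h0 : α.adjugate * P 0 0 = β.adjugate * P 1 0 := by
    have h1 : α.adjugate * α = β.adjugate * β := by
      rw [Matrix.adjugate_mul, Matrix.adjugate_mul, hdet]
    nth_rw 2 [hα] at h1
    nth_rw 2 [hβ] at h1
    rw [mul_add, mul_add, ← mul_assoc, ← mul_assoc, hadj] at h1
    exact add_right_cancel h1
  have hrow : ∀ j, α.adjugate * (P 0 0 * H 0 j + P 0 1 * H 1 j) =
      β.adjugate * (P 1 0 * H 0 j + P 1 1 * H 1 j) := by
    intro j
    simp only [mul_add, ← mul_assoc, h0, hadj]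
  have hα0 : α.adjugate = 0 := by simpa [hPH] using hrow 0
  have hβ0 : β.adjugate = 0 := by simpa [hPH] using (hrow 1).symm
  have h1 : H 0 0 * α + H 0 1 * β = 1 := by
    have h2 : H 0 0 * α + H 0 1 * β = (H 0 0 * P 0 0 + H 0 1 * P 1 0) +
        (H 0 0 * P 0 1 + H 0 1 * P 1 1) * X := by
      rw [hα, hβ]
      noncomm_ring
    rw [h2, hHP, hHP]
    simp
  have h2 := det_add_eq_zero_of_adjugate_eq_zero hn (S := H 0 0 * α) (T := H 0 1 * β)
    (by rw [Matrix.adjugate_mul_distrib, hα0, zero_mul])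
    (by rw [Matrix.adjugate_mul_distrib, hβ0, zero_mul])
  rw [h1, Matrix.det_one] at h2
  exact one_ne_zero h2

/-- Only column j is perturbed, so the determinant is affine in t without any condition on t;
Cramer's rule gives the coefficient. -/
theorem det_map_add_smul_mul_single {D : Type*} [CommRing D] [Algebra K D] {n : ℕ} (t : D)
    (M N : Matrix (Fin n) (Fin n) K) (i j : Fin n) :
    (M.map (algebraMap K D) + t • (N * Matrix.single i j (1 : K)).map (algebraMap K D)).det =
      algebraMap K D M.det + t * algebraMap K D ((M.adjugate * N) j i) := by
  have h1 : M.map (algebraMap K D) + t • (N * Matrix.single i j (1 : K)).map (algebraMap K D) =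
      (M.map (algebraMap K D)).updateCol j ((fun k => M.map (algebraMap K D) k j) +
        t • fun k => (N.map (algebraMap K D)) k i) := by
    ext k l
    by_cases hl : l = j
    · subst hl
      simp
    · rw [Matrix.updateCol_ne hl]
      simp [Matrix.mul_single_apply_of_ne _ _ _ _ _ hl]
  rw [h1, Matrix.det_updateCol_add, Matrix.det_updateCol_smul, Matrix.updateCol_eq_self]
  congr 1
  · exact (RingHom.map_det (algebraMap K D) M).symm
  · congr 1
    have h2 : (M.adjugate * N) j i = (M.updateCol j fun k => N k i).det := by
      rw [← Matrix.cramer_apply, Matrix.cramer_eq_adjugate_mulVec]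
      rfl
    rw [h2, RingHom.map_det]
    congr 1
    ext k l
    by_cases hl : l = j
    · subst hl
      simp
    · simp [Matrix.updateCol_ne hl]

end Adjugate

/-! ### Smoothness of the charts of the norm section -/

section SmoothCharts

variable {F : Type u} [Field F] {A : Type u} [Ring A] [Algebra F A] {n : ℕ}
  [FiniteDimensional F A]

omit [FiniteDimensional F A] in
theorem exists_isAlgClosed_hom_ker_eq {B : Type u} [CommRing B] [Algebra F B] (p : Ideal B)
    [p.IsPrime] : ∃ (K : Type u) (_ : Field K) (_ : Algebra F K) (_ : IsAlgClosed K)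
      (π : B →ₐ[F] K), RingHom.ker π = p := by
  refine ⟨AlgebraicClosure p.ResidueField, inferInstance, inferInstance, inferInstance,
    IsScalarTower.toAlgHom F B _, ?_⟩
  ext b
  rw [RingHom.mem_ker, IsScalarTower.coe_toAlgHom',
    IsScalarTower.algebraMap_apply B p.ResidueField (AlgebraicClosure p.ResidueField),
    map_eq_zero_iff _ (algebraMap p.ResidueField _).injective, Ideal.algebraMap_residueField_eq_zero]

theorem basis_repr_baseMap {R S : Type u} [CommRing R] [Algebra F R] [CommRing S] [Algebra F S]
    (f : R →ₐ[F] S) (x : R ⊗[F] A) (i : Fin (Module.finrank F A)) :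
    (Algebra.TensorProduct.basis S (Module.finBasis F A)).repr (baseMap A f x) i =
      f ((Algebra.TensorProduct.basis R (Module.finBasis F A)).repr x i) := by
  induction x with
  | zero => simp
  | add x y hx hy => simp only [map_add, Finsupp.add_apply, hx, hy]
  | tmul r a => simp

/-- The first order Taylor expansion of a polynomial function on `A`. -/
theorem coordHom_add_smul {K D : Type u} [Field K] [Algebra F K] [CommRing D] [Algebra F D]
    (e : K →ₐ[F] D) {t : D} (ht : t * t = 0) (x y : K ⊗[F] A) (p : CoordRing F A)
    (hp : coordHom x p = 0) (hp' : ∀ i, coordHom x (MvPolynomial.pderiv i p) = 0) :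
    coordHom (baseMap A e x + t • baseMap A e y) p = 0 := by
  have h1 : ∀ i, (Algebra.TensorProduct.basis D (Module.finBasis F A)).repr
      (baseMap A e x + t • baseMap A e y) i =
        e ((Algebra.TensorProduct.basis K (Module.finBasis F A)).repr x i) +
          t * e ((Algebra.TensorProduct.basis K (Module.finBasis F A)).repr y i) := by
    intro i
    rw [map_add, map_smul, Finsupp.add_apply, Finsupp.smul_apply, basis_repr_baseMap,
      basis_repr_baseMap, smul_eq_mul]
  have h2 : ∀ q : CoordRing F A, MvPolynomial.aeval
      (fun i => e ((Algebra.TensorProduct.basis K (Module.finBasis F A)).repr x i)) q =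
        e (coordHom x q) := by
    intro q
    rw [coordHom, ← AlgHom.comp_apply, MvPolynomial.comp_aeval]
  rw [coordHom, funext h1, aeval_add_mul ht]
  simp only [h2, hp, hp', map_zero, mul_zero, Finset.sum_const_zero, add_zero]

omit [FiniteDimensional F A] in
theorem splitHom_chart_add_smul {K : Type u} [Field K] [Algebra F K] (φ : Splitting F A n)
    (ι : AlgebraicClosure F →ₐ[F] K) (x y : K ⊗[F] A) (a b : A) :
    splitHom φ ((IsScalarTower.toAlgHom F K (DualNumber K)).comp ι)
        (1 ⊗ₜ a + (1 ⊗ₜ b) * (baseMap A (IsScalarTower.toAlgHom F K (DualNumber K)) x +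
          DualNumber.eps (R := K) • baseMap A (IsScalarTower.toAlgHom F K (DualNumber K)) y)) =
      (splitHom φ ι ((1 : K) ⊗ₜ[F] a + ((1 : K) ⊗ₜ[F] b) * x)).map (algebraMap K (DualNumber K)) +
        DualNumber.eps (R := K) •
          (splitHom φ ι ((1 : K) ⊗ₜ[F] b) * splitHom φ ι y).map (algebraMap K (DualNumber K)) := by
  set e := IsScalarTower.toAlgHom F K (DualNumber K) with he
  have h1 : (1 : DualNumber K) ⊗ₜ[F] a + ((1 : DualNumber K) ⊗ₜ[F] b) * (baseMap A e x +
      DualNumber.eps (R := K) • baseMap A e y) = baseMap A e (1 ⊗ₜ a + (1 ⊗ₜ b) * x) +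
        DualNumber.eps (R := K) • baseMap A e ((1 ⊗ₜ b) * y) := by
    simp only [map_add, map_mul, Algebra.TensorProduct.map_tmul, map_one, AlgHom.id_apply,
      mul_add, mul_smul_comm, add_assoc]
  rw [h1, map_add, map_smul]
  erw [splitHom_map φ ι e, splitHom_map φ ι e]
  rw [map_mul (splitHom φ ι)]
  rfl

variable [PerfectField F] [Algebra.IsCentral F A] [IsSimpleRing A]

/-- At a common geometric zero x of the equation and its derivatives, the equation holds at x + εy
for all y. Letting y run through the matrix units of a splitting, the coefficients of ε give the
hypothesis of `false_of_adjugate_mul_eq`. -/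
theorem span_insert_pderiv_normEquation (hA : Module.finrank F A = n ^ 2) (hn : n = 2 ∨ n = 3)
    (g : (Matrix (Fin 2) (Fin 2) A)ˣ) :
    Ideal.span (insert (normEquation F A n g.1)
      (Set.range fun i => MvPolynomial.pderiv i (normEquation F A n g.1))) = ⊤ := by
  by_contra htop
  obtain ⟨m, hm, hle⟩ := Ideal.exists_le_maximal _ htop
  obtain ⟨K, _, _, _, π, hker⟩ := exists_isAlgClosed_hom_ker_eq (F := F) m
  have hπ : ∀ q ∈ insert (normEquation F A n g.1)
      (Set.range fun i => MvPolynomial.pderiv i (normEquation F A n g.1)), π q = 0 := by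
    intro q hq
    rw [← RingHom.mem_ker, hker]
    exact hle (Ideal.subset_span hq)
  set x := baseMap A π (generic F A) with hx
  have hxπ : coordHom x = π := coordRing_hom_ext (baseMap_coordHom_generic x)
  rw [← hxπ] at hπ
  obtain ⟨φ⟩ := nonempty_splitting hA
  let ι : AlgebraicClosure F →ₐ[F] K := IsAlgClosed.lift
  let Ψ := splitHom φ ι
  let e := IsScalarTower.toAlgHom F K (DualNumber K)
  have hadj : ∀ i j, ((Ψ (chartTop g.1 x)).adjugate * Ψ (1 ⊗ₜ g.1 0 1)) j i =
      ((Ψ (chartBot g.1 x)).adjugate * Ψ (1 ⊗ₜ g.1 1 1)) j i := by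
    intro i j
    obtain ⟨y, hy⟩ := (splitHom_bijective hA φ ι).2 (Matrix.single i j 1)
    have h1 := coordHom_add_smul (D := DualNumber K) e (t := DualNumber.eps)
      DualNumber.eps_mul_eps x y (normEquation F A n g.1) (hπ _ (Set.mem_insert _ _))
      fun i => hπ _ (Set.mem_insert_of_mem _ ⟨i, rfl⟩)
    rw [map_normEquation hA, baseMap_coordHom_generic, sub_eq_zero,
      ← det_splitHom φ (e.comp ι), ← det_splitHom φ (e.comp ι)] at h1
    rw [chartTop, chartBot, splitHom_chart_add_smul, splitHom_chart_add_smul, hy,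
      det_map_add_smul_mul_single, det_map_add_smul_mul_single] at h1
    have h2 := congrArg TrivSqZeroExt.snd h1
    simpa [Ψ, chartTop, chartBot, TrivSqZeroExt.algebraMap_eq_inl] using h2
  have hdet : (Ψ (chartTop g.1 x)).det = (Ψ (chartBot g.1 x)).det := by
    have h1 := hπ _ (Set.mem_insert _ _)
    rw [map_normEquation hA, baseMap_coordHom_generic, sub_eq_zero] at h1
    rw [det_splitHom, det_splitHom, h1]
  have hmul : ∀ u v : Matrix (Fin 2) (Fin 2) A, u * v = 1 → ∀ i j,
      Ψ (1 ⊗ₜ u i 0) * Ψ (1 ⊗ₜ v 0 j) + Ψ (1 ⊗ₜ u i 1) * Ψ (1 ⊗ₜ v 1 j) =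
        if i = j then 1 else 0 := by
    intro u v huv i j
    have h1 := congrFun (congrFun huv i) j
    rw [Matrix.mul_apply, Fin.sum_univ_two, Matrix.one_apply] at h1
    rw [← map_mul, ← map_mul, Algebra.TensorProduct.tmul_mul_tmul,
      Algebra.TensorProduct.tmul_mul_tmul, ← map_add, one_mul, ← TensorProduct.tmul_add, h1]
    split_ifs
    · exact map_one Ψ
    · rw [TensorProduct.tmul_zero, map_zero]
  have htop' : Ψ (chartTop g.1 x) = Ψ (1 ⊗ₜ g.1 0 0) + Ψ (1 ⊗ₜ g.1 0 1) * Ψ x := by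
    rw [chartTop, map_add, map_mul]
  have hbot' : Ψ (chartBot g.1 x) = Ψ (1 ⊗ₜ g.1 1 0) + Ψ (1 ⊗ₜ g.1 1 1) * Ψ x := by
    rw [chartBot, map_add, map_mul]
  rw [htop', hbot'] at hadj hdet
  exact false_of_adjugate_mul_eq hn (P := fun i j => Ψ (1 ⊗ₜ g.1 i j))
    (H := fun i j => Ψ (1 ⊗ₜ g⁻¹.1 i j)) (hmul _ _ g.mul_inv) (hmul _ _ g.inv_mul) (Ψ x) hdet
    (Matrix.ext fun j i => hadj i j)

theorem smooth_normAlg (hA : Module.finrank F A = n ^ 2) (hn : n = 2 ∨ n = 3)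
    (g : (Matrix (Fin 2) (Fin 2) A)ˣ) : Algebra.Smooth F (normAlg F A n g.1) :=
  smooth_quotient_of_span_pderiv _ (span_insert_pderiv_normEquation hA hn g)

omit [FiniteDimensional F A] [PerfectField F] [Algebra.IsCentral F A] [IsSimpleRing A] in
theorem smooth_of_isOpenImmersion_cover {X : Over (Spec (.of F))} {I : Type u}
    {B : I → CommAlgCat.{u} F} (hB : ∀ i, Algebra.Smooth F (B i)) (k : ∀ i, specOver (B i) ⟶ X)
    (hk : ∀ i, IsOpenImmersion (k i).left) (hcov : ∀ x : X.left, ∃ i y, (k i).left y = x) :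
    Smooth X.hom := by
  let U : X.left.OpenCover := Scheme.Cover.mkOfCovers I (fun i => (specOver (B i)).left)
    (fun i => (k i).left) hcov hk
  have hloc : HasRingHomProperty @Smooth.{u} RingHom.Smooth := inferInstance
  have : IsZariskiLocalAtSource @Smooth.{u} := hloc.instIsZariskiLocalAtSource
  rw [IsZariskiLocalAtSource.iff_of_openCover (P := @Smooth.{u}) U]
  intro i
  change Smooth ((k i).left ≫ X.hom)
  rw [Over.w]
  change Smooth (Spec.map (CommRingCat.ofHom (algebraMap F (B i))))
  rw [HasRingHomProperty.Spec_iff (P := @Smooth.{u})]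
  exact RingHom.smooth_algebraMap.2 (hB i)

end SmoothCharts

/-! ### Deformation to points with invertible first entry -/

section Deformation

/-- A singular matrix over a field is the value at zero of a curve of invertible matrices, whose
determinant can be prescribed up to a nonzero factor. -/
theorem exists_powerSeries_matrix {K : Type*} [Field K] {m : Type*} [Fintype m] [DecidableEq m]
    {M : Matrix m m K} (hM : M.det = 0) : ∃ P : PowerSeries K, P ≠ 0 ∧ ∀ f : PowerSeries K,
      ∃ N : Matrix m m (PowerSeries K), N.map PowerSeries.constantCoeff = M ∧
        N.det = PowerSeries.X * f * P := by
  -- Transvections have determinant 1, so some diagonal entry D i is 0. It is deformed to X · f and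
  -- the other entries to D j + X; P is the product of the latter.
  obtain ⟨L, L', D, rfl⟩ := Matrix.Pivot.exists_list_transvec_mul_diagonal_mul_list_transvec M
  rw [Matrix.det_mul, Matrix.det_mul, Matrix.TransvectionStruct.det_toMatrix_prod,
    Matrix.TransvectionStruct.det_toMatrix_prod, one_mul, mul_one, Matrix.det_diagonal,
    Finset.prod_eq_zero_iff] at hM
  obtain ⟨i, -, hi⟩ := hM
  set U := (L.map Matrix.TransvectionStruct.toMatrix).prod with hU
  set V := (L'.map Matrix.TransvectionStruct.toMatrix).prod with hV
  have hdet : ∀ L : List (Matrix.TransvectionStruct m K),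
      ((L.map Matrix.TransvectionStruct.toMatrix).prod.map
        (PowerSeries.C (R := K))).det = 1 := by
    intro L
    rw [← RingHom.mapMatrix_apply, ← RingHom.map_det,
      Matrix.TransvectionStruct.det_toMatrix_prod, map_one]
  have hC : ∀ W : Matrix m m K, PowerSeries.constantCoeff.mapMatrix
      (W.map (PowerSeries.C (R := K))) = W := by
    intro W
    ext a b
    simp
  refine ⟨∏ j ∈ Finset.univ.erase i, (PowerSeries.C (D j) + PowerSeries.X),
    Finset.prod_ne_zero_iff.2 fun j _ h => ?_, fun f => ?_⟩
  · simpa [PowerSeries.coeff_C] using congrArg (PowerSeries.coeff 1) h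
  · refine ⟨U.map PowerSeries.C * Matrix.diagonal (fun j => if j = i then PowerSeries.X * f else
      PowerSeries.C (D j) + PowerSeries.X) * V.map PowerSeries.C, ?_, ?_⟩
    · rw [← RingHom.mapMatrix_apply, map_mul, map_mul, hC, hC]
      congr 2
      rw [RingHom.mapMatrix_apply, Matrix.diagonal_map (map_zero _)]
      congr 1
      refine funext fun j => ?_
      split_ifs with h
      · simp [h, hi]
      · simp
    · rw [Matrix.det_mul, Matrix.det_mul, hdet, hdet, one_mul, mul_one, Matrix.det_diagonal,
        ← Finset.mul_prod_erase _ _ (Finset.mem_univ i), if_pos rfl]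
      congr 1
      exact Finset.prod_congr rfl fun j hj => if_neg (Finset.ne_of_mem_erase hj)

variable {F : Type u} [Field F] {A : Type u} [Ring A] [Algebra F A] {n : ℕ}
  [FiniteDimensional F A] [PerfectField F] [Algebra.IsCentral F A] [IsSimpleRing A]
  {K : Type u} [Field K] [Algebra F K]

omit [FiniteDimensional F A] [PerfectField F] [Algebra.IsCentral F A] [IsSimpleRing A] in
theorem column_injective {R : Type u} [CommRing R] [Algebra F R] {a b a' b' : R ⊗[F] A}
    (h : column a b = column a' b') : a = a' ∧ b = b' := by
  have h1 := congrArg toMat h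
  rw [toMat_column, toMat_column] at h1
  exact ⟨by simpa using congrFun (congrFun h1 0) 0, by simpa using congrFun (congrFun h1 1) 0⟩

omit [FiniteDimensional F A] [PerfectField F] [Algebra.IsCentral F A] [IsSimpleRing A] in
theorem column_mul {R : Type u} [CommRing R] [Algebra F R] (a b c : R ⊗[F] A) :
    column (a * c) (b * c) = column a b * entry 0 0 c := by
  rw [column_mul_entry, column_eq]

variable (F K) in
omit [FiniteDimensional F A] [PerfectField F] [Algebra.IsCentral F A] [IsSimpleRing A] in
/-- The value at zero of a power series. -/
abbrev constantCoeffHom : PowerSeries K →ₐ[F] K where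
  __ := PowerSeries.constantCoeff (R := K)
  commutes' r := by
    simp [PowerSeries.algebraMap_apply]

/-- Every point of the norm section is the specialization of a point at which the first entry is
invertible. -/
theorem exists_powerSeries_point [IsAlgClosed K] (hA : Module.finrank F A = n ^ 2)
    (g : (Matrix (Fin 2) (Fin 2) A)ˣ) {x : K ⊗[F] A}
    (hx : reducedNorm n (chartTop g.1 x) = reducedNorm n (chartBot g.1 x)) :
    ∃ z : PowerSeries K ⊗[F] A, baseMap A (constantCoeffHom F K) z = x ∧
      reducedNorm n (chartTop g.1 z) = reducedNorm n (chartBot g.1 z) ∧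
      reducedNorm n (chartTop g.1 z) ≠ 0 := by
  let e : K →ₐ[F] PowerSeries K := IsScalarTower.toAlgHom F K (PowerSeries K)
  by_cases h0 : reducedNorm n (chartTop g.1 x) = 0
  swap
  · refine ⟨baseMap A e x, ?_, ?_, ?_⟩
    · have h1 : (constantCoeffHom F K).comp e = AlgHom.id F K := by
        ext a
        exact PowerSeries.constantCoeff_C a
      rw [baseMap_baseMap, h1]
      simp
    · rw [← baseMap_chartTop, ← baseMap_chartBot, reducedNorm_map hA, reducedNorm_map hA, hx]
    · rw [← baseMap_chartTop, reducedNorm_map hA]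
      exact (map_ne_zero_iff _ (algebraMap K (PowerSeries K)).injective).2 h0
  obtain ⟨φ⟩ := nonempty_splitting hA
  let ι : AlgebraicClosure F →ₐ[F] K := IsAlgClosed.lift
  have hcomp : (constantCoeffHom F K).comp (e.comp ι) = ι := by
    ext a
    exact PowerSeries.constantCoeff_C _
  have hlift : ∀ (y : K ⊗[F] A) (N : Matrix (Fin n) (Fin n) (PowerSeries K)),
      N.map PowerSeries.constantCoeff = splitHom φ ι y →
        ∃ w : PowerSeries K ⊗[F] A, baseMap A (constantCoeffHom F K) w = y ∧
          reducedNorm n w = N.det := by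
    intro y N hN
    obtain ⟨w, rfl⟩ := (splitHom_bijective hA φ (e.comp ι)).2 N
    refine ⟨w, (splitHom_bijective hA φ ι).1 ?_, (det_splitHom _ _ _).symm⟩
    rw [← hN]
    have h1 := splitHom_map φ (e.comp ι) (constantCoeffHom F K) w
    rw [hcomp] at h1
    exact h1
  rw [h0] at hx
  obtain ⟨P, hP, hP'⟩ := exists_powerSeries_matrix (M := splitHom φ ι (chartTop g.1 x))
    (by rw [det_splitHom, h0])
  obtain ⟨Q, hQ, hQ'⟩ := exists_powerSeries_matrix (M := splitHom φ ι (chartBot g.1 x))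
    (by rw [det_splitHom, ← hx])
  -- Each lift takes the factor of the other as its free parameter, so both determinants equal X · P
  -- · Q.
  obtain ⟨M, hM, hMdet⟩ := hP' Q
  obtain ⟨N, hN, hNdet⟩ := hQ' P
  obtain ⟨α, hα, hαdet⟩ := hlift _ M hM
  obtain ⟨β, hβ, hβdet⟩ := hlift _ N hN
  -- The lifted column must be brought to the form g(1, z). Since (a, b) specializes to (1, x), the
  -- reduced norm of a has constant term 1, so a is a unit and z = b a⁻¹.
  obtain ⟨a, b, hab⟩ : ∃ a b, (1 ⊗ₜ g⁻¹.1) * column α β = column a b :=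
    ⟨_, _, tmul_mul_column _ _ _⟩
  have h1 : column (baseMap A (constantCoeffHom F K) a) (baseMap A (constantCoeffHom F K) b) =
      column 1 x := by
    rw [← baseMap_column, ← hab, map_mul, baseMap_column, hα, hβ, Algebra.TensorProduct.map_tmul,
      map_one, AlgHom.id_apply]
    refine (congrArg _ (chartColumn_eq g.1 x)).trans ?_
    rw [← mul_assoc, Algebra.TensorProduct.tmul_mul_tmul, one_mul, g.inv_mul,
      ← Algebra.TensorProduct.one_def, one_mul]
  obtain ⟨ha, hb⟩ := column_injective h1
  have hunit : IsUnit a := by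
    rw [isUnit_iff_isUnit_reducedNorm hA, PowerSeries.isUnit_iff_constantCoeff]
    have h2 := reducedNorm_map hA (constantCoeffHom F K) a
    rw [show Algebra.TensorProduct.map (constantCoeffHom F K) (AlgHom.id F A) a = 1 from ha,
      reducedNorm_one hA] at h2
    exact h2 ▸ isUnit_one
  obtain ⟨c, hac⟩ := hunit.exists_right_inv
  have hc : baseMap A (constantCoeffHom F K) c = 1 := by
    have h2 := congrArg (baseMap A (constantCoeffHom F K)) hac
    rwa [map_mul, ha, one_mul, map_one] at h2
  have h2 : column (chartTop g.1 (b * c)) (chartBot g.1 (b * c)) = column (α * c) (β * c) := by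
    refine (chartColumn_eq g.1 (b * c)).trans ?_
    rw [← hac, column_mul, ← hab, ← mul_assoc, ← mul_assoc, Algebra.TensorProduct.tmul_mul_tmul,
      one_mul, g.mul_inv, ← Algebra.TensorProduct.one_def, one_mul, ← column_mul]
  obtain ⟨htop, hbot⟩ := column_injective h2
  have hc0 : reducedNorm n c ≠ 0 := by
    have h3 := congrArg (reducedNorm n) hac
    rw [reducedNorm_mul hA, reducedNorm_one hA] at h3
    exact right_ne_zero_of_mul_eq_one h3
  refine ⟨b * c, by rw [map_mul, hb, hc, mul_one], ?_, ?_⟩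
  · rw [htop, hbot, reducedNorm_mul hA, reducedNorm_mul hA, hαdet, hβdet, hMdet, hNdet]
    ring
  · rw [htop, reducedNorm_mul hA, hαdet, hMdet]
    exact mul_ne_zero (mul_ne_zero (mul_ne_zero PowerSeries.X_ne_zero hQ) hP) hc0

/-- A deformation over K⟦X⟧ of the geometric point above p is a morphism to a domain. Its kernel is
the required generization q. -/
theorem exists_le_reducedNorm_chartTop_notMem (hA : Module.finrank F A = n ^ 2)
    (g : (Matrix (Fin 2) (Fin 2) A)ˣ) (p : PrimeSpectrum (normAlg F A n g.1)) :
    ∃ q : PrimeSpectrum (normAlg F A n g.1), q ≤ p ∧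
      reducedNorm n (chartTop g.1 (normGeneric F A n g.1)) ∉ q.asIdeal := by
  obtain ⟨K, _, _, _, π, hker⟩ := exists_isAlgClosed_hom_ker_eq (F := F) p.asIdeal
  obtain ⟨z, hz, hz1, hz2⟩ := exists_powerSeries_point hA g (reducedNorm_of_normAlg_hom hA g.1 π)
  obtain ⟨φ, hφ⟩ := exists_normAlg_hom hA hz1
  have hcomp : (constantCoeffHom F K).comp φ = π := by
    refine normAlg_hom_ext ?_
    rw [← hz, ← hφ, baseMap_baseMap]
  refine ⟨⟨RingHom.ker φ, RingHom.ker_isPrime φ.toRingHom⟩, fun b hb => ?_, fun h => hz2 ?_⟩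
  · rw [← hker, RingHom.mem_ker, ← hcomp, AlgHom.comp_apply, RingHom.mem_ker.1 hb, map_zero]
  · rw [← hφ, ← baseMap_chartTop, reducedNorm_map hA]
    exact RingHom.mem_ker.1 h

end Deformation

/-! ### SL₁(A) as a chart, density, and the closed immersion -/

section Representability

variable {F : Type u} [Field F]

theorem app_specMap_comp {X : Over (Spec (.of F))} {P : CommAlgCat.{u} F ⥤ Type u}
    (ε : functorOfPoints F X ⟶ P) {R S : CommAlgCat.{u} F} (a : R ⟶ S) (x : specOver R ⟶ X) :
    ε.app S (specMap a ≫ x) = P.map a (ε.app R x) :=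
  NatTrans.naturality_apply ε a x

theorem over_comp_left_apply {S : Scheme.{u}} {X Y Z : Over S} (f : X ⟶ Y) (g : Y ⟶ Z)
    (x : X.left) : (f ≫ g).left x = g.left (f.left x) := by
  rw [Over.comp_left, Scheme.Hom.comp_apply]

/-- A functor with a universal element is the functor of points of an affine scheme. -/
theorem exists_iso_of_universal {P : CommAlgCat.{u} F ⥤ Type u} {C : CommAlgCat.{u} F} (c : P.obj C)
    (h : ∀ R : CommAlgCat.{u} F, Function.Bijective fun φ : C ⟶ R => P.map φ c) :
    ∃ ε : functorOfPoints F (specOver C) ≅ P,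
      ∀ (R : CommAlgCat.{u} F) (φ : C ⟶ R), ε.hom.app R (specMap φ) = P.map φ c := by
  choose a ha using fun (R : CommAlgCat.{u} F) (x : specOver R ⟶ specOver C) =>
    exists_specMap_eq x
  have ha' : ∀ {R : CommAlgCat.{u} F} (φ : C ⟶ R), a R (specMap φ) = φ :=
    fun φ => specMap_injective (ha _ _)
  let η : functorOfPoints F (specOver C) ⟶ P :=
    { app R := ↾fun x => P.map (a R x) c
      naturality R S f := by
        ext x
        change P.map (a S (specMap f ≫ x)) c = P.map f (P.map (a R x) c)
        rw [← Functor.map_comp_apply]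
        refine congrArg (fun b => P.map b c) (specMap_injective ?_)
        rw [ha, specMap_comp, ha] }
  have hη : ∀ R : CommAlgCat.{u} F, IsIso (η.app R) := by
    intro R
    rw [isIso_iff_bijective]
    constructor
    · intro x y hxy
      have h1 : a R x = a R y := (h R).1 hxy
      rw [← ha R x, ← ha R y, h1]
    · intro s
      obtain ⟨φ, hφ⟩ := (h R).2 s
      refine ⟨specMap φ, ?_⟩
      change P.map (a R (specMap φ)) c = s
      rw [ha']
      exact hφ
  have : IsIso η := NatIso.isIso_of_isIso_app η
  refine ⟨asIso η, fun R φ => ?_⟩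
  change P.map (a R (specMap φ)) c = _
  rw [ha']

variable {A : Type u} [Ring A] [Algebra F A] {n : ℕ}

theorem chartTop_one {R : Type u} [CommRing R] [Algebra F R] (x : R ⊗[F] A) :
    chartTop (1 : Matrix (Fin 2) (Fin 2) A) x = 1 := by
  simp [chartTop, Algebra.TensorProduct.one_def]

theorem chartBot_one {R : Type u} [CommRing R] [Algebra F R] (x : R ⊗[F] A) :
    chartBot (1 : Matrix (Fin 2) (Fin 2) A) x = x := by
  simp [chartBot, ← Algebra.TensorProduct.one_def]

variable [FiniteDimensional F A] [PerfectField F] [Algebra.IsCentral F A] [IsSimpleRing A]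

/-- For g = 1 the equation reads 1 = Nrd(x), which already forces x to be a unit. So SL₁(A) is the
chart of the norm section at g = 1. -/
theorem mem_specialLinear_iff (hA : Module.finrank F A = n ^ 2) {R : CommAlgCat.{u} F}
    {x : R ⊗[F] A} : x ∈ (specialLinear F A n).obj R ↔
      reducedNorm n (chartTop (1 : Matrix (Fin 2) (Fin 2) A) x) =
        reducedNorm n (chartBot (1 : Matrix (Fin 2) (Fin 2) A) x) := by
  rw [chartTop_one, chartBot_one, reducedNorm_one hA]
  refine ⟨fun h => h.2.symm, fun h => ⟨?_, h.symm⟩⟩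
  rw [isUnit_iff_isUnit_reducedNorm hA]
  exact h ▸ isUnit_one

theorem exists_specialLinear_iso (hA : Module.finrank F A = n ^ 2) :
    ∃ ε : functorOfPoints F (specOver (normAlg F A n 1)) ≅ (specialLinear F A n).toFunctor,
      ∀ (R : CommAlgCat.{u} F) (φ : normAlg F A n 1 ⟶ R),
        (ε.hom.app R (specMap φ)).1 = baseMap A φ.hom (normGeneric F A n 1) := by
  obtain ⟨ε, hε⟩ := exists_iso_of_universal (P := (specialLinear F A n).toFunctor)
    (C := normAlg F A n 1)
    ⟨normGeneric F A n 1, (mem_specialLinear_iff hA).2 (reducedNorm_normGeneric hA 1)⟩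
    fun R => by
      constructor
      · intro φ ψ h
        exact CommAlgCat.hom_ext (normAlg_hom_ext (congrArg Subtype.val h))
      · rintro ⟨x, hx⟩
        obtain ⟨φ, hφ⟩ := exists_normAlg_hom hA ((mem_specialLinear_iff hA).1 hx)
        exact ⟨CommAlgCat.ofHom φ, Subtype.ext hφ⟩
  refine ⟨ε, fun R φ => ?_⟩
  rw [hε]
  rfl

section Geometry

variable (hA : Module.finrank F A = n ^ 2) {X : Over (Spec (.of F))}
  (ε : functorOfPoints F X ≅ (normSection F A n).toFunctor)
  (k : ∀ g : (Matrix (Fin 2) (Fin 2) A)ˣ, specOver (normAlg F A n g.1) ⟶ X)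

theorem exists_comp_chart_eq (hε : ∀ g, ε.hom.app _ (k g) = normChart hA g)
    {R : CommAlgCat.{u} F} (s : specOver R ⟶ X)
    (g : (Matrix (Fin 2) (Fin 2) A)ˣ) {x : R ⊗[F] A} (h : (ε.hom.app R s).1 = sbPoint hA g x) :
    ∃ t : specOver R ⟶ specOver (normAlg F A n g.1), t ≫ k g = s := by
  obtain ⟨φ, hφ⟩ := exists_normChart_eq hA h
  refine ⟨specMap φ, ?_⟩
  apply ((isIso_iff_bijective (ε.hom.app R)).1 inferInstance).1
  refine (app_specMap_comp ε.hom φ (k g)).trans ?_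
  rw [hε, hφ]

theorem app_specMap_chart (hε : ∀ g, ε.hom.app _ (k g) = normChart hA g)
    (g : (Matrix (Fin 2) (Fin 2) A)ˣ) {R : CommAlgCat.{u} F}
    (φ : normAlg F A n g.1 ⟶ R) : (ε.hom.app R (specMap φ ≫ k g)).1 =
      sbPoint hA g (baseMap A φ.hom (normGeneric F A n g.1)) := by
  rw [app_specMap_comp, hε, normSection_map_normChart]

/-- An open set containing a point contains its generizations. One of them has invertible norm of
the first entry, and hence lies in the chart of g = 1. -/
theorem denseRange_chart_one (hε : ∀ g, ε.hom.app _ (k g) = normChart hA g)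
    (hcov : ∀ x : X.left, ∃ g y, (k g).left y = x) :
    DenseRange (k 1).left := by
  intro x
  rw [mem_closure_iff]
  intro V hV hx
  obtain ⟨g, p, rfl⟩ := hcov x
  obtain ⟨q, hqp, hq⟩ := exists_le_reducedNorm_chartTop_notMem hA g p
  have hqV : (k g).left q ∈ V :=
    (((PrimeSpectrum.le_iff_specializes q p).1 hqp).map (k g).left.continuous).mem_open hV hx
  set d := reducedNorm n (chartTop g.1 (normGeneric F A n g.1)) with hd
  have hunit : IsUnit (transitionEntry 1 g
      (baseMap A (toAway (normAlg F A n g.1) d).hom (normGeneric F A n g.1))) := by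
    rw [transitionEntry, inv_one, Units.val_one, one_mul, isUnit_iff_isUnit_reducedNorm hA,
      ← baseMap_chartTop, reducedNorm_map hA]
    exact isUnit_toAway _ _
  obtain ⟨x, hx⟩ := (isUnit_transitionEntry_iff hA 1 g _).1 hunit
  obtain ⟨t, ht⟩ := exists_comp_chart_eq hA ε k hε (specMap (toAway _ d) ≫ k g) 1 (x := x) (by
    rw [app_specMap_chart hA ε k hε, sbPoint_eq_iff, hx])
  obtain ⟨y, hy⟩ : q ∈ Set.range (specMap (toAway (normAlg F A n g.1) d)).left := by
    rw [range_specMap_toAway]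
    exact hq
  refine ⟨_, hqV, t.left y, ?_⟩
  have h1 := congrArg (fun f => f.left y) ht
  rw [over_comp_left_apply, over_comp_left_apply, hy] at h1
  exact h1

/-- Being a closed immersion is local on the target. Over the chart of g the morphism is the
spectrum of the quotient by `normEquation`, provided the preimage of this chart is the chart of g in
X. -/
theorem isClosedImmersion_of_charts
    (hε : ∀ g, ε.hom.app _ (k g) = normChart hA g) {SB : Over (Spec (.of F))}
    (δ : functorOfPoints F SB ≅ (severiBrauer F (Matrix (Fin 2) (Fin 2) A) (2 * n) n).toFunctor)
    (l : (Matrix (Fin 2) (Fin 2) A)ˣ → (specOver (coordAlg F A) ⟶ SB))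
    (hδ : ∀ g, δ.hom.app _ (l g) = sbPoint hA g (generic F A)) (i : X ⟶ SB)
    (hi : ∀ (R : CommAlgCat.{u} F) (x : specOver R ⟶ X),
      δ.hom.app R (x ≫ i) = (ε.hom.app R x).1)
    (hk : ∀ g, IsOpenImmersion (k g).left) (hcov : ∀ x : X.left, ∃ g y, (k g).left y = x)
    (hl : ∀ g, IsOpenImmersion (l g).left) (hcov' : ∀ x : SB.left, ∃ g y, (l g).left y = x) :
    IsClosedImmersion i.left := by
  have hcomm : ∀ g, k g ≫ i = specMap (normAlgMk F A n g.1) ≫ l g := by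
    intro g
    apply ((isIso_iff_bijective (δ.hom.app _)).1 inferInstance).1
    refine (hi _ _).trans ((congrArg Subtype.val (hε g)).trans ?_)
    refine Eq.trans ?_ (app_specMap_comp δ.hom (normAlgMk F A n g.1) (l g)).symm
    rw [hδ, severiBrauer_map_sbPoint]
    rfl
  -- Checked on geometric points: an ideal in the norm section of the form [g(1, x)] satisfies the
  -- norm equation in that presentation, so it is a point of the chart of g in X.
  have hpre : ∀ g, i.left ⁻¹ᵁ (l g).left.opensRange = (k g).left.opensRange := by
    intro g
    ext x
    constructor
    · intro hx
      obtain ⟨h, p, rfl⟩ := hcov x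
      obtain ⟨K, _, _, _, π, hker⟩ := exists_isAlgClosed_hom_ker_eq (F := F)
        (show PrimeSpectrum (normAlg F A n h.1) from p).asIdeal
      let π' : normAlg F A n h.1 ⟶ .of F K := CommAlgCat.ofHom π
      have hπ : ∀ y : PrimeSpectrum K, (specMap π').left y = p := by
        intro y
        change PrimeSpectrum.comap π.toRingHom y = (show PrimeSpectrum (normAlg F A n h.1) from p)
        refine PrimeSpectrum.ext ?_
        rw [PrimeSpectrum.comap_asIdeal, ← hker, Subsingleton.elim y ⊥]
        rfl
      obtain ⟨t, ht⟩ := exists_comp_eq_of_range_subset (l g) (specMap π' ≫ k h ≫ i) (by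
        rintro _ ⟨y, rfl⟩
        rw [over_comp_left_apply, over_comp_left_apply, hπ y]
        exact hx)
      obtain ⟨ψ, rfl⟩ := exists_specMap_eq t
      obtain ⟨t', ht'⟩ := exists_comp_chart_eq hA ε k hε (specMap π' ≫ k h) g
        (x := baseMap A ψ.hom (generic F A)) (by
          refine (hi _ _).symm.trans ?_
          rw [Category.assoc, ← ht, app_specMap_comp, hδ, severiBrauer_map_sbPoint])
      refine ⟨t'.left (⊥ : PrimeSpectrum K), ?_⟩
      refine (over_comp_left_apply t' (k g) _).symm.trans ?_
      rw [ht']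
      refine (over_comp_left_apply (specMap π') (k h) _).trans ?_
      rw [hπ ⊥]
    · rintro ⟨y, rfl⟩
      refine ⟨(specMap (normAlgMk F A n g.1)).left y, ?_⟩
      have h1 := congrArg (fun f => f.left y) (hcomm g)
      rw [over_comp_left_apply, over_comp_left_apply] at h1
      exact h1.symm
  let U : SB.left.OpenCover := Scheme.Cover.mkOfCovers _ (fun _ => (specOver (coordAlg F A)).left)
    (fun g => (l g).left) hcov' hl
  refine IsZariskiLocalAtTarget.of_openCover U fun g => ?_
  have := hk g
  have := hl g
  have hmk : IsClosedImmersion (specMap (normAlgMk F A n g.1)).left :=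
    IsClosedImmersion.spec_of_surjective _
      (Ideal.Quotient.mk_surjective (I := Ideal.span {normEquation F A n g.1}))
  have hpb := IsOpenImmersion.isPullback (specMap (normAlgMk F A n g.1)).left (k g).left
    (l g).left i.left (congrArg (fun f => f.left) (hcomm g)) (hpre g)
  change IsClosedImmersion (Limits.pullback.snd i.left (l g).left)
  rw [← hpb.flip.isoPullback_inv_snd]
  infer_instance

end Geometry

end Representability

end

end SeveriBrauer

/-! ### The theorem -/

theorem mainTheorem8 {F : Type u} [Field F] [PerfectField F]
    {A : Type u} [Ring A] [Algebra F A] [FiniteDimensional F A]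
    [Algebra.IsCentral F A] [IsSimpleRing A]
    (n : ℕ) (hA : Module.finrank F A = n ^ 2) (hn : n = 2 ∨ n = 3) :
    ∃ (SB X G : Over (Spec (.of F)))
      (eSB : SeveriBrauer.functorOfPoints F SB ≅
        (SeveriBrauer.severiBrauer F (Matrix (Fin 2) (Fin 2) A) (2 * n) n).toFunctor)
      (eX : SeveriBrauer.functorOfPoints F X ≅ (SeveriBrauer.normSection F A n).toFunctor)
      (eG : SeveriBrauer.functorOfPoints F G ≅ (SeveriBrauer.specialLinear F A n).toFunctor)
      (i : X ⟶ SB) (j : G ⟶ X),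
      -- `X` is a closed subscheme of `SB`
      IsClosedImmersion i.left ∧
      (∀ (R : CommAlgCat.{u} F) (x : (SeveriBrauer.functorOfPoints F X).obj R),
        eSB.hom.app R (x ≫ i) = (eX.hom.app R x).1) ∧
      Smooth X.hom ∧
      -- `j` is the morphism `g ↦ [1, g]`
      (∀ (R : CommAlgCat.{u} F) (g : (SeveriBrauer.functorOfPoints F G).obj R),
        (eX.hom.app R (g ≫ j)).1.1.toSubmodule =
          SeveriBrauer.columnIdeal 1 (eG.hom.app R g).1) ∧
      IsOpenImmersion j.left ∧ DenseRange j.left := by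
  obtain ⟨SB, eSB, l, hl, hlcov, hlpt, -⟩ :=
    (SeveriBrauer.severiBrauer_isAtlas hA
      (SeveriBrauer.severiBrauer_locallyCovered hA)).exists_scheme
        (SeveriBrauer.severiBrauer_isZariskiSheaf _ _)
  obtain ⟨X, eX, k, hk, hkcov, hkpt, hX⟩ :=
    (SeveriBrauer.normSection_isAtlas hA).exists_scheme
      (SeveriBrauer.normSection_isZariskiSheaf hA)
  obtain ⟨eG, hG⟩ := SeveriBrauer.exists_specialLinear_iso hA
  obtain ⟨i, hi⟩ := hX SB (eX.hom ≫ (SeveriBrauer.normSection F A n).ι ≫ eSB.inv)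
  have hi' : ∀ (R : CommAlgCat.{u} F) (x : (SeveriBrauer.functorOfPoints F X).obj R),
      eSB.hom.app R (x ≫ i) = (eX.hom.app R x).1 := by
    intro R x
    rw [← hi]
    simp
  -- The scheme representing SL₁(A) is the chart of X at g = 1, and j is the chart morphism `k 1`.
  refine ⟨SB, X, _, eSB, eX, eG, i, k 1,
    SeveriBrauer.isClosedImmersion_of_charts hA eX k hkpt eSB l hlpt i hi' hk hkcov hl hlcov, hi',
    SeveriBrauer.smooth_of_isOpenImmersion_cover (SeveriBrauer.smooth_normAlg hA hn) k hk hkcov,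
    fun R g => ?_, hk 1, SeveriBrauer.denseRange_chart_one hA eX k hkpt hkcov⟩
  obtain ⟨φ, rfl⟩ := SeveriBrauer.exists_specMap_eq g
  rw [hG]
  refine (congrArg (fun J => J.1.toSubmodule)
    (SeveriBrauer.app_specMap_chart hA eX k hkpt 1 φ)).trans ?_
  exact congrArg₂ SeveriBrauer.columnIdeal (SeveriBrauer.chartTop_one _)
    (SeveriBrauer.chartBot_one _)
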